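/- Let $\Omega\subset\mathbb R^3$ be a nonempty bounded open set with $C^2$ boundary, let $g\in L^1_{loc}(\Omega)^3$ (for instance $g\in L^2(\Omega)^3$), and let $f\in C^2(\mathbb R^3,\mathbb R^3)$ satisfy, for some constants $K,C,\kappa>0$ and $r\ge1$, $$f'(u)v\cdot v\ \ge\ (-K+\kappa|u|^{r-1})|v|^2,\qquad |f'(u)|\le C(1+|u|^{r-1})\qquad\text{for all }u,v\in\mathbb R^3 .$$ Let $\mathcal V$ be the set of divergence-free vector fields in $C_0^\infty(\Omega)^3$, and let $H$ and $V$ be the closures of $\mathcal V$ in $L^2(\Omega)^3$ and in $H^1(\Omega)^3$, respectively. Let $(\cdot,\cdot)$ be the inner product of $L^2(\Omega)$. A weak solution of the Brinkman-Forchheimer equations $$\partial_t u-\Delta u+f(u)+\nabla p=g,\quad \operatorname{div}u=0,\quad u|_{\partial\Omega}=0$$ is a function $u\in C([0,\infty),H)\cap L^2_{loc}([0,\infty),V)\cap L^{r+1}_{loc}([0,\infty),L^{r+1}(\Omega)^3)$ such that $$-\int_0^\infty(u(t),\partial_t\varphi(t))\,dt=\int_0^\infty\big[-(\nabla u(t),\nabla\varphi(t))-(f(u(t)),\varphi(t))+(g,\varphi(t))\big]\,dt$$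 for all $\varphi\in C_0^\infty((0,\infty)\times\Omega)^3$ with $\operatorname{div}\varphi(t)=0$ for all $t$. The Stokes operator $-\Pi\Delta$ (where $\Pi$ is the orthogonal projection of $L^2(\Omega)^3$ onto $H$) maps $w\in V$ to $h\in H$ when $(\nabla w,\nabla\varphi)=(h,\varphi)$ for all $\varphi\in\mathcal V$. It has a smallest eigenvalue $\lambda_1$, and $\lambda_1>0$. Then weak solutions are unique: two weak solutions $u_1,u_2$ with the same initial value $u_1(0)=u_2(0)$ coincide for all $t\ge0$. Moreover, any two weak solutions $u_1,u_2$ (with possibly different initial values) satisfy $$\|u_1(t)-u_2(t)\|_{L^2}\le e^{(K-\lambda_1)t}\,\|u_1(0)-u_2(0)\|_{L^2}\qquad\text{for all }t\ge0 .$$ -/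

import Mathlib

open MeasureTheory Set

noncomputable section

namespace BrinkmanForchheimer

/-- Three-dimensional Euclidean space `ℝ³`. -/
abbrev E3 : Type := EuclideanSpace ℝ (Fin 3)

/-- The values of gradients of vector fields: the `j`-th entry is the `j`-th partial derivative.
The norm and the inner product are the Frobenius ones. -/
abbrev Mat3 : Type := PiLp 2 (fun _ : Fin 3 => E3)

/-- The `j`-th standard basis vector of `ℝ³`. -/
def e (j : Fin 3) : E3 := EuclideanSpace.single j 1

/-- `Ω` has a `C²` boundary: near each of its boundary points, and in suitable Cartesian
coordinates, `Ω` is the set of points lying strictly above the graph of a `C²` function of two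
variables. -/
def HasC2Boundary (Ω : Set E3) : Prop :=
  ∀ x₀ ∈ frontier Ω, ∃ (R : E3 ≃ₗᵢ[ℝ] E3) (γ : EuclideanSpace ℝ (Fin 2) → ℝ) (ρ : ℝ),
    ContDiff ℝ 2 γ ∧ 0 < ρ ∧
      ∀ x ∈ Metric.ball x₀ ρ,
        (x ∈ Ω ↔ γ !₂[R (x - x₀) 0, R (x - x₀) 1] < R (x - x₀) 2)

/-- The structural assumptions on the nonlinearity `f`. -/
structure NonlinearityCond (f : E3 → E3) (K C κ r : ℝ) : Prop where
  contDiff : ContDiff ℝ 2 f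
  monotone : ∀ u v : E3, (-K + κ * ‖u‖ ^ (r - 1)) * ‖v‖ ^ 2 ≤ inner ℝ (fderiv ℝ f u v) v
  growth : ∀ u : E3, ‖fderiv ℝ f u‖ ≤ C * (1 + ‖u‖ ^ (r - 1))

/-- The (classical) gradient of a vector field. -/
def grad (φ : E3 → E3) (x : E3) : Mat3 := WithLp.toLp 2 (fun j => fderiv ℝ φ x (e j))

/-- The (classical) divergence of a vector field. -/
def divergence (φ : E3 → E3) (x : E3) : ℝ := ∑ j, fderiv ℝ φ x (e j) j

/-- The space `[L²(Ω)]³`. -/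
abbrev L2 (Ω : Set E3) : Type := Lp E3 2 (volume.restrict Ω)

/-- The space `[L²(Ω)]^{3 × 3}`, to which gradients of `H¹` vector fields belong. -/
abbrev L2Grad (Ω : Set E3) : Type := Lp Mat3 2 (volume.restrict Ω)

/-- The set `𝒱` of smooth divergence-free vector fields with compact support in `Ω`. -/
def testFields (Ω : Set E3) : Set (E3 → E3) :=
  {φ | ContDiff ℝ (⊤ : ℕ∞) φ ∧ HasCompactSupport φ ∧ tsupport φ ⊆ Ω ∧ ∀ x, divergence φ x = 0}

/-- `H`: the closure of `𝒱` in `L²(Ω)`. -/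
def spaceH (Ω : Set E3) : Set (L2 Ω) :=
  closure {w | ∃ φ ∈ testFields Ω, w =ᵐ[volume.restrict Ω] φ}

/-- `G` is the weak (distributional) gradient of `w` in `Ω`. -/
def HasWeakGrad (Ω : Set E3) (w : L2 Ω) (G : L2Grad Ω) : Prop :=
  ∀ ψ : E3 → ℝ, ContDiff ℝ (⊤ : ℕ∞) ψ → HasCompactSupport ψ → tsupport ψ ⊆ Ω → ∀ j : Fin 3,
    ∫ x in Ω, fderiv ℝ ψ x (e j) • w x = -∫ x in Ω, ψ x • G x j

/-- `V = H¹`: the closure of `𝒱` in the Sobolev space `H¹(Ω)`. An element `w` of `H¹(Ω)` is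
represented by the pair `(w, ∇w)` of `L²` functions, so that the `H¹` topology is the product
topology. -/
def spaceV (Ω : Set E3) : Set (L2 Ω × L2Grad Ω) :=
  {p | HasWeakGrad Ω p.1 p.2} ∩
    closure {p | ∃ φ ∈ testFields Ω,
      p.1 =ᵐ[volume.restrict Ω] φ ∧ p.2 =ᵐ[volume.restrict Ω] grad φ}

/-- `w` belongs to the domain of the Stokes operator `-ΠΔ` (with Dirichlet conditions), which maps
`w` to `h`: `w ∈ V`, `h ∈ H`, and `(∇w, ∇φ) = (h, φ)` for all divergence-free test fields `φ`. -/
def IsStokes (Ω : Set E3) (w h : L2 Ω) : Prop :=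
  h ∈ spaceH Ω ∧ ∃ G : L2Grad Ω, (w, G) ∈ spaceV Ω ∧
    ∀ φ ∈ testFields Ω, ∫ x in Ω, inner ℝ (G x) (grad φ x) = ∫ x in Ω, inner ℝ (h x) (φ x)

/-- The set of all eigenvalues of the Stokes operator. -/
def stokesEigenvalues (Ω : Set E3) : Set ℝ :=
  {μ | ∃ w : L2 Ω, w ≠ 0 ∧ IsStokes Ω w (μ • w)}

/-- The smooth vector fields with compact support in `(0, ∞) × Ω` that are divergence-free at
each time. -/
def spaceTimeTestFields (Ω : Set E3) : Set (ℝ × E3 → E3) :=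
  {φ | ContDiff ℝ (⊤ : ℕ∞) φ ∧ HasCompactSupport φ ∧ tsupport φ ⊆ Ioi 0 ×ˢ Ω ∧
    ∀ t x, divergence (fun y => φ (t, y)) x = 0}

/-- `u` is a weak solution of the Brinkman-Forchheimer equations in `Ω`. Only the values `u t` with
`0 ≤ t` matter. The function `G` is the gradient of `u`. -/
structure IsWeakSolution (Ω : Set E3) (r : ℝ) (f g : E3 → E3) (u : ℝ → L2 Ω) : Prop where
  /-- `u ∈ C([0, ∞), H)` -/
  continuousOn : ContinuousOn u (Ici 0)
  mem_spaceH : ∀ t, 0 ≤ t → u t ∈ spaceH Ω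
  /-- `u` is locally in `L^{r+1}([0, ∞), L^{r+1}(Ω))` -/
  eLpNorm_lt_top : ∀ T : ℝ, 0 < T →
    ∫⁻ t in Ioo 0 T, eLpNorm (u t) (ENNReal.ofReal (r + 1)) (volume.restrict Ω) ^ (r + 1) < ⊤
  /-- `u` is locally in `L²([0, ∞), V)`, and the equation holds in the sense of distributions -/
  weak_equation : ∃ G : ℝ → L2Grad Ω,
    (∀ᵐ t ∂(volume.restrict (Ioi (0 : ℝ))), (u t, G t) ∈ spaceV Ω) ∧
    (∀ T : ℝ, 0 < T → MemLp G 2 (volume.restrict (Ioo 0 T))) ∧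
    ∀ φ ∈ spaceTimeTestFields Ω,
      -∫ t in Ioi (0 : ℝ), ∫ x in Ω, inner ℝ (u t x) (deriv (fun s => φ (s, x)) t) =
        ∫ t in Ioi (0 : ℝ),
          (-(∫ x in Ω, inner ℝ (G t x) (grad (fun y => φ (t, y)) x))
            - (∫ x in Ω, inner ℝ (f (u t x)) (φ (t, x)))
            + ∫ x in Ω, inner ℝ (g x) (φ (t, x)))

end BrinkmanForchheimer

end

noncomputable section

namespace BrinkmanForchheimer

open Filter Topology
open scoped ENNReal NNReal ContDiff

/-! Formally, test the equation for `w = u₁ - u₂` with `w` itself: `½ d/dt ‖w‖² + ‖∇w‖² + (f(u₁) -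
f(u₂), w) = 0`, where the pressure and `g` have dropped out. The lower bound on `f'` gives `(f(u₁) -
f(u₂), w) ≥ -K ‖w‖²` (`neg_mul_le_inner_sub`), the variational characterization of `λ₁` gives `‖∇w‖²
≥ λ₁ ‖w‖²`, and Gronwall gives the exponential bound. Uniqueness is the case of equal initial
values. Three points need an argument.

Space: `w(t)` lies in `V ∩ L^{r+1}`, while `f(u)` is only in the dual space `L^q`, `q = (r+1)/r`.
Test fields converging to `w(t)` in `H¹` need not be bounded in `L^{r+1}`, so approximation must be
simultaneous (`exists_testFields_approx`). A smooth field `X` points into `Ω` along the boundary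
(`exists_inward_field`). The field is pushed forward by `Φ = id + ε X` as `DΦ v` times the
transported volume, which preserves zero divergence, and is then mollified at a scale `δ`
proportional to `ε`, small enough to keep the support in `Ω`. The result is bounded in every `L^P`
with `1 ≤ P < ∞`, its gradient is bounded in `L²` because `ε/δ` is bounded, and it converges weakly.
Weak convergence suffices, since only a linear identity has to be extended (`annihilator_extends`).

Time: `w` is only continuous into `L²`. The equation is first integrated to an increment formula
(`sub_eq_integral_of_weak_deriv`, `exists_forces`). Testing the increment over `[x, x+h]` with
`w(x+h) + w(x)` produces `‖w(x+h)‖² - ‖w(x)‖²`; averaging over `x`, dividing by `h` and letting `h →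
0` gives the energy identity, by continuity of translations in Lebesgue spaces (`energy_identity`).

Spectrum: Rellich compactness on the closure of the test fields yields a minimizer of the Rayleigh
quotient (`exists_rayleigh_minimizer`). Its Euler-Lagrange equation is the Stokes eigenvalue
equation, and Poincaré's inequality makes the minimum positive. -/

/-! ### A smooth field pointing into the domain. -/

theorem exists_pos_le_of_finset {ι : Type*} (s : Finset ι) (a : ι → ℝ) (ha : ∀ i, 0 < a i) :
    ∃ c, 0 < c ∧ ∀ i ∈ s, c ≤ a i := by
  classical
  induction s using Finset.induction_on with
  | empty => exact ⟨1, one_pos, by simp⟩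
  | insert i s _ ih =>
    obtain ⟨c, hc, h⟩ := ih
    refine ⟨min c (a i), lt_min hc (ha i), fun j hj => ?_⟩
    rcases Finset.mem_insert.1 hj with rfl | hj
    · exact min_le_right _ _
    · exact (min_le_left _ _).trans (h j hj)

/-- Moving the points of `Ω` near `x₀` in the direction `d` moves them into `Ω`, uniformly. -/
def IsInwardNear (Ω : Set E3) (x₀ d : E3) (ρ c ε₀ : ℝ) : Prop :=
  ∀ x ∈ Ω, x ∈ Metric.ball x₀ ρ → ∀ ε, 0 < ε → ε < ε₀ → Metric.ball (x + ε • d) (c * ε) ⊆ Ω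

theorem norm_vec2_le (v : E3) : ‖(!₂[v 0, v 1] : EuclideanSpace ℝ (Fin 2))‖ ≤ ‖v‖ := by
  rw [EuclideanSpace.norm_eq, EuclideanSpace.norm_eq]
  apply Real.sqrt_le_sqrt
  simp [Fin.sum_univ_three, Fin.sum_univ_two]
  positivity

/-- The direction `d` is the vertical one of the boundary chart. Near the centre `γ` is Lipschitz
with constant `L`. After raising a point of `Ω` by `ε`, a further displacement `k` lowers the height
above the graph by at most `(1 + L) ‖k‖`, which is less than `ε` if `‖k‖ < ε / (1 + L)`. -/
theorem HasC2Boundary.exists_isInwardNear {Ω : Set E3} (hΩ : HasC2Boundary Ω) {x₀ : E3}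
    (hx₀ : x₀ ∈ frontier Ω) :
    ∃ (d : E3) (ρ c ε₀ : ℝ), ‖d‖ ≤ 1 ∧ 0 < ρ ∧ 0 < c ∧ 0 < ε₀ ∧ IsInwardNear Ω x₀ d ρ c ε₀ := by
  obtain ⟨R, γ, ρ, hγ, hρ, h⟩ := hΩ x₀ hx₀
  obtain ⟨L, t, ht, hL⟩ := (hγ.of_le (by norm_num : (1 : WithTop ℕ∞) ≤ 2)).contDiffAt
    (x := (0 : EuclideanSpace ℝ (Fin 2))) |>.exists_lipschitzOnWith
  obtain ⟨σ, hσ, hσt⟩ := Metric.mem_nhds_iff.1 ht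
  have hL0 : (0 : ℝ) ≤ L := L.2
  set τ := min ρ σ with hτ
  have hτ0 : 0 < τ := lt_min hρ hσ
  set c : ℝ := 1 / (1 + L) with hc
  have hc0 : 0 < c := by positivity
  have hc1 : c ≤ 1 := by rw [hc, div_le_one (by positivity)]; linarith
  have hcL : c * (1 + L) = 1 := by rw [hc]; field_simp
  set d : E3 := R.symm (e 2) with hd
  have hnd : ‖d‖ = 1 := by rw [hd, LinearIsometryEquiv.norm_map, e]; simp
  -- The budget is `τ/2 + τ/4 + c τ/4 ≤ τ`: the point, its shift and the extra displacement all stay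
  -- where the chart and the Lipschitz bound are valid.
  refine ⟨d, τ / 2, c, τ / 4, hnd.le, by positivity, hc0, by positivity, ?_⟩
  intro x hxΩ hx ε hε hε' z hz
  rw [Metric.mem_ball, dist_eq_norm] at hx hz
  set k := z - (x + ε • d) with hk
  have hzx : z - x₀ = (x - x₀) + ε • d + k := by rw [hk]; abel
  have hzn : ‖z - x₀‖ < τ := by
    rw [hzx]
    have h1 := norm_add_le ((x - x₀) + ε • d) k
    have h2 := norm_add_le (x - x₀) (ε • d)
    rw [norm_smul, hnd, Real.norm_of_nonneg hε.le] at h2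
    nlinarith
  have hxn : ‖x - x₀‖ < τ := by linarith
  have hR : R (z - x₀) = R (x - x₀) + ε • e 2 + R k := by
    rw [hzx, map_add, map_add, map_smul, hd, LinearIsometryEquiv.apply_symm_apply]
  have hRk : ‖R k‖ = ‖k‖ := R.norm_map k
  have e20 : (e 2 : E3) 0 = 0 := by simp [e]
  have e21 : (e 2 : E3) 1 = 0 := by simp [e]
  have e22 : (e 2 : E3) 2 = 1 := by simp [e]
  have c0 : R (z - x₀) 0 = R (x - x₀) 0 + R k 0 := by rw [hR]; simp [e20]
  have c1 : R (z - x₀) 1 = R (x - x₀) 1 + R k 1 := by rw [hR]; simp [e21]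
  have c2 : R (z - x₀) 2 = R (x - x₀) 2 + ε + R k 2 := by rw [hR]; simp [e22]
  have hzρ : z ∈ Metric.ball x₀ ρ := by
    rw [Metric.mem_ball, dist_eq_norm]; exact hzn.trans_le (min_le_left _ _)
  have hxρ : x ∈ Metric.ball x₀ ρ := by
    rw [Metric.mem_ball, dist_eq_norm]; exact hxn.trans_le (min_le_left _ _)
  rw [h z hzρ]
  have hxγ := (h x hxρ).1 hxΩ
  have hmem : ∀ y : E3, ‖y - x₀‖ < τ →
      (!₂[R (y - x₀) 0, R (y - x₀) 1] : EuclideanSpace ℝ (Fin 2)) ∈ t := fun y hy => by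
    apply hσt
    rw [mem_ball_zero_iff]
    refine (norm_vec2_le _).trans_lt ?_
    rw [R.norm_map]
    exact hy.trans_le (min_le_right _ _)
  have hlip := hL.dist_le_mul _ (hmem z hzn) _ (hmem x hxn)
  have hdiff : (!₂[R (z - x₀) 0, R (z - x₀) 1] : EuclideanSpace ℝ (Fin 2))
      - !₂[R (x - x₀) 0, R (x - x₀) 1] = !₂[R k 0, R k 1] := by
    ext i
    fin_cases i
    · exact sub_eq_iff_eq_add'.2 c0
    · exact sub_eq_iff_eq_add'.2 c1
  rw [dist_eq_norm, dist_eq_norm, hdiff] at hlip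
  have h3 := norm_vec2_le (R k)
  have h4 : ‖R k 2‖ ≤ ‖R k‖ := PiLp.norm_apply_le _ _
  rw [Real.norm_eq_abs] at hlip h4
  have h5 := (abs_le.1 h4).1
  have h6 := (abs_le.1 hlip).2
  have h7 : (L : ℝ) * ‖(!₂[R k 0, R k 1] : EuclideanSpace ℝ (Fin 2))‖ ≤ L * ‖k‖ := by
    apply mul_le_mul_of_nonneg_left _ hL0
    rw [← hRk]; exact h3
  have h8 : (1 + (L : ℝ)) * ‖k‖ < ε := by
    calc (1 + (L : ℝ)) * ‖k‖ < (1 + L) * (c * ε) := by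
          apply mul_lt_mul_of_pos_left hz; positivity
      _ = ε := by rw [← mul_assoc, mul_comm (1 + (L : ℝ)), hcL, one_mul]
  rw [c2]
  rw [hRk] at h5
  linarith

/-- The field is a sum of the chart directions weighted by bumps. Directions of different charts
need no comparison: the displacements are added one at a time, each moving a point of `Ω` near its
chart centre to another point of `Ω`. The gain `c ε` comes from a chart whose bump equals one;
points away from the boundary have room of fixed size. -/
theorem exists_inward_field {Ω : Set E3} (hΩo : IsOpen Ω) (hΩb : Bornology.IsBounded Ω)
    (hΩ : HasC2Boundary Ω) :
    ∃ X : E3 → E3, ContDiff ℝ ∞ X ∧ HasCompactSupport X ∧ ∃ c ε₀ : ℝ, 0 < c ∧ 0 < ε₀ ∧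
      ∀ ε, 0 < ε → ε < ε₀ → ∀ y ∈ Ω, Metric.ball (y + ε • X y) (c * ε) ⊆ Ω := by
  classical
  have key : ∀ x : E3, ∃ (d : E3) (ρ c ε₀ : ℝ), ‖d‖ ≤ 1 ∧ 0 < ρ ∧ 0 < c ∧ 0 < ε₀ ∧
      (x ∈ frontier Ω → IsInwardNear Ω x d ρ c ε₀) := fun x => by
    by_cases hx : x ∈ frontier Ω
    · obtain ⟨d, ρ, c, ε₀, h1, h2, h3, h4, h5⟩ := hΩ.exists_isInwardNear hx
      exact ⟨d, ρ, c, ε₀, h1, h2, h3, h4, fun _ => h5⟩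
    · exact ⟨0, 1, 1, 1, by simp, one_pos, one_pos, one_pos, fun h => absurd h hx⟩
  choose d ρ c ε₀ hd hρ hc hε₀ hin using key
  have hcomp : IsCompact (frontier Ω) :=
    Metric.isCompact_of_isClosed_isBounded isClosed_frontier
      (hΩb.closure.subset frontier_subset_closure)
  obtain ⟨s, hsΩ, hs⟩ := hcomp.elim_nhds_subcover (fun x => Metric.ball x (ρ x / 4))
    (fun x _ => Metric.ball_mem_nhds _ (by have := hρ x; positivity))
  let χ : ∀ i : E3, ContDiffBump i := fun i =>
    ⟨ρ i / 4, ρ i / 2, by have := hρ i; positivity, by have := hρ i; linarith⟩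
  obtain ⟨c', hc'0, hc'⟩ := exists_pos_le_of_finset s c hc
  -- `ε M` bounds the whole displacement: at most `ε` from each bump, `c' ε` for the ball around the
  -- image, and a spare `ε`.
  set M : ℝ := s.card + 1 + c' with hM
  have hM0 : 0 < M := by positivity
  obtain ⟨ε', hε'0, hε'⟩ := exists_pos_le_of_finset s (fun i => min (ε₀ i) (ρ i / 2 / M))
    (fun i => lt_min (hε₀ i) (by have := hρ i; positivity))
  set K := closure Ω \ ⋃ x ∈ s, Metric.ball x (ρ x / 4) with hK
  have hKc : IsCompact K := by
    refine (Metric.isCompact_of_isClosed_isBounded isClosed_closure hΩb.closure).diff ?_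
    exact isOpen_biUnion fun _ _ => Metric.isOpen_ball
  have hKΩ : K ⊆ Ω := by
    rintro x ⟨hx, hx'⟩
    by_contra hxΩ
    exact hx' (hs ⟨hx, by rwa [hΩo.interior_eq]⟩)
  obtain ⟨m, hm, hmK⟩ := hKc.exists_thickening_subset_open hΩo hKΩ
  set X : E3 → E3 := fun y => ∑ i ∈ s, (χ i y) • d i with hX
  have hsum : ∀ y : E3, ∀ s' ⊆ s, ‖∑ i ∈ s', (χ i y) • d i‖ ≤ s.card := fun y s' hs' => by
    refine (norm_sum_le _ _).trans ?_
    refine (Finset.sum_le_card_nsmul s' _ 1 fun i _ => ?_).trans ?_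
    · rw [norm_smul, Real.norm_of_nonneg (χ i).nonneg]
      exact mul_le_one₀ (χ i).le_one (norm_nonneg _) (hd i)
    · simpa using Finset.card_le_card hs'
  refine ⟨X, ?_, ?_, c', min ε' (m / M), hc'0, lt_min hε'0 (by positivity), ?_⟩
  · exact ContDiff.sum fun i _ => (χ i).contDiff.smul contDiff_const
  · have : X = ∑ i ∈ s, fun y => (χ i y) • d i := by ext1 y; simp [hX]
    rw [this]
    exact HasCompactSupport.finset_sum fun i _ => (χ i).hasCompactSupport.smul_right
  intro ε hε hεε y hy
  have hε1 : ε < ε' := hεε.trans_le (min_le_left _ _)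
  have hε2 : ε * M < m := by
    rw [← lt_div_iff₀ hM0]; exact hεε.trans_le (min_le_right _ _)
  have hεi : ∀ i ∈ s, ε < ε₀ i ∧ ε * M < ρ i / 2 := fun i hi => by
    have h1 := hε1.trans_le (hε' i hi)
    refine ⟨h1.trans_le (min_le_left _ _), ?_⟩
    rw [← lt_div_iff₀ hM0]; exact h1.trans_le (min_le_right _ _)
  -- Induction on the charts already used: partial sums stay in `Ω`, and once a chart with bump
  -- value one has been used a whole ball is gained, which later charts preserve.
  have step : ∀ s' : Finset E3, s' ⊆ s → y + ε • (∑ i ∈ s', (χ i y) • d i) ∈ Ω ∧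
      ((∃ i ∈ s', χ i y = 1) →
        Metric.ball (y + ε • (∑ i ∈ s', (χ i y) • d i)) (c' * ε) ⊆ Ω) := by
    intro s'
    induction s' using Finset.induction_on with
    | empty => intro _; simpa using hy
    | insert i s' hi ih =>
      intro hs'
      have his : i ∈ s := hs' (Finset.mem_insert_self _ _)
      have hs's : s' ⊆ s := (Finset.subset_insert _ _).trans hs'
      obtain ⟨ih1, ih2⟩ := ih hs's
      rw [Finset.sum_insert hi]
      rcases ((χ i).nonneg (x := y)).eq_or_lt with h0 | h0
      · rw [← h0, zero_smul, zero_add]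
        refine ⟨ih1, ?_⟩
        rintro ⟨j, hj, hj1⟩
        rcases Finset.mem_insert.1 hj with rfl | hj
        · rw [← h0] at hj1; norm_num at hj1
        · exact ih2 ⟨j, hj, hj1⟩
      · have hyi : ‖y - i‖ < ρ i / 2 := by
          rw [← dist_eq_norm]
          by_contra hcon
          exact h0.ne' ((χ i).zero_of_le_dist (not_lt.1 hcon))
        obtain ⟨hεi1, hεi2⟩ := hεi i his
        set Y := y + ε • (∑ i ∈ s', (χ i y) • d i) with hY
        have heq : y + ε • ((χ i y) • d i + ∑ i ∈ s', (χ i y) • d i)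
            = Y + (ε * χ i y) • d i := by rw [hY, smul_add, mul_smul]; abel
        rw [heq]
        have hpos : 0 < ε * χ i y := mul_pos hε h0
        have hle : ε * χ i y ≤ ε := mul_le_of_le_one_right hε.le (χ i).le_one
        have hnear : ∀ z : E3, ‖z - Y‖ < c' * ε + ε → z ∈ Metric.ball i (ρ i) := fun z hz => by
          rw [Metric.mem_ball, dist_eq_norm]
          have h1 : z - i = (z - Y) + (y - i) + ε • (∑ i ∈ s', (χ i y) • d i) := by
            rw [hY]; abel
          rw [h1]
          have h2 := norm_add₃_le (a := z - Y) (b := y - i)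
            (c := ε • (∑ i ∈ s', (χ i y) • d i))
          have h3 := mul_le_mul_of_nonneg_left (hsum y s' hs's) hε.le
          rw [norm_smul ε, Real.norm_of_nonneg hε.le] at h2
          rw [hM] at hεi2
          nlinarith
        have hYb : Y ∈ Metric.ball i (ρ i) := hnear Y (by simp; positivity)
        have hin' := hin i (hsΩ i his)
        have hb := hin' Y ih1 hYb _ hpos (hle.trans_lt hεi1)
        refine ⟨hb (Metric.mem_ball_self (mul_pos (hc i) hpos)), ?_⟩
        rintro ⟨j, hj, hj1⟩
        rcases Finset.mem_insert.1 hj with rfl | hj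
        · rw [hj1, mul_one] at hb ⊢
          exact (Metric.ball_subset_ball (mul_le_mul_of_nonneg_right (hc' _ his) hε.le)).trans hb
        -- The ball was gained earlier: each of its points, translated back, lies in `Ω` near `i`,
        -- so the current chart moves it into `Ω` again.
        · intro z hz
          rw [Metric.mem_ball, dist_eq_norm] at hz
          have hz1 : ‖z - (ε * χ i y) • d i - Y‖ < c' * ε := by
            rwa [show z - (ε * χ i y) • d i - Y = z - (Y + (ε * χ i y) • d i) by abel]
          have hzΩ : z - (ε * χ i y) • d i ∈ Ω := ih2 ⟨j, hj, hj1⟩ (by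
            rwa [Metric.mem_ball, dist_eq_norm])
          have := hin' _ hzΩ (hnear _ (by linarith)) _ hpos (hle.trans_lt hεi1)
          exact this (by simpa using mul_pos (hc i) hpos)
  by_cases hyU : y ∈ ⋃ x ∈ s, Metric.ball x (ρ x / 4)
  · simp only [mem_iUnion] at hyU
    obtain ⟨i, hi, hyi⟩ := hyU
    exact (step s subset_rfl).2 ⟨i, hi, (χ i).one_of_mem_closedBall
      (Metric.ball_subset_closedBall hyi)⟩
  · refine Subset.trans ?_ hmK
    intro z hz
    refine Metric.mem_thickening_iff.2 ⟨y, ⟨subset_closure hy, hyU⟩, ?_⟩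
    rw [Metric.mem_ball, dist_eq_norm] at hz
    rw [dist_eq_norm]
    have h1 : z - y = (z - (y + ε • X y)) + ε • X y := by abel
    rw [h1]
    have h2 := norm_add_le (z - (y + ε • X y)) (ε • X y)
    have h3 := mul_le_mul_of_nonneg_left (hsum y s subset_rfl) hε.le
    rw [norm_smul ε, Real.norm_of_nonneg hε.le] at h2
    rw [hM] at hε2
    have : ε * ‖X y‖ ≤ ε * s.card := h3
    nlinarith

/-! ### Kernel operators -/

theorem MemLp.of_continuous_of_isBounded {Ω : Set E3} (hΩ : Bornology.IsBounded Ω)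
    (hm : MeasurableSet Ω) {F : Type*} [NormedAddCommGroup F] {A : E3 → F} (hA : Continuous A)
    (P : ℝ≥0∞) : MemLp A P (volume.restrict Ω) := by
  have : IsFiniteMeasure (volume.restrict Ω) :=
    isFiniteMeasure_restrict.2 hΩ.measure_lt_top.ne
  obtain ⟨C, hC⟩ := (hΩ.isCompact_closure.exists_bound_of_continuousOn hA.continuousOn)
  exact MemLp.of_bound hA.aestronglyMeasurable C
    ((ae_restrict_iff' hm).2 (Eventually.of_forall fun x hx => hC x (subset_closure hx)))

/-- Makes integral identities with bounded coefficients closed conditions in `L²`, so that they pass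
from test fields to `H` and `V`. -/
theorem continuous_integral_clm_apply {α E F : Type*} [MeasurableSpace α] {μ : Measure α}
    [NormedAddCommGroup E] [NormedSpace ℝ E] [NormedAddCommGroup F] [NormedSpace ℝ F]
    [CompleteSpace F] {A : α → E →L[ℝ] F} (hA : MemLp A 2 μ) :
    Continuous fun w : Lp E 2 μ => ∫ y, A y (w y) ∂μ := by
  have := (((ContinuousLinearMap.id ℝ (E →L[ℝ] F)).lpPairing μ 2 2) hA.toLp).continuous
  convert this using 2 with w
  rw [ContinuousLinearMap.lpPairing_eq_integral]
  refine integral_congr_ae ?_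
  filter_upwards [hA.coeFn_toLp] with y hy
  rw [hy]; rfl

/-- Schur's test for the indicator kernel of `R`: Hölder on each slice costs `a ^ (p - 1)`, and
Tonelli costs `b`. -/
theorem lintegral_rpow_setLIntegral_le {α β : Type*} [MeasurableSpace α] [MeasurableSpace β]
    {μ : Measure α} {ν : Measure β} [SFinite μ] [SFinite ν] {R : Set (α × β)}
    (hR : MeasurableSet R)
    {a b : ℝ≥0∞} (ha : ∀ x, ν {y | (x, y) ∈ R} ≤ a) (hb : ∀ y, μ {x | (x, y) ∈ R} ≤ b)
    {p : ℝ} (hp : 1 ≤ p) {f : β → ℝ≥0∞} (hf : AEMeasurable f ν) :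
    ∫⁻ x, (∫⁻ y in {y | (x, y) ∈ R}, f y ∂ν) ^ p ∂μ ≤ a ^ (p - 1) * b * ∫⁻ y, f y ^ p ∂ν := by
  wlog hf' : Measurable f generalizing f
  · have h1 := this hf.measurable_mk.aemeasurable hf.measurable_mk
    have h2 : ∫⁻ y, f y ^ p ∂ν = ∫⁻ y, hf.mk f y ^ p ∂ν :=
      lintegral_congr_ae (hf.ae_eq_mk.mono fun y hy => by simp only [hy])
    rw [h2]
    refine le_trans (le_of_eq ?_) h1
    refine lintegral_congr fun x => ?_
    rw [lintegral_congr_ae (ae_restrict_of_ae hf.ae_eq_mk)]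
  have hp0 : 0 < p := one_pos.trans_le hp
  have key : ∀ x, (∫⁻ y in {y | (x, y) ∈ R}, f y ∂ν) ^ p ≤
      a ^ (p - 1) * ∫⁻ y, R.indicator (fun z => f z.2 ^ p) (x, y) ∂ν := fun x => by
    have hRx : MeasurableSet {y | (x, y) ∈ R} := measurable_prodMk_left hR
    have h := ENNReal.lintegral_mul_le_Lp_mul_Lq (ν.restrict {y | (x, y) ∈ R})
      (f := f) (g := 1) (p := p) (q := p / (p - 1))
    -- At `p = 1` there is no finite conjugate exponent, and no Hölder step is needed.
    rcases hp.eq_or_lt with rfl | hp1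
    · simp only [ENNReal.rpow_one, sub_self, ENNReal.rpow_zero, one_mul]
      rw [← lintegral_indicator hRx]
      exact le_of_eq rfl
    have hpq : p.HolderConjugate (p / (p - 1)) := Real.HolderConjugate.conjExponent hp1
    have h := h hpq hf'.aemeasurable aemeasurable_const
    simp only [Pi.mul_apply, Pi.one_apply, mul_one, ENNReal.one_rpow, lintegral_const,
      one_mul, Measure.restrict_apply MeasurableSet.univ, univ_inter] at h
    have h2 := ENNReal.rpow_le_rpow h hp0.le
    rw [ENNReal.mul_rpow_of_nonneg _ _ hp0.le, ← ENNReal.rpow_mul, ← ENNReal.rpow_mul,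
      one_div_mul_cancel hp0.ne', ENNReal.rpow_one] at h2
    have hexp : 1 / (p / (p - 1)) * p = p - 1 := by field_simp
    rw [hexp, mul_comm] at h2
    refine h2.trans ?_
    refine mul_le_mul' (ENNReal.rpow_le_rpow (ha x) (by linarith)) ?_
    rw [← lintegral_indicator hRx]
    exact le_of_eq rfl
  refine (lintegral_mono key).trans ?_
  have hmeas : Measurable (R.indicator (fun z : α × β => f z.2 ^ p)) :=
    ((hf'.comp measurable_snd).pow_const p).indicator hR
  rw [lintegral_const_mul _ hmeas.lintegral_prod_right', mul_assoc]
  refine mul_le_mul' le_rfl ?_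
  rw [lintegral_lintegral_swap (f := fun x y => R.indicator (fun z => f z.2 ^ p) (x, y))
    hmeas.aemeasurable, ← lintegral_const_mul _ (hf'.pow_const p)]
  refine lintegral_mono fun y => ?_
  have hRy : MeasurableSet {x | (x, y) ∈ R} := measurable_prodMk_right hR
  have : ∀ x, R.indicator (fun z : α × β => f z.2 ^ p) (x, y) =
      {x | (x, y) ∈ R}.indicator (fun _ => f y ^ p) x := fun x => rfl
  simp only [this]
  rw [lintegral_indicator hRy, setLIntegral_const, mul_comm]
  exact mul_le_mul' (hb y) le_rfl

/-- Boundedness in `L^P` of integral operators whose kernel is of size `δ⁻³` near the graph of an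
expanding map. -/
theorem eLpNorm_integral_le_of_kernel_bound {Ω : Set E3} {F E : Type*} [NormedAddCommGroup F]
    [NormedSpace ℝ F] [NormedAddCommGroup E]
    {Φ : E3 → E3} (hΦc : Continuous Φ) (hΦ : ∀ a b, ‖a - b‖ ≤ 2 * ‖Φ a - Φ b‖)
    {δ M : ℝ} (hδ : 0 < δ) (hM : 0 ≤ M) {P : ℝ≥0∞} (hP1 : 1 ≤ P) (hPt : P ≠ ⊤)
    {J : E3 → E3 → F} {β : E3 → E} (hβ : AEStronglyMeasurable β (volume.restrict Ω))
    (hJ : ∀ x, ∀ᵐ y ∂(volume.restrict Ω), ‖J x y‖ ≤ M / δ ^ 3 * ‖β y‖)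
    (hJ0 : ∀ x y, δ < ‖x - Φ y‖ → J x y = 0) :
    eLpNorm (fun x => ∫ y in Ω, J x y) P volume ≤
      ENNReal.ofReal (M * 64) * volume (Metric.ball (0 : E3) 1) *
        eLpNorm β P (volume.restrict Ω) := by
  set V := volume (Metric.ball (0 : E3) 1) with hV
  set p := P.toReal with hp
  have hP0 : P ≠ 0 := (one_pos.trans_le hP1).ne'
  have hp1 : 1 ≤ p := by
    rw [hp, ← ENNReal.toReal_one]; exact ENNReal.toReal_mono hPt hP1
  have hp0 : 0 < p := one_pos.trans_le hp1
  set R : Set (E3 × E3) := {z | ‖z.1 - Φ z.2‖ ≤ δ} with hR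
  have hRm : MeasurableSet R := by
    apply IsClosed.measurableSet
    exact isClosed_le (by fun_prop) continuous_const
  have hvol : ∀ x : E3, ∀ s : ℝ, 0 ≤ s →
      volume (Metric.closedBall x s) = ENNReal.ofReal (s ^ 3) * V := fun x s hs => by
    rw [Measure.addHaar_closedBall _ _ hs]; simp [hV]
  set D := ENNReal.ofReal (δ ^ 3) with hD
  have ha : ∀ x, (volume.restrict Ω) {y | (x, y) ∈ R} ≤ ENNReal.ofReal 64 * D * V := fun x => by
    refine (Measure.restrict_apply_le _ _).trans ?_
    rcases Set.eq_empty_or_nonempty {y | (x, y) ∈ R} with h | ⟨y₀, hy₀⟩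
    · rw [h]; simp
    -- Two points of the slice have images at distance at most `2 δ`, hence are `4 δ` apart at most;
    -- this is the source of `64 = 4 ^ 3`.
    · have : {y | (x, y) ∈ R} ⊆ Metric.closedBall y₀ (4 * δ) := fun y hy => by
        rw [Metric.mem_closedBall, dist_eq_norm]
        have h1 := hΦ y y₀
        have h2 : ‖Φ y - Φ y₀‖ ≤ ‖x - Φ y₀‖ + ‖x - Φ y‖ := by
          rw [show Φ y - Φ y₀ = (x - Φ y₀) - (x - Φ y) by abel]; exact norm_sub_le _ _
        simp only [hR, mem_ofPred_eq] at hy hy₀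
        linarith
      refine (measure_mono this).trans ?_
      rw [hvol _ _ (by positivity), hD, ← ENNReal.ofReal_mul (by norm_num)]
      exact le_of_eq (by ring_nf)
  -- The other slice is a ball of radius `δ`. The larger bound of `ha` is kept so that the two Schur
  -- factors combine to a `p`-th power.
  have hb : ∀ y, volume {x | (x, y) ∈ R} ≤ ENNReal.ofReal 64 * D * V := fun y => by
    have : {x | (x, y) ∈ R} = Metric.closedBall (Φ y) δ := by
      ext x; simp [hR, dist_eq_norm]
    rw [this, hvol _ _ hδ.le]
    gcongr
    rw [hD]
    calc ENNReal.ofReal (δ ^ 3) = 1 * ENNReal.ofReal (δ ^ 3) := (one_mul _).symm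
      _ ≤ _ := by gcongr; simp
  have hβm : AEMeasurable (fun y => ‖β y‖ₑ) (volume.restrict Ω) := hβ.enorm
  have hmain := lintegral_rpow_setLIntegral_le hRm ha hb hp1 hβm
  have hpt : ∀ x, ‖∫ y in Ω, J x y‖ₑ ≤ ENNReal.ofReal (M / δ ^ 3) *
      ∫⁻ y in {y | (x, y) ∈ R}, ‖β y‖ₑ ∂(volume.restrict Ω) := fun x => by
    have hRx : MeasurableSet {y | (x, y) ∈ R} := measurable_prodMk_left hRm
    refine (enorm_integral_le_lintegral_enorm _).trans ?_
    rw [← lintegral_const_mul'' _ hβm.restrict, ← lintegral_indicator hRx]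
    refine lintegral_mono_ae ((hJ x).mono fun y hy => ?_)
    by_cases hxy : y ∈ {y | (x, y) ∈ R}
    · rw [indicator_of_mem hxy, ← ofReal_norm, ← ofReal_norm,
        ← ENNReal.ofReal_mul (by positivity)]
      exact ENNReal.ofReal_le_ofReal hy
    · rw [hJ0 x y (by simpa [hR] using hxy)]; simp
  rw [eLpNorm_eq_lintegral_rpow_enorm_toReal hP0 hPt,
    eLpNorm_eq_lintegral_rpow_enorm_toReal hP0 hPt, ← hp]
  have hfin : ENNReal.ofReal 64 * D * V ≠ ⊤ :=
    ENNReal.mul_ne_top (ENNReal.mul_ne_top ENNReal.ofReal_ne_top ENNReal.ofReal_ne_top)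
      measure_ball_lt_top.ne
  have hpos : ENNReal.ofReal 64 * D * V ≠ 0 := by
    refine mul_ne_zero (mul_ne_zero (by simp) ?_) (Metric.measure_ball_pos _ _ one_pos).ne'
    rw [hD]; simp only [ne_eq, ENNReal.ofReal_eq_zero, not_le]; positivity
  calc (∫⁻ x, ‖∫ y in Ω, J x y‖ₑ ^ p) ^ (1 / p)
      ≤ (∫⁻ x, ENNReal.ofReal (M / δ ^ 3) ^ p *
          (∫⁻ y in {y | (x, y) ∈ R}, ‖β y‖ₑ ∂(volume.restrict Ω)) ^ p) ^ (1 / p) := by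
        refine ENNReal.rpow_le_rpow (lintegral_mono fun x => ?_) (by positivity)
        rw [← ENNReal.mul_rpow_of_nonneg _ _ hp0.le]
        exact ENNReal.rpow_le_rpow (hpt x) hp0.le
    _ ≤ (ENNReal.ofReal (M / δ ^ 3) ^ p * ((ENNReal.ofReal 64 * D * V) ^ p *
          ∫⁻ y in Ω, ‖β y‖ₑ ^ p)) ^ (1 / p) := by
        refine ENNReal.rpow_le_rpow ?_ (by positivity)
        rw [lintegral_const_mul' _ _ (ENNReal.rpow_ne_top_of_nonneg hp0.le ENNReal.ofReal_ne_top)]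
        refine mul_le_mul' le_rfl (hmain.trans (le_of_eq ?_))
        congr 1
        conv_lhs => rw [← ENNReal.rpow_one (ENNReal.ofReal 64 * D * V),
          ← ENNReal.rpow_mul, ← ENNReal.rpow_add _ _ hpos hfin]
        congr 1; ring
    _ = ENNReal.ofReal (M / δ ^ 3) * (ENNReal.ofReal 64 * D * V) *
          (∫⁻ y in Ω, ‖β y‖ₑ ^ p) ^ (1 / p) := by
        rw [ENNReal.mul_rpow_of_nonneg _ _ (by positivity),
          ENNReal.mul_rpow_of_nonneg _ _ (by positivity), ← ENNReal.rpow_mul, ← ENNReal.rpow_mul,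
          mul_one_div_cancel hp0.ne', ENNReal.rpow_one, ENNReal.rpow_one]
        simp only [mul_assoc]
    _ = _ := by
        congr 1
        rw [← mul_assoc, ← mul_assoc, hD, ← ENNReal.ofReal_mul (by positivity),
          ← ENNReal.ofReal_mul (by positivity)]
        congr 2
        field_simp

/-- Mollification along a map is smooth, and can be differentiated under the integral sign. -/
theorem contDiff_integral_kernel {Ω : Set E3} {E : Type} [NormedAddCommGroup E] [NormedSpace ℝ E]
    [CompleteSpace E]
    {Φ : E3 → E3} (hΦc : Continuous Φ) (hΦi : Function.Injective Φ)
    {k : E3 → ℝ} (hk : ContDiff ℝ ∞ k) (hkc : HasCompactSupport k)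
    {b : E3 → E} (hb : IntegrableOn b Ω) :
    ContDiff ℝ ∞ (fun x => ∫ y in Ω, k (x - Φ y) • b y) ∧
    ∀ x v, fderiv ℝ (fun x => ∫ y in Ω, k (x - Φ y) • b y) x v =
      ∫ y in Ω, (fderiv ℝ k (x - Φ y) v) • b y := by
  set L : E →L[ℝ] ℝ →L[ℝ] E := (ContinuousLinearMap.lsmul ℝ ℝ).flip with hL
  -- Since `Φ` is injective, `b` becomes a function of `Φ y`, and the integral is a convolution with
  -- respect to the image measure; smoothness is inherited from `k`.
  set ν := Measure.map Φ (volume.restrict Ω) with hν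
  have hme : MeasurableEmbedding Φ := hΦc.measurableEmbedding hΦi
  set f : E3 → E := b ∘ Function.invFun Φ with hf
  have hfΦ : ∀ y, f (Φ y) = b y := fun y => by
    simp [hf, Function.leftInverse_invFun hΦi y]
  have hfi : LocallyIntegrable f ν := by
    refine Integrable.locallyIntegrable ?_
    rw [hν, hme.integrable_map_iff]
    exact hb.congr (Eventually.of_forall fun y => (hfΦ y).symm)
  have heq : (fun x => ∫ y in Ω, k (x - Φ y) • b y) = convolution f k L ν := by
    ext1 x
    rw [convolution_def, hν]
    rw [hme.integral_map (g := fun t => L (f t) (k (x - t)))]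
    simp [hfΦ, hL]
  refine ⟨heq ▸ hkc.contDiff_convolution_right L hfi hk, fun x v => ?_⟩
  have hk1 : Continuous (fderiv ℝ k) := hk.continuous_fderiv (by simp)
  obtain ⟨C₀, hC₀⟩ := hkc.exists_bound_of_continuous hk.continuous
  obtain ⟨C, hC⟩ := (hkc.fderiv ℝ).exists_bound_of_continuous hk1
  have hm0 : ∀ x, AEStronglyMeasurable (fun y => k (x - Φ y) • b y) (volume.restrict Ω) := fun x =>
    (hk.continuous.comp (continuous_const.sub hΦc)).aestronglyMeasurable.smul
      hb.aestronglyMeasurable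
  have hm1 : AEStronglyMeasurable (fun y => (fderiv ℝ k (x - Φ y)).smulRight (b y))
      (volume.restrict Ω) :=
    (ContinuousLinearMap.smulRightL ℝ E3 E).aestronglyMeasurable_comp₂
      (hk1.comp (continuous_const.sub hΦc)).aestronglyMeasurable hb.aestronglyMeasurable
  have hbd : ∀ x y, ‖(fderiv ℝ k (x - Φ y)).smulRight (b y)‖ ≤ C * ‖b y‖ := fun x y => by
    rw [ContinuousLinearMap.norm_smulRight_apply]
    exact mul_le_mul_of_nonneg_right (hC _) (norm_nonneg _)
  have hbi : Integrable (fun y => C * ‖b y‖) (volume.restrict Ω) := hb.norm.const_mul C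
  have hd := hasFDerivAt_integral_of_dominated_of_fderiv_le (𝕜 := ℝ) (μ := volume.restrict Ω)
    (F := fun x y => k (x - Φ y) • b y)
    (F' := fun x y => (fderiv ℝ k (x - Φ y)).smulRight (b y)) (x₀ := x)
    (bound := fun y => C * ‖b y‖) univ_mem (Eventually.of_forall hm0)
    ((hb.norm.const_mul C₀).mono' (hm0 x) (Eventually.of_forall fun y => by
      rw [norm_smul]; exact mul_le_mul_of_nonneg_right (hC₀ _) (norm_nonneg _)))
    hm1 (Eventually.of_forall fun y x _ => hbd x y) hbi
    (Eventually.of_forall fun y x _ => ?_)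
  · rw [hd.fderiv, ContinuousLinearMap.integral_apply]
    · simp
    · exact hbi.mono' hm1 (Eventually.of_forall fun y => hbd x y)
  · have h1 : HasFDerivAt (fun x => k (x - Φ y)) (fderiv ℝ k (x - Φ y)) x := by
      have := ((hk.differentiable (by simp)) (x - Φ y)).hasFDerivAt.comp x
        ((hasFDerivAt_id x).sub_const (Φ y))
      rw [ContinuousLinearMap.comp_id] at this
      exact this
    exact h1.smul_const (b y)

/-! ### Mollified push-forward of divergence-free fields -/

/-- A fixed smooth bump of integral one, supported in the unit ball. -/
def baseBump : E3 → ℝ := (⟨1 / 2, 1, by norm_num, by norm_num⟩ : ContDiffBump (0 : E3)).normed volume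

/-- The standard mollifier at scale `δ`. -/
def moll (δ : ℝ) (z : E3) : ℝ := (δ ^ 3)⁻¹ * baseBump (δ⁻¹ • z)

theorem baseBump_contDiff : ContDiff ℝ ∞ baseBump := ContDiffBump.contDiff_normed _

theorem baseBump_hasCompactSupport : HasCompactSupport baseBump :=
  ContDiffBump.hasCompactSupport_normed _

theorem baseBump_eq_zero {z : E3} (hz : 1 ≤ ‖z‖) : baseBump z = 0 := by
  have : z ∉ Function.support baseBump := by
    rw [baseBump, ContDiffBump.support_normed_eq]
    simpa using hz
  simpa using this

theorem moll_contDiff (δ : ℝ) : ContDiff ℝ ∞ (moll δ) :=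
  contDiff_const.mul (baseBump_contDiff.comp (contDiff_const_smul _))

theorem moll_nonneg {δ : ℝ} (hδ : 0 < δ) (z : E3) : 0 ≤ moll δ z :=
  mul_nonneg (by positivity) (ContDiffBump.nonneg_normed _ _)

theorem moll_eq_zero {δ : ℝ} (hδ : 0 < δ) {z : E3} (hz : δ ≤ ‖z‖) : moll δ z = 0 := by
  rw [moll, baseBump_eq_zero, mul_zero]
  rw [norm_smul, norm_inv, Real.norm_of_nonneg hδ.le, ← div_eq_inv_mul, le_div_iff₀ hδ]
  linarith

theorem moll_hasCompactSupport {δ : ℝ} (hδ : 0 < δ) : HasCompactSupport (moll δ) := by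
  refine HasCompactSupport.of_support_subset_isCompact (isCompact_closedBall (0 : E3) δ) ?_
  intro z hz
  by_contra h
  rw [mem_closedBall_zero_iff, not_le] at h
  exact hz (moll_eq_zero hδ h.le)

theorem integral_moll {δ : ℝ} (hδ : 0 < δ) : ∫ z, moll δ z = 1 := by
  simp only [moll]
  rw [integral_const_mul, Measure.integral_comp_smul, baseBump, ContDiffBump.integral_normed]
  have : Module.finrank ℝ E3 = 3 := by simp
  rw [this, smul_eq_mul, mul_one, abs_of_pos (by positivity)]
  field_simp

theorem fderiv_moll_eq_zero {δ : ℝ} (hδ : 0 < δ) {z : E3} (hz : δ < ‖z‖) :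
    fderiv ℝ (moll δ) z = 0 := by
  have : moll δ =ᶠ[𝓝 z] fun _ => 0 := by
    filter_upwards [(isOpen_lt continuous_const continuous_norm).mem_nhds hz] with y hy
    exact moll_eq_zero hδ (le_of_lt hy)
  rw [this.fderiv_eq]; simp

theorem exists_moll_bound : ∃ M : ℝ, 0 ≤ M ∧ ∀ δ, 0 < δ → ∀ z,
    |moll δ z| ≤ M / δ ^ 3 ∧ ‖fderiv ℝ (moll δ) z‖ ≤ M / δ ^ 4 := by
  obtain ⟨C₀, hC₀⟩ := baseBump_hasCompactSupport.exists_bound_of_continuous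
    baseBump_contDiff.continuous
  obtain ⟨C₁, hC₁⟩ := (baseBump_hasCompactSupport.fderiv ℝ).exists_bound_of_continuous
    (baseBump_contDiff.continuous_fderiv (by simp))
  have h0 : 0 ≤ C₀ := (norm_nonneg _).trans (hC₀ 0)
  have h1 : 0 ≤ C₁ := (norm_nonneg _).trans (hC₁ 0)
  refine ⟨max C₀ C₁, h0.trans (le_max_left _ _), fun δ hδ z => ⟨?_, ?_⟩⟩
  · rw [moll, abs_mul, abs_of_pos (by positivity), div_eq_inv_mul]
    have := hC₀ (δ⁻¹ • z)
    rw [Real.norm_eq_abs] at this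
    exact mul_le_mul_of_nonneg_left (this.trans (le_max_left _ _)) (by positivity)
  · have hd : HasFDerivAt (moll δ) ((δ ^ 3)⁻¹ • (δ⁻¹ • fderiv ℝ baseBump (δ⁻¹ • z))) z := by
      have h2 := ((baseBump_contDiff.differentiable (by simp)) (δ⁻¹ • z)).hasFDerivAt.comp z
        ((hasFDerivAt_id z).const_smul δ⁻¹)
      have h3 := h2.const_mul (δ ^ 3)⁻¹
      rw [ContinuousLinearMap.comp_smul, ContinuousLinearMap.comp_id] at h3
      exact h3
    rw [hd.fderiv, norm_smul, norm_smul, Real.norm_of_nonneg (by positivity),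
      Real.norm_of_nonneg (by positivity), ← mul_assoc, div_eq_inv_mul]
    have : (δ ^ 3)⁻¹ * δ⁻¹ = (δ ^ 4)⁻¹ := by rw [← mul_inv]; ring
    rw [this]
    exact mul_le_mul_of_nonneg_left ((hC₁ _).trans (le_max_right _ _)) (by positivity)

/-- The push-forward of the divergence-free field `v` under `y ↦ y + ε X(y)` (as a vector field
times a density), mollified at scale `δ`. -/
def pushMoll (Ω : Set E3) (X : E3 → E3) (ε δ : ℝ) (v : E3 → E3) (x : E3) : E3 :=
  ∫ y in Ω, moll δ (x - (y + ε • X y)) • (v y + ε • fderiv ℝ X y (v y))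

/-- `ε X` is `1/2`-Lipschitz, so `id + ε X` shrinks distances by at most a factor two. This gives
injectivity and the volume bound for slices of the kernel. -/
theorem norm_sub_le_two_mul_of_fderiv_le {X : E3 → E3} (hX : Differentiable ℝ X) {L ε : ℝ}
    (hL : ∀ y, ‖fderiv ℝ X y‖ ≤ L) (hε : 0 ≤ ε) (hεL : ε * L ≤ 1 / 2) (a b : E3) :
    ‖a - b‖ ≤ 2 * ‖(a + ε • X a) - (b + ε • X b)‖ := by
  have h1 := convex_univ.norm_image_sub_le_of_norm_fderiv_le (𝕜 := ℝ) (f := X)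
    (fun x _ => hX x) (fun x _ => hL x) (mem_univ b) (mem_univ a)
  have h2 : a - b = ((a + ε • X a) - (b + ε • X b)) - ε • (X a - X b) := by
    rw [smul_sub]; abel
  have h3 := norm_sub_le ((a + ε • X a) - (b + ε • X b)) (ε • (X a - X b))
  rw [← h2, norm_smul, Real.norm_of_nonneg hε] at h3
  have h4 : ε * ‖X a - X b‖ ≤ 1 / 2 * ‖a - b‖ :=
    (mul_le_mul_of_nonneg_left h1 hε).trans (by
      rw [← mul_assoc]; exact mul_le_mul_of_nonneg_right hεL (norm_nonneg _))
  linarith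

theorem sum_fderiv_single {F : Type*} [NormedAddCommGroup F] [NormedSpace ℝ F]
    (A : E3 →L[ℝ] F) (b : E3) : ∑ j, b j • A (e j) = A b := by
  conv_rhs => rw [← (EuclideanSpace.basisFun (Fin 3) ℝ).sum_repr b]
  simp [map_sum, e]

section Push

variable {Ω : Set E3} {X : E3 → E3} {L ε δ : ℝ}

theorem integrableOn_add_smul_fderiv (hX : ContDiff ℝ ∞ X) (hL : ∀ y, ‖fderiv ℝ X y‖ ≤ L)
    {v : E3 → E3} (hv : IntegrableOn v Ω) :
    IntegrableOn (fun y => v y + ε • fderiv ℝ X y (v y)) Ω := by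
  refine hv.add (Integrable.smul ε ?_)
  refine (hv.norm.const_mul L).mono' ?_ (Eventually.of_forall fun y => ?_)
  · exact (ContinuousLinearMap.id ℝ (E3 →L[ℝ] E3)).aestronglyMeasurable_comp₂
      (hX.continuous_fderiv (by simp)).aestronglyMeasurable hv.aestronglyMeasurable
  · exact (ContinuousLinearMap.le_opNorm _ _).trans
      (mul_le_mul_of_nonneg_right (hL y) (norm_nonneg _))

theorem pushMoll_contDiff (hX : ContDiff ℝ ∞ X) (hL : ∀ y, ‖fderiv ℝ X y‖ ≤ L) (hε : 0 ≤ ε)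
    (hεL : ε * L ≤ 1 / 2) (hδ : 0 < δ) {v : E3 → E3} (hv : IntegrableOn v Ω) :
    ContDiff ℝ ∞ (pushMoll Ω X ε δ v) ∧
    ∀ x w, fderiv ℝ (pushMoll Ω X ε δ v) x w =
      ∫ y in Ω, (fderiv ℝ (moll δ) (x - (y + ε • X y)) w) •
        (v y + ε • fderiv ℝ X y (v y)) := by
  have hXd : Differentiable ℝ X := hX.differentiable (by simp)
  refine contDiff_integral_kernel (Φ := fun y => y + ε • X y)
    (continuous_id.add (hX.continuous.const_smul ε)) ?_ (moll_contDiff δ)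
    (moll_hasCompactSupport hδ) (integrableOn_add_smul_fderiv hX hL hv)
  intro a b hab
  have := norm_sub_le_two_mul_of_fderiv_le hXd hL hε hεL a b
  simp only at hab
  rw [hab, sub_self, norm_zero, mul_zero] at this
  exact sub_eq_zero.1 (norm_le_zero_iff.1 this)

/-- With `Φ y = y + ε X y`, the divergence at `x` is `∫ D moll(x - Φ y) (DΦ(y) v(y)) dy`. By the
chain rule the integrand is minus the derivative in direction `v(y)` of `q(y) = moll(x - Φ y)`, so
the integral vanishes by `hdiv`. No Jacobian determinant appears because the volume is transported
along with the field. The function `q` need not vanish on the boundary, which is why `hdiv` is asked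
for all smooth `q`. -/
theorem pushMoll_mem_testFields (hΩb : Bornology.IsBounded Ω)
    (hX : ContDiff ℝ ∞ X) (hL : ∀ y, ‖fderiv ℝ X y‖ ≤ L) (hε : 0 ≤ ε)
    (hεL : ε * L ≤ 1 / 2) (hδ : 0 < δ) {σ : ℝ} (hδσ : δ < σ)
    (hball : ∀ y ∈ Ω, Metric.ball (y + ε • X y) σ ⊆ Ω)
    {v : E3 → E3} (hv : IntegrableOn v Ω)
    (hdiv : ∀ q : E3 → ℝ, ContDiff ℝ ∞ q → ∫ y in Ω, fderiv ℝ q y (v y) = 0) :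
    pushMoll Ω X ε δ v ∈ testFields Ω := by
  obtain ⟨h1, h2⟩ := pushMoll_contDiff hX hL hε hεL hδ hv
  have hts : tsupport (pushMoll Ω X ε δ v) ⊆ Ω := by
    intro x hx
    -- The margin `σ - δ` is spent on passing from the support to its closure.
    obtain ⟨z, hz, hzx⟩ := Metric.mem_closure_iff.1 hx (σ - δ) (by linarith)
    have : ∃ y ∈ Ω, ‖z - (y + ε • X y)‖ < δ := by
      by_contra! hcon
      refine hz ?_
      refine setIntegral_eq_zero_of_forall_eq_zero fun y hy => ?_
      rw [moll_eq_zero hδ (hcon y hy), zero_smul]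
    obtain ⟨y, hy, hzy⟩ := this
    refine hball y hy ?_
    rw [Metric.mem_ball]
    have := dist_triangle x z (y + ε • X y)
    rw [dist_eq_norm z] at this
    linarith
  refine ⟨h1, ?_, hts, fun x => ?_⟩
  · exact Metric.isCompact_of_isClosed_isBounded (isClosed_tsupport _) (hΩb.subset hts)
  have hXd : Differentiable ℝ X := hX.differentiable (by simp)
  set b : E3 → E3 := fun y => v y + ε • fderiv ℝ X y (v y) with hb
  have hbi : IntegrableOn b Ω := integrableOn_add_smul_fderiv hX hL hv
  have hq : ContDiff ℝ ∞ (fun y => moll δ (x - (y + ε • X y))) :=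
    (moll_contDiff δ).comp (contDiff_const.sub (contDiff_id.add (hX.const_smul ε)))
  have hqd : ∀ y w, fderiv ℝ (fun y => moll δ (x - (y + ε • X y))) y w =
      -fderiv ℝ (moll δ) (x - (y + ε • X y)) (w + ε • fderiv ℝ X y w) := fun y w => by
    have hd := (((moll_contDiff δ).differentiable (by simp)) (x - (y + ε • X y))).hasFDerivAt.comp y
      (((hasFDerivAt_id y).add ((hXd y).hasFDerivAt.const_smul ε)).const_sub x)
    have hd' : HasFDerivAt (fun y => moll δ (x - (y + ε • X y))) _ y := hd
    rw [hd'.fderiv]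
    simp
  have := hdiv _ hq
  simp only [hqd, integral_neg, neg_eq_zero] at this
  rw [divergence, ← this]
  have hk1 : Continuous (fderiv ℝ (moll δ)) := (moll_contDiff δ).continuous_fderiv (by simp)
  obtain ⟨C, hC⟩ := ((moll_hasCompactSupport hδ).fderiv ℝ).exists_bound_of_continuous hk1
  have hint : ∀ j : Fin 3, IntegrableOn
      (fun y => (fderiv ℝ (moll δ) (x - (y + ε • X y)) (e j)) • b y) Ω := fun j => by
    have hcont : Continuous fun y => fderiv ℝ (moll δ) (x - (y + ε • X y)) (e j) :=
      (hk1.comp (continuous_const.sub (continuous_id.add (hX.continuous.const_smul ε)))).clm_apply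
        continuous_const
    refine (hbi.norm.const_mul (C * ‖e j‖)).mono'
      (hcont.aestronglyMeasurable.smul hbi.aestronglyMeasurable)
      (Eventually.of_forall fun y => ?_)
    rw [norm_smul]
    refine mul_le_mul_of_nonneg_right ?_ (norm_nonneg _)
    exact (ContinuousLinearMap.le_opNorm _ _).trans
      (mul_le_mul_of_nonneg_right (hC _) (norm_nonneg _))
  have hcoord : ∀ j : Fin 3, fderiv ℝ (pushMoll Ω X ε δ v) x (e j) j =
      ∫ y in Ω, fderiv ℝ (moll δ) (x - (y + ε • X y)) (e j) * b y j := fun j => by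
    rw [h2]
    have := ContinuousLinearMap.integral_comp_comm (EuclideanSpace.proj j : E3 →L[ℝ] ℝ) (hint j)
    exact this.symm
  simp only [hcoord]
  rw [← integral_finsetSum]
  · refine integral_congr_ae (Eventually.of_forall fun y => ?_)
    simp only
    rw [← sum_fderiv_single (fderiv ℝ (moll δ) (x - (y + ε • X y))) (b y)]
    exact Finset.sum_congr rfl fun j _ => by rw [smul_eq_mul, mul_comm]
  · intro j _
    simpa using ContinuousLinearMap.integrable_comp (EuclideanSpace.proj j : E3 →L[ℝ] ℝ) (hint j)

/-- The factor `2` bounds `id + ε DX`. The constant depends neither on the scales nor on `P`, so the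
`L²` and `L^{r+1}` bounds hold for the same approximants. -/
theorem eLpNorm_pushMoll_le (hX : ContDiff ℝ ∞ X) (hL : ∀ y, ‖fderiv ℝ X y‖ ≤ L) (hε : 0 ≤ ε)
    (hεL : ε * L ≤ 1 / 2) (hδ : 0 < δ) {M : ℝ} (hM : 0 ≤ M) (hMδ : ∀ z, |moll δ z| ≤ M / δ ^ 3)
    {P : ℝ≥0∞} (hP1 : 1 ≤ P) (hPt : P ≠ ⊤)
    {v : E3 → E3} (hv : AEStronglyMeasurable v (volume.restrict Ω)) :
    eLpNorm (pushMoll Ω X ε δ v) P volume ≤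
      ENNReal.ofReal (M * 2 * 64) * volume (Metric.ball (0 : E3) 1) *
        eLpNorm v P (volume.restrict Ω) := by
  have hXd : Differentiable ℝ X := hX.differentiable (by simp)
  refine eLpNorm_integral_le_of_kernel_bound (Φ := fun y => y + ε • X y)
    (J := fun x y => moll δ (x - (y + ε • X y)) • (v y + ε • fderiv ℝ X y (v y)))
    (continuous_id.add (hX.continuous.const_smul ε))
    (norm_sub_le_two_mul_of_fderiv_le hXd hL hε hεL) hδ (by positivity) hP1 hPt hv
    (fun x => Eventually.of_forall fun y => ?_) (fun x y hxy => ?_)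
  · rw [norm_smul, Real.norm_eq_abs]
    have h1 : ‖v y + ε • fderiv ℝ X y (v y)‖ ≤ 2 * ‖v y‖ := by
      refine (norm_add_le _ _).trans ?_
      rw [norm_smul, Real.norm_of_nonneg hε]
      have := mul_le_mul_of_nonneg_left ((ContinuousLinearMap.le_opNorm (fderiv ℝ X y) (v y)).trans
        (mul_le_mul_of_nonneg_right (hL y) (norm_nonneg _))) hε
      rw [← mul_assoc] at this
      have h3 := mul_le_mul_of_nonneg_right hεL (norm_nonneg (v y))
      linarith [norm_nonneg (v y)]
    calc _ ≤ M / δ ^ 3 * (2 * ‖v y‖) := by gcongr; exact hMδ _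
      _ = _ := by ring
  · rw [moll_eq_zero hδ hxy.le, zero_smul]

end Push

/-! ### Test fields and the spaces `H` and `V` -/

theorem testFields.integral_eq {Ω : Set E3} {F : Type*} [NormedAddCommGroup F] [NormedSpace ℝ F]
    {g : E3 → F} {φ : E3 → E3} (hφ : φ ∈ testFields Ω) (hg : ∀ x ∉ tsupport φ, g x = 0) :
    ∫ x in Ω, g x = ∫ x, g x :=
  setIntegral_eq_integral_of_forall_compl_eq_zero fun x hx => hg x fun h => hx (hφ.2.2.1 h)

theorem testFields.continuous {Ω : Set E3} {φ : E3 → E3} (hφ : φ ∈ testFields Ω) :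
    Continuous φ := hφ.1.continuous

theorem testFields.continuous_fderiv {Ω : Set E3} {φ : E3 → E3} (hφ : φ ∈ testFields Ω) :
    Continuous (fderiv ℝ φ) := hφ.1.continuous_fderiv (by simp)

theorem testFields.continuous_grad {Ω : Set E3} {φ : E3 → E3} (hφ : φ ∈ testFields Ω) :
    Continuous (grad φ) := by
  unfold grad
  exact (PiLp.continuous_toLp 2 _).comp
    (continuous_pi fun j => (testFields.continuous_fderiv hφ).clm_apply continuous_const)

theorem fderiv_eq_zero_of_notMem_tsupport {φ : E3 → E3} {x : E3} (hx : x ∉ tsupport φ) :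
    fderiv ℝ φ x = 0 :=
  image_eq_zero_of_notMem_tsupport fun h => hx (tsupport_fderiv_subset ℝ h)

/-- The pairs `(φ, ∇φ)`, `φ` a test field. -/
def testPairs (Ω : Set E3) : Set (L2 Ω × L2Grad Ω) :=
  {p | ∃ φ ∈ testFields Ω, p.1 =ᵐ[volume.restrict Ω] φ ∧ p.2 =ᵐ[volume.restrict Ω] grad φ}

theorem closure_testPairs_subset {Ω : Set E3} {S : Set (L2 Ω × L2Grad Ω)} (hS : IsClosed S)
    (h : ∀ p : L2 Ω × L2Grad Ω, ∀ φ ∈ testFields Ω, p.1 =ᵐ[volume.restrict Ω] φ →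
      p.2 =ᵐ[volume.restrict Ω] grad φ → p ∈ S) : closure (testPairs Ω) ⊆ S :=
  closure_minimal (fun p ⟨φ, hφ, h1, h2⟩ => h p φ hφ h1 h2) hS

theorem spaceV.fst_mem_spaceH {Ω : Set E3} {p : L2 Ω × L2Grad Ω} (hp : p ∈ closure (testPairs Ω)) :
    p.1 ∈ spaceH Ω := by
  refine closure_testPairs_subset (S := {p | p.1 ∈ spaceH Ω})
    (isClosed_closure.preimage continuous_fst) (fun p φ hφ h1 _ => ?_) hp
  exact subset_closure ⟨φ, hφ, h1⟩

/-- Integration by parts against a smooth compactly supported function. -/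
theorem integral_fderiv_bilin_eq_neg {F G W : Type*} [NormedAddCommGroup F] [NormedSpace ℝ F]
    [NormedAddCommGroup G] [NormedSpace ℝ G] [NormedAddCommGroup W] [NormedSpace ℝ W]
    (B : F →L[ℝ] G →L[ℝ] W) {f : E3 → F} {g : E3 → G} (hf : ContDiff ℝ 1 f) (hg : ContDiff ℝ 1 g)
    (hgc : HasCompactSupport g) (v : E3) :
    ∫ x, B (f x) (fderiv ℝ g x v) = -∫ x, B (fderiv ℝ f x v) (g x) := by
  have c1 : Continuous fun x => fderiv ℝ f x v :=
    (hf.continuous_fderiv one_ne_zero).clm_apply continuous_const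
  have c2 : Continuous fun x => fderiv ℝ g x v :=
    (hg.continuous_fderiv one_ne_zero).clm_apply continuous_const
  refine integral_bilinear_fderiv_right_eq_neg_left_of_integrable ?_ ?_ ?_
    (fun x _ => hf.differentiable one_ne_zero x) (fun x _ => hg.differentiable one_ne_zero x)
  · refine Continuous.integrable_of_hasCompactSupport (B.continuous₂.comp (c1.prodMk hg.continuous))
      (hgc.mono fun x hx => ?_)
    contrapose! hx
    simp only [Function.mem_support, not_not] at hx ⊢
    rw [hx, map_zero]
  · refine Continuous.integrable_of_hasCompactSupport (B.continuous₂.comp (hf.continuous.prodMk c2))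
      ((hgc.fderiv_apply ℝ v).mono fun x hx => ?_)
    contrapose! hx
    simp only [Function.mem_support, not_not] at hx ⊢
    rw [hx, map_zero]
  · refine Continuous.integrable_of_hasCompactSupport
      (B.continuous₂.comp (hf.continuous.prodMk hg.continuous)) (hgc.mono fun x hx => ?_)
    contrapose! hx
    simp only [Function.mem_support, not_not] at hx ⊢
    rw [hx, map_zero]

/-- Integration by parts against the divergence; `q` is unrestricted at the boundary because `φ` has
compact support in `Ω`. The closure `H` inherits this weak form of a vanishing normal component. -/
theorem testFields.integral_fderiv_apply_eq_zero {Ω : Set E3} {φ : E3 → E3}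
    (hφ : φ ∈ testFields Ω) {q : E3 → ℝ} (hq : ContDiff ℝ ∞ q) :
    ∫ y in Ω, fderiv ℝ q y (φ y) = 0 := by
  have hφ1 : ContDiff ℝ 1 φ := hφ.1.of_le (by exact_mod_cast le_top)
  have hq1 : ContDiff ℝ 1 q := hq.of_le (by exact_mod_cast le_top)
  rw [testFields.integral_eq hφ fun x hx => by
    rw [image_eq_zero_of_notMem_tsupport hx, map_zero]]
  let pr : Fin 3 → E3 →L[ℝ] ℝ := fun j => EuclideanSpace.proj j
  have hpr : ∀ (j : Fin 3) (z : E3), pr j z = z j := fun _ _ => rfl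
  have hb : ∀ j : Fin 3, ∫ y, q y * fderiv ℝ φ y (e j) j = -∫ y, fderiv ℝ q y (e j) * φ y j := by
    intro j
    have := integral_fderiv_bilin_eq_neg ((ContinuousLinearMap.mul ℝ ℝ)) (f := q)
      (g := fun y => pr j (φ y)) hq1 ((pr j).contDiff.comp hφ1)
      (hφ.2.1.comp_left (g := pr j) (map_zero _)) (e j)
    have hfd : ∀ y, fderiv ℝ (fun y => pr j (φ y)) y (e j) = fderiv ℝ φ y (e j) j := fun y => by
      have := (pr j).hasFDerivAt.comp y (hφ1.differentiable one_ne_zero y).hasFDerivAt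
      have h2 : HasFDerivAt (fun y => pr j (φ y)) _ y := this
      rw [h2.fderiv]; rfl
    simp only [ContinuousLinearMap.mul_apply', hfd] at this
    exact this
  have hφc : Continuous φ := (testFields.continuous hφ)
  have hqc : Continuous (fderiv ℝ q) := hq.continuous_fderiv (by simp)
  have hint : ∀ j : Fin 3, Integrable fun y => fderiv ℝ q y (e j) * φ y j := fun j => by
    refine Continuous.integrable_of_hasCompactSupport
      ((hqc.clm_apply continuous_const).mul ((pr j).continuous.comp hφc))
      (hφ.2.1.mono fun x hx => ?_)
    contrapose! hx
    simp only [Function.mem_support, not_not] at hx ⊢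
    rw [hx]; simp
  have hint2 : ∀ j : Fin 3, Integrable fun y => q y * fderiv ℝ φ y (e j) j := fun j => by
    refine Continuous.integrable_of_hasCompactSupport
      (hq.continuous.mul ((pr j).continuous.comp
        ((testFields.continuous_fderiv hφ).clm_apply continuous_const)))
      ((hφ.2.1.fderiv_apply ℝ (e j)).mono fun x hx => ?_)
    contrapose! hx
    simp only [Function.mem_support, not_not] at hx ⊢
    rw [hx]; simp
  have h1 : ∀ y, fderiv ℝ q y (φ y) = ∑ j, fderiv ℝ q y (e j) * φ y j := fun y => by
    rw [← sum_fderiv_single (fderiv ℝ q y) (φ y)]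
    exact Finset.sum_congr rfl fun j _ => by rw [smul_eq_mul, mul_comm]
  simp only [h1]
  rw [integral_finsetSum _ fun j _ => hint j]
  have h2 : ∀ j, ∫ y, fderiv ℝ q y (e j) * φ y j = -∫ y, q y * fderiv ℝ φ y (e j) j := fun j => by
    rw [hb j, neg_neg]
  simp only [h2, Finset.sum_neg_distrib]
  rw [← integral_finsetSum _ fun j _ => hint2 j]
  have h3 : ∀ y, ∑ j, q y * fderiv ℝ φ y (e j) j = 0 := fun y => by
    rw [← Finset.mul_sum]
    have := hφ.2.2.2 y
    rw [divergence] at this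
    rw [this, mul_zero]
  simp [h3]

theorem spaceH.integral_fderiv_apply_eq_zero {Ω : Set E3} (hΩo : IsOpen Ω)
    (hΩb : Bornology.IsBounded Ω) {w : L2 Ω} (hw : w ∈ spaceH Ω) {q : E3 → ℝ}
    (hq : ContDiff ℝ ∞ q) : ∫ y in Ω, fderiv ℝ q y (w y) = 0 := by
  have hcl : IsClosed {w : L2 Ω | ∫ y in Ω, fderiv ℝ q y (w y) = 0} :=
    isClosed_eq (continuous_integral_clm_apply (MemLp.of_continuous_of_isBounded hΩb
      hΩo.measurableSet (hq.continuous_fderiv (by simp)) 2)) continuous_const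
  refine closure_minimal ?_ hcl hw
  rintro w ⟨φ, hφ, hwφ⟩
  rw [mem_ofPred_eq, ← (testFields.integral_fderiv_apply_eq_zero hφ) hq]
  exact integral_congr_ae (hwφ.mono fun y hy => by simp only [hy])

/-- The test function `ψ` need not vanish on the boundary: this is the weak form of the zero trace
of elements of `V`, obtained from compactly supported fields by density. -/
theorem spaceV.integral_inner_eq_neg {Ω : Set E3} (hΩo : IsOpen Ω)
    (hΩb : Bornology.IsBounded Ω) {p : L2 Ω × L2Grad Ω} (hp : p ∈ closure (testPairs Ω))
    {ψ : E3 → E3} (hψ : ContDiff ℝ ∞ ψ) (j : Fin 3) :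
    ∫ y in Ω, inner ℝ (p.2 y j) (ψ y) = -∫ y in Ω, inner ℝ (p.1 y) (fderiv ℝ ψ y (e j)) := by
  have hψ1 : ContDiff ℝ 1 ψ := hψ.of_le (by exact_mod_cast le_top)
  let A1 : E3 → E3 →L[ℝ] ℝ := fun y => innerSL ℝ (fderiv ℝ ψ y (e j))
  let A2 : E3 → Mat3 →L[ℝ] ℝ := fun y => (innerSL ℝ (ψ y)).comp (PiLp.proj 2 (fun _ => E3) j)
  have hA1 : Continuous A1 := (innerSL ℝ).continuous.comp
    ((hψ.continuous_fderiv (by simp)).clm_apply continuous_const)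
  have hA2 : Continuous A2 :=
    ((innerSL ℝ).continuous.comp hψ.continuous).clm_comp continuous_const
  have e1 : ∀ y (z : E3), inner ℝ z (fderiv ℝ ψ y (e j)) = A1 y z := fun y z =>
    (real_inner_comm _ _)
  have e2 : ∀ y (z : Mat3), inner ℝ (z j) (ψ y) = A2 y z := fun y z => (real_inner_comm _ _)
  simp only [e1, e2]
  have hcl : IsClosed {p : L2 Ω × L2Grad Ω | ∫ y in Ω, A2 y (p.2 y) = -∫ y in Ω, A1 y (p.1 y)} :=
    isClosed_eq
      ((continuous_integral_clm_apply (MemLp.of_continuous_of_isBounded hΩb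
        hΩo.measurableSet hA2 2)).comp continuous_snd)
      ((continuous_integral_clm_apply (MemLp.of_continuous_of_isBounded hΩb
        hΩo.measurableSet hA1 2)).comp continuous_fst).neg
  refine closure_testPairs_subset hcl (fun p φ hφ h1 h2 => ?_) hp
  have i1 : ∫ y in Ω, A1 y (p.1 y) = ∫ y in Ω, A1 y (φ y) :=
    integral_congr_ae (h1.mono fun y hy => by simp only [hy])
  have i2 : ∫ y in Ω, A2 y (p.2 y) = ∫ y in Ω, A2 y (grad φ y) :=
    integral_congr_ae (h2.mono fun y hy => by simp only [hy])
  rw [mem_ofPred_eq, i1, i2,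
    testFields.integral_eq hφ (fun x hx => by
      show inner ℝ (ψ x) (fderiv ℝ φ x (e j)) = 0
      rw [fderiv_eq_zero_of_notMem_tsupport hx]; simp),
    testFields.integral_eq hφ (fun x hx => by
      rw [image_eq_zero_of_notMem_tsupport hx, map_zero])]
  exact integral_fderiv_bilin_eq_neg (innerSL ℝ) hψ1
    (hφ.1.of_le (by exact_mod_cast le_top)) hφ.2.1 (e j)

/-! ### Weak convergence in Lebesgue spaces -/

theorem tendsto_clm_of_tendsto_dense {E : Type*} [NormedAddCommGroup E] [NormedSpace ℝ E]
    {T : ℕ → E →L[ℝ] ℝ} {T₀ : E →L[ℝ] ℝ} {C : ℝ} (hT : ∀ n, ‖T n‖ ≤ C) {S : Set E} (hS : Dense S)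
    (h : ∀ s ∈ S, Tendsto (fun n => T n s) atTop (𝓝 (T₀ s))) (x : E) :
    Tendsto (fun n => T n x) atTop (𝓝 (T₀ x)) := by
  have hC : 0 ≤ C := (norm_nonneg _).trans (hT 0)
  rw [Metric.tendsto_atTop]
  intro η hη
  set D := C + ‖T₀‖ + 1
  have hD : 0 < D := by positivity
  obtain ⟨s, hs, hsx⟩ := Metric.mem_closure_iff.1 (hS x) (η / 2 / D) (by positivity)
  obtain ⟨N, hN⟩ := (Metric.tendsto_atTop.1 (h s hs)) (η / 2) (by positivity)
  refine ⟨N, fun n hn => ?_⟩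
  have h1 := hN n hn
  rw [dist_eq_norm] at h1 hsx ⊢
  have h2 : T n x - T₀ x = T n (x - s) + (T n s - T₀ s) - T₀ (x - s) := by
    rw [map_sub, map_sub]; abel
  rw [h2]
  have h3 := norm_sub_le (T n (x - s) + (T n s - T₀ s)) (T₀ (x - s))
  have h4 := norm_add_le (T n (x - s)) (T n s - T₀ s)
  have h5 := (T n).le_of_opNorm_le (hT n) (x - s)
  have h6 := T₀.le_opNorm (x - s)
  have h7 : D * ‖x - s‖ < η / 2 := by rw [mul_comm]; exact (lt_div_iff₀ hD).1 hsx
  have h8 : D * ‖x - s‖ = C * ‖x - s‖ + ‖T₀‖ * ‖x - s‖ + ‖x - s‖ := by ring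
  linarith [norm_nonneg (x - s)]

/-- A bound in `L^P` reduces weak convergence to test functions in a dense subset of `L^Q`;
finiteness of `Q` makes the smooth compactly supported ones dense. -/
theorem tendsto_integral_inner_of_tendsto_smooth {μ : Measure E3} [IsFiniteMeasureOnCompacts μ]
    {P Q : ℝ≥0∞} [Fact (1 ≤ P)] [Fact (1 ≤ Q)] [ENNReal.HolderConjugate P Q] (hQ : Q ≠ ⊤)
    {a : ℕ → E3 → E3} {a₀ : E3 → E3} (ha : ∀ n, MemLp (a n) P μ) (ha₀ : MemLp a₀ P μ)
    {C : ℝ≥0∞} (hC : C ≠ ⊤) (hbd : ∀ n, eLpNorm (a n) P μ ≤ C)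
    (h : ∀ ψ : E3 → E3, ContDiff ℝ ∞ ψ → HasCompactSupport ψ →
      Tendsto (fun n => ∫ x, inner ℝ (a n x) (ψ x) ∂μ) atTop (𝓝 (∫ x, inner ℝ (a₀ x) (ψ x) ∂μ)))
    {F : E3 → E3} (hF : MemLp F Q μ) :
    Tendsto (fun n => ∫ x, inner ℝ (a n x) (F x) ∂μ) atTop (𝓝 (∫ x, inner ℝ (a₀ x) (F x) ∂μ)) := by
  let T : Lp E3 P μ →L[ℝ] Lp E3 Q μ →L[ℝ] ℝ := (innerSL ℝ).lpPairing μ P Q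
  have hT : ∀ {b : E3 → E3} (hb : MemLp b P μ) (G : Lp E3 Q μ),
      T hb.toLp G = ∫ x, inner ℝ (b x) (G x) ∂μ := fun {b} hb G => by
    rw [ContinuousLinearMap.lpPairing_eq_integral]
    refine integral_congr_ae (hb.coeFn_toLp.mono fun x hx => ?_)
    simp only [hx]; rfl
  have key := tendsto_clm_of_tendsto_dense (T := fun n => T (ha n).toLp) (T₀ := T ha₀.toLp)
    (C := ‖T‖ * C.toReal) (fun n => ?_)
    (Lp.dense_hasCompactSupport_contDiff (μ := μ) (F := E3) (E := E3) hQ)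
    (fun s ⟨ψ, hψ, hψc, hψs⟩ => ?_) hF.toLp
  · simp only [hT] at key
    have e1 : ∀ b : E3 → E3, ∫ x, inner ℝ (b x) ((hF.toLp F : Lp E3 Q μ) x) ∂μ = ∫ x, inner ℝ (b x) (F x) ∂μ :=
      fun b => integral_congr_ae (hF.coeFn_toLp.mono fun x hx => by simp only [hx])
    simpa only [e1] using key
  · refine (T.le_opNorm _).trans (mul_le_mul_of_nonneg_left ?_ (norm_nonneg _))
    rw [Lp.norm_toLp]
    exact ENNReal.toReal_mono hC (hbd n)
  · have e1 : ∀ b : E3 → E3, ∫ x, inner ℝ (b x) (s x) ∂μ = ∫ x, inner ℝ (b x) (ψ x) ∂μ :=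
      fun b => integral_congr_ae (hψ.mono fun x hx => by simp only [hx])
    simp only [hT, e1]
    exact h ψ hψs hψc

/-! ### The gradient of the mollified push-forward -/

theorem integrable_clm_apply {α E F : Type*} [MeasurableSpace α] {μ : Measure α}
    [NormedAddCommGroup E] [NormedSpace ℝ E] [NormedAddCommGroup F] [NormedSpace ℝ F]
    {A : α → E →L[ℝ] F} (hA : MemLp A 2 μ) {w : α → E} (hw : MemLp w 2 μ) :
    Integrable (fun y => A y (w y)) μ :=
  memLp_one_iff_integrable.1
    ((ContinuousLinearMap.id ℝ (E →L[ℝ] F)).memLp_of_bilin (p := 2) (q := 2) 1 hA hw)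

section PushGrad

variable {Ω : Set E3} {X : E3 → E3} {L L₂ ε δ : ℝ}

/-- The integrand of the `j`-th partial derivative of `pushMoll`. -/
def pushGradKernel (X : E3 → E3) (ε δ : ℝ) (j : Fin 3) (x y : E3) (v : E3) (G : Mat3) : E3 :=
  moll δ (x - (y + ε • X y)) •
      (G j + ε • (fderiv ℝ (fderiv ℝ X) y (e j) v + fderiv ℝ X y (G j))) -
    (ε * fderiv ℝ (moll δ) (x - (y + ε • X y)) (fderiv ℝ X y (e j))) •
      (v + ε • fderiv ℝ X y v)

/-- A derivative of the mollifier costs `1/δ`, which is not affordable. Here `∂ⱼ moll(x - Φ y)` is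
rewritten as minus the `y`-derivative of `moll(x - Φ y)`, integrated by parts onto the field, plus
an error term. The error still differentiates the mollifier but carries a factor `ε`. -/
theorem testFields.fderiv_pushMoll (hX : ContDiff ℝ ∞ X) {φ : E3 → E3} (hφ : φ ∈ testFields Ω)
    (x : E3) (j : Fin 3) :
    ∫ y in Ω, (fderiv ℝ (moll δ) (x - (y + ε • X y)) (e j)) • (φ y + ε • fderiv ℝ X y (φ y)) =
      ∫ y in Ω, pushGradKernel X ε δ j x y (φ y) (grad φ y) := by
  have hXd : Differentiable ℝ X := hX.differentiable (by simp)
  have hX1 : ContDiff ℝ ∞ (fderiv ℝ X) := hX.fderiv_right (by simp)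
  have hX2 : Continuous (fderiv ℝ (fderiv ℝ X)) := hX1.continuous_fderiv (by simp)
  have hφc := testFields.continuous hφ
  have hφd := testFields.continuous_fderiv hφ
  have hmd : Continuous (fderiv ℝ (moll δ)) := (moll_contDiff δ).continuous_fderiv (by simp)
  have hφ0 : ∀ y ∉ tsupport φ, φ y = 0 := fun y hy => image_eq_zero_of_notMem_tsupport hy
  have hφ1 : ∀ y ∉ tsupport φ, fderiv ℝ φ y = 0 := fun y hy => fderiv_eq_zero_of_notMem_tsupport hy
  have hg0 : ∀ y ∉ tsupport φ, grad φ y = 0 := fun y hy => by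
    rw [grad, hφ1 y hy]; rfl
  rw [testFields.integral_eq hφ fun y hy => by rw [hφ0 y hy]; simp,
    testFields.integral_eq hφ fun y hy => by
      rw [hφ0 y hy, hg0 y hy]; simp [pushGradKernel]]
  set K : E3 → ℝ := fun y => moll δ (x - (y + ε • X y)) with hK
  set b : E3 → E3 := fun y => φ y + ε • fderiv ℝ X y (φ y) with hb
  have hKs : ContDiff ℝ ∞ K :=
    (moll_contDiff δ).comp (contDiff_const.sub (contDiff_id.add (hX.const_smul ε)))
  have hφs : ContDiff ℝ ∞ φ := hφ.1
  have hbs : ContDiff ℝ ∞ b := hφs.add ((hX1.clm_apply hφs).const_smul ε)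
  have hbc : HasCompactSupport b := hφ.2.1.mono fun y hy => by
    contrapose! hy
    simp only [Function.mem_support, not_not] at hy ⊢
    rw [hb]; simp [hy]
  have hKd : ∀ y w, fderiv ℝ K y w =
      -fderiv ℝ (moll δ) (x - (y + ε • X y)) (w + ε • fderiv ℝ X y w) := fun y w => by
    have hd := (((moll_contDiff δ).differentiable (by simp)) (x - (y + ε • X y))).hasFDerivAt.comp y
      (((hasFDerivAt_id y).add ((hXd y).hasFDerivAt.const_smul ε)).const_sub x)
    have hd' : HasFDerivAt K _ y := hd
    rw [hd'.fderiv]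
    simp
  have hbd : ∀ y w, fderiv ℝ b y w = fderiv ℝ φ y w +
      ε • (fderiv ℝ (fderiv ℝ X) y w (φ y) + fderiv ℝ X y (fderiv ℝ φ y w)) := fun y w => by
    have hφy := (hφs.differentiable (by simp) y).hasFDerivAt
    have hXy := (hX1.differentiable (by simp) y).hasFDerivAt
    have hd := hφy.add ((hXy.clm_apply hφy).const_smul ε)
    have hd' : HasFDerivAt b _ y := hd
    rw [hd'.fderiv]
    simp [add_comm]
  have hibp := integral_fderiv_bilin_eq_neg (ContinuousLinearMap.lsmul ℝ ℝ) (f := K) (g := b)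
    (hKs.of_le (by exact_mod_cast le_top)) (hbs.of_le (by exact_mod_cast le_top)) hbc (e j)
  simp only [ContinuousLinearMap.lsmul_apply] at hibp
  have hbdc : Continuous fun y => fderiv ℝ b y (e j) :=
    (hbs.continuous_fderiv (by simp)).clm_apply continuous_const
  have hKdc : Continuous fun y => fderiv ℝ K y (e j) :=
    (hKs.continuous_fderiv (by simp)).clm_apply continuous_const
  have hmc : Continuous fun y => fderiv ℝ (moll δ) (x - (y + ε • X y)) :=
    hmd.comp (continuous_const.sub (continuous_id.add (hX.continuous.const_smul ε)))
  have hi1 : Integrable fun y => K y • fderiv ℝ b y (e j) :=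
    (hKs.continuous.smul hbdc).integrable_of_hasCompactSupport
      ((hbc.fderiv_apply ℝ (e j)).smul_left)
  have hi2 : Integrable fun y => fderiv ℝ K y (e j) • b y :=
    (hKdc.smul hbs.continuous).integrable_of_hasCompactSupport hbc.smul_left
  have hi3 : Integrable fun y =>
      (ε * fderiv ℝ (moll δ) (x - (y + ε • X y)) (fderiv ℝ X y (e j))) • b y :=
    ((continuous_const.mul (hmc.clm_apply (hX1.continuous.clm_apply continuous_const))).smul
      hbs.continuous).integrable_of_hasCompactSupport hbc.smul_left
  have e1 : ∀ y, (fderiv ℝ (moll δ) (x - (y + ε • X y)) (e j)) • b y =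
      -(fderiv ℝ K y (e j) • b y) -
        (ε * fderiv ℝ (moll δ) (x - (y + ε • X y)) (fderiv ℝ X y (e j))) • b y := fun y => by
    rw [hKd, ← neg_smul, ← sub_smul]
    congr 1
    simp
  have e2 : ∀ y, pushGradKernel X ε δ j x y (φ y) (grad φ y) = K y • fderiv ℝ b y (e j) -
        (ε * fderiv ℝ (moll δ) (x - (y + ε • X y)) (fderiv ℝ X y (e j))) • b y := fun y => by
    rw [hbd]; rfl
  rw [integral_congr_ae (Eventually.of_forall e1), integral_congr_ae (Eventually.of_forall e2),
    integral_sub hi1 hi3, hibp, ← integral_neg]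
  exact integral_sub hi2.neg hi3

-- Both sides are `L²`-continuous in the pair for fixed `x`, because their coefficients are
-- continuous and `Ω` is bounded; the identity therefore passes to the closure.
set_option maxHeartbeats 1000000 in
theorem spaceV.fderiv_pushMoll (hΩo : IsOpen Ω) (hΩb : Bornology.IsBounded Ω)
    (hX : ContDiff ℝ ∞ X) {p : L2 Ω × L2Grad Ω} (hp : p ∈ closure (testPairs Ω))
    (x : E3) (j : Fin 3) :
    ∫ y in Ω, (fderiv ℝ (moll δ) (x - (y + ε • X y)) (e j)) • (p.1 y + ε • fderiv ℝ X y (p.1 y)) =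
      ∫ y in Ω, pushGradKernel X ε δ j x y (p.1 y) (p.2 y) := by
  have hX1 : ContDiff ℝ ∞ (fderiv ℝ X) := hX.fderiv_right (by simp)
  have hX2 : Continuous (fderiv ℝ (fderiv ℝ X)) := hX1.continuous_fderiv (by simp)
  have hΦ : Continuous fun y => x - (y + ε • X y) :=
    continuous_const.sub (continuous_id.add (hX.continuous.const_smul ε))
  have hm : Continuous fun y => moll δ (x - (y + ε • X y)) :=
    (moll_contDiff δ).continuous.comp hΦ
  have hmc : Continuous fun y => fderiv ℝ (moll δ) (x - (y + ε • X y)) :=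
    ((moll_contDiff δ).continuous_fderiv (by simp)).comp hΦ
  let D : E3 → E3 →L[ℝ] E3 := fun y => ContinuousLinearMap.id ℝ E3 + ε • fderiv ℝ X y
  have hD : Continuous D := continuous_const.add (hX1.continuous.const_smul ε)
  let A0 : E3 → E3 →L[ℝ] E3 := fun y => (fderiv ℝ (moll δ) (x - (y + ε • X y)) (e j)) • D y
  let A1 : E3 → E3 →L[ℝ] E3 := fun y => (moll δ (x - (y + ε • X y)) * ε) •
    fderiv ℝ (fderiv ℝ X) y (e j) -
    (ε * fderiv ℝ (moll δ) (x - (y + ε • X y)) (fderiv ℝ X y (e j))) • D y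
  let A2 : E3 → Mat3 →L[ℝ] E3 := fun y => (moll δ (x - (y + ε • X y))) •
    (D y).comp (PiLp.proj 2 (fun _ => E3) j)
  have hA0 : Continuous A0 := (hmc.clm_apply continuous_const).smul hD
  have hA1 : Continuous A1 := ((hm.mul continuous_const).smul (hX2.clm_apply continuous_const)).sub
    ((continuous_const.mul (hmc.clm_apply (hX1.continuous.clm_apply continuous_const))).smul hD)
  have hA2 : Continuous A2 := hm.smul (hD.clm_comp continuous_const)
  have mem : ∀ {F : Type} [NormedAddCommGroup F] {A : E3 → F}, Continuous A →
      MemLp A 2 (volume.restrict Ω) := fun hA =>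
    MemLp.of_continuous_of_isBounded hΩb hΩo.measurableSet hA 2
  have e0 : ∀ y v, (fderiv ℝ (moll δ) (x - (y + ε • X y)) (e j)) • (v + ε • fderiv ℝ X y v) =
      A0 y v := fun y v => by simp [A0, D]
  have e1 : ∀ y v G, pushGradKernel X ε δ j x y v G = A1 y v + A2 y G := fun y v G => by
    simp only [A1, A2, D, pushGradKernel]
    simp only [sub_apply, smul_apply,
      add_apply, ContinuousLinearMap.comp_apply, ContinuousLinearMap.id_apply,
      PiLp.proj_apply, smul_add, mul_smul]
    abel
  have hi1 : ∀ p : L2 Ω × L2Grad Ω, IntegrableOn (fun y => A1 y (p.1 y)) Ω := fun p =>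
    integrable_clm_apply (mem hA1) (Lp.memLp p.1)
  have hi2 : ∀ p : L2 Ω × L2Grad Ω, IntegrableOn (fun y => A2 y (p.2 y)) Ω := fun p =>
    integrable_clm_apply (mem hA2) (Lp.memLp p.2)
  have hcl : IsClosed {p : L2 Ω × L2Grad Ω | ∫ y in Ω, A0 y (p.1 y) =
      (∫ y in Ω, A1 y (p.1 y)) + ∫ y in Ω, A2 y (p.2 y)} :=
    isClosed_eq ((continuous_integral_clm_apply (mem hA0)).comp continuous_fst)
      (Continuous.add ((continuous_integral_clm_apply (mem hA1)).comp continuous_fst)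
      ((continuous_integral_clm_apply (mem hA2)).comp continuous_snd))
  simp only [e0, e1]
  rw [integral_add (hi1 p) (hi2 p)]
  refine closure_testPairs_subset hcl (fun p φ hφ h1 h2 => ?_) hp
  rw [mem_ofPred_eq, ← integral_add (hi1 p) (hi2 p)]
  have := testFields.fderiv_pushMoll (ε := ε) (δ := δ) hX hφ x j
  simp only [e0, e1] at this
  refine Eq.trans (integral_congr_ae ?_) (this.trans (integral_congr_ae ?_))
  · exact h1.mono fun y hy => by simp only [hy]
  · filter_upwards [h1, h2] with y hy1 hy2
    rw [hy1, hy2]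

/-- The dangerous term has size `ε M / δ ^ 4`, which `ε ≤ ρ δ` turns into `ρ M / δ ^ 3`, the size
admitted by the kernel bound. -/
theorem norm_pushGradKernel_le (hL : ∀ y, ‖fderiv ℝ X y‖ ≤ L)
    (hL₂ : ∀ y, ‖fderiv ℝ (fderiv ℝ X) y‖ ≤ L₂) (hε : 0 ≤ ε) (hε1 : ε ≤ 1)
    (hεL : ε * L ≤ 1 / 2) (hδ : 0 < δ) {M : ℝ} (hM : 0 ≤ M) (hMδ : ∀ z, |moll δ z| ≤ M / δ ^ 3)
    (hMδ' : ∀ z, ‖fderiv ℝ (moll δ) z‖ ≤ M / δ ^ 4) {ρ : ℝ} (hερ : ε ≤ ρ * δ) (j : Fin 3)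
    (x y v : E3) (G : Mat3) :
    ‖pushGradKernel X ε δ j x y v G‖ ≤ M * (2 + L₂ + 2 * ρ * L) / δ ^ 3 * (‖v‖ + ‖G‖) := by
  have hL0 : 0 ≤ L := (norm_nonneg _).trans (hL 0)
  have hL20 : 0 ≤ L₂ := (norm_nonneg (fderiv ℝ (fderiv ℝ X) 0)).trans (hL₂ 0)
  have hej : ‖e j‖ = 1 := by simp [e]
  have hGj : ‖G j‖ ≤ ‖G‖ := PiLp.norm_apply_le G j
  have h1 : ‖fderiv ℝ X y (G j)‖ ≤ L * ‖G‖ :=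
    ((fderiv ℝ X y).le_of_opNorm_le (hL y) _).trans (by gcongr)
  have h2 : ‖fderiv ℝ X y v‖ ≤ L * ‖v‖ := (fderiv ℝ X y).le_of_opNorm_le (hL y) _
  have h3 : ‖fderiv ℝ (fderiv ℝ X) y (e j) v‖ ≤ L₂ * ‖v‖ := by
    refine ContinuousLinearMap.le_of_opNorm_le _ ?_ _
    have := (fderiv ℝ (fderiv ℝ X) y).le_of_opNorm_le (hL₂ y) (e j)
    rwa [hej, mul_one] at this
  have h4 : ‖fderiv ℝ X y (e j)‖ ≤ L := by
    have := (fderiv ℝ X y).le_of_opNorm_le (hL y) (e j)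
    rwa [hej, mul_one] at this
  have h5 : ‖fderiv ℝ (moll δ) (x - (y + ε • X y)) (fderiv ℝ X y (e j))‖ ≤ M / δ ^ 4 * L :=
    (ContinuousLinearMap.le_of_opNorm_le _ (hMδ' _) _).trans (by gcongr)
  have hεM : ε * (M / δ ^ 4) ≤ ρ * (M / δ ^ 3) := by
    calc ε * (M / δ ^ 4) ≤ (ρ * δ) * (M / δ ^ 4) := by gcongr
      _ = ρ * (M / δ ^ 3) := by field_simp
  have hρ : 0 ≤ ρ := by
    by_contra hcon
    have : ρ * δ < 0 := mul_neg_of_neg_of_pos (not_le.1 hcon) hδ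
    linarith
  have hv0 := norm_nonneg v
  have hG0 := norm_nonneg G
  set m := M / δ ^ 3 with hm
  have hm0 : 0 ≤ m := by positivity
  have t1 : ‖moll δ (x - (y + ε • X y)) •
      (G j + ε • (fderiv ℝ (fderiv ℝ X) y (e j) v + fderiv ℝ X y (G j)))‖ ≤
      m * (2 * ‖G‖ + L₂ * ‖v‖) := by
    rw [norm_smul]
    refine mul_le_mul (hMδ _) ?_ (norm_nonneg _) hm0
    refine (norm_add_le _ _).trans ?_
    rw [norm_smul, Real.norm_of_nonneg hε]
    have h6 := mul_le_mul_of_nonneg_left ((norm_add_le _ _).trans (add_le_add h3 h1)) hε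
    have h7 : ε * (L₂ * ‖v‖) ≤ L₂ * ‖v‖ := mul_le_of_le_one_left (by positivity) hε1
    have h8 : ε * (L * ‖G‖) ≤ 1 / 2 * ‖G‖ := by rw [← mul_assoc]; gcongr
    linarith
  have t2 : ‖(ε * fderiv ℝ (moll δ) (x - (y + ε • X y)) (fderiv ℝ X y (e j))) •
      (v + ε • fderiv ℝ X y v)‖ ≤ ρ * m * L * (2 * ‖v‖) := by
    rw [norm_smul, norm_mul, Real.norm_of_nonneg hε]
    refine mul_le_mul ?_ ?_ (norm_nonneg _) (by positivity)
    · calc _ ≤ ε * (M / δ ^ 4 * L) := by gcongr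
        _ = ε * (M / δ ^ 4) * L := by ring
        _ ≤ _ := by gcongr
    · refine (norm_add_le _ _).trans ?_
      rw [norm_smul, Real.norm_of_nonneg hε]
      have h8 : ε * (L * ‖v‖) ≤ 1 / 2 * ‖v‖ := by rw [← mul_assoc]; gcongr
      have h9 := mul_le_mul_of_nonneg_left h2 hε
      linarith
  have t3 := (norm_sub_le _ _).trans (add_le_add t1 t2)
  refine t3.trans ?_
  have : M * (2 + L₂ + 2 * ρ * L) / δ ^ 3 = m * (2 + L₂ + 2 * ρ * L) := by rw [hm]; ring
  rw [this]
  have p1 : 0 ≤ m * ‖v‖ := by positivity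
  have p2 : 0 ≤ m * L₂ * ‖G‖ := by positivity
  have p3 : 0 ≤ m * (ρ * L) * ‖G‖ := by positivity
  nlinarith

theorem spaceV.eLpNorm_fderiv_pushMoll_le (hΩo : IsOpen Ω) (hΩb : Bornology.IsBounded Ω)
    (hX : ContDiff ℝ ∞ X) (hL : ∀ y, ‖fderiv ℝ X y‖ ≤ L)
    (hL₂ : ∀ y, ‖fderiv ℝ (fderiv ℝ X) y‖ ≤ L₂) (hε : 0 ≤ ε) (hε1 : ε ≤ 1)
    (hεL : ε * L ≤ 1 / 2) (hδ : 0 < δ) {M : ℝ} (hM : 0 ≤ M) (hMδ : ∀ z, |moll δ z| ≤ M / δ ^ 3)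
    (hMδ' : ∀ z, ‖fderiv ℝ (moll δ) z‖ ≤ M / δ ^ 4) {ρ : ℝ} (hρ : 0 ≤ ρ) (hερ : ε ≤ ρ * δ)
    {p : L2 Ω × L2Grad Ω} (hp : p ∈ closure (testPairs Ω)) (j : Fin 3) :
    eLpNorm (fun x => fderiv ℝ (pushMoll Ω X ε δ p.1) x (e j)) 2 volume ≤
      ENNReal.ofReal (M * (2 + L₂ + 2 * ρ * L) * 64) * volume (Metric.ball (0 : E3) 1) *
        eLpNorm (fun y => ‖p.1 y‖ + ‖p.2 y‖) 2 (volume.restrict Ω) := by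
  have : IsFiniteMeasure (volume.restrict Ω) :=
    isFiniteMeasure_restrict.2 hΩb.measure_lt_top.ne
  have hL0 : 0 ≤ L := (norm_nonneg _).trans (hL 0)
  have hL20 : 0 ≤ L₂ := (norm_nonneg (fderiv ℝ (fderiv ℝ X) 0)).trans (hL₂ 0)
  have hXd : Differentiable ℝ X := hX.differentiable (by simp)
  have hv : IntegrableOn p.1 Ω := (Lp.memLp p.1).integrable one_le_two
  have heq : (fun x => fderiv ℝ (pushMoll Ω X ε δ p.1) x (e j)) =
      fun x => ∫ y in Ω, pushGradKernel X ε δ j x y (p.1 y) (p.2 y) := by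
    ext1 x
    rw [(pushMoll_contDiff hX hL hε hεL hδ hv).2, spaceV.fderiv_pushMoll hΩo hΩb hX hp]
  rw [heq]
  refine eLpNorm_integral_le_of_kernel_bound (Φ := fun y => y + ε • X y)
    (J := fun x y => pushGradKernel X ε δ j x y (p.1 y) (p.2 y))
    (continuous_id.add (hX.continuous.const_smul ε))
    (norm_sub_le_two_mul_of_fderiv_le hXd hL hε hεL) hδ (by positivity) one_le_two (by simp)
    ((Lp.aestronglyMeasurable p.1).norm.add (Lp.aestronglyMeasurable p.2).norm)
    (fun x => Eventually.of_forall fun y => ?_) (fun x y hxy => ?_)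
  · refine (norm_pushGradKernel_le hL hL₂ hε hε1 hεL hδ hM hMδ hMδ' hερ j x y _ _).trans ?_
    rw [Real.norm_of_nonneg (by positivity)]
  · rw [pushGradKernel, moll_eq_zero hδ hxy.le, fderiv_moll_eq_zero hδ hxy]
    simp

end PushGrad

/-! ### Weak convergence of mollified push-forwards -/

theorem integrable_inner {α E : Type*} [MeasurableSpace α] {μ : Measure α}
    [NormedAddCommGroup E] [InnerProductSpace ℝ E] {P Q : ℝ≥0∞} [ENNReal.HolderConjugate P Q]
    {f g : α → E} (hf : MemLp f P μ) (hg : MemLp g Q μ) :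
    Integrable (fun y => inner ℝ (f y) (g y)) μ :=
  memLp_one_iff_integrable.1
    ((innerSL ℝ : E →L[ℝ] E →L[ℝ] ℝ).memLp_of_bilin (p := P) (q := Q) 1 hf hg)

theorem norm_integral_moll_smul_sub_le {ψ : E3 → E3} (hψ : Continuous ψ) {δ η : ℝ} (hδ : 0 < δ)
    {c a : E3} (h : ∀ x, ‖x - c‖ < δ → ‖ψ x - a‖ ≤ η) :
    ‖(∫ x, moll δ (x - c) • ψ x) - a‖ ≤ η := by
  have h1 : ∫ x, moll δ (x - c) = 1 := by
    rw [integral_sub_right_eq_self (fun x => moll δ x), integral_moll hδ]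
  have hc : Continuous fun x => moll δ (x - c) :=
    (moll_contDiff δ).continuous.comp (continuous_id.sub continuous_const)
  have hcs : HasCompactSupport fun x => moll δ (x - c) := by
    have := (moll_hasCompactSupport hδ).comp_homeomorph (Homeomorph.subRight c)
    exact this
  have i1 : Integrable fun x => moll δ (x - c) := hc.integrable_of_hasCompactSupport hcs
  have i2 : Integrable fun x => moll δ (x - c) • ψ x :=
    (hc.smul hψ).integrable_of_hasCompactSupport hcs.smul_right
  have h2 : a = ∫ x, moll δ (x - c) • a := by rw [integral_smul_const, h1, one_smul]
  conv_lhs => rw [h2]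
  rw [← integral_sub i2 (i1.smul_const a)]
  have h3 : ∫ x, moll δ (x - c) * η = η := by rw [integral_mul_const, h1, one_mul]
  rw [← h3]
  refine norm_integral_le_of_norm_le (i1.mul_const η) (Eventually.of_forall fun x => ?_)
  rw [← smul_sub, norm_smul, Real.norm_of_nonneg (moll_nonneg hδ _)]
  by_cases hx : ‖x - c‖ < δ
  · exact mul_le_mul_of_nonneg_left (h x hx) (moll_nonneg hδ _)
  · rw [moll_eq_zero hδ (not_lt.1 hx), zero_mul, zero_mul]

section

variable {Ω : Set E3} {X : E3 → E3} {L : ℝ}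

theorem integral_inner_pushMoll (hX : ContDiff ℝ ∞ X) (hL : ∀ y, ‖fderiv ℝ X y‖ ≤ L) {ε δ : ℝ}
    (hδ : 0 < δ) {v : E3 → E3} (hv : IntegrableOn v Ω) {ψ : E3 → E3} (hψ : Continuous ψ)
    (hψc : HasCompactSupport ψ) :
    ∫ x, inner ℝ (pushMoll Ω X ε δ v x) (ψ x) =
      ∫ y in Ω, inner ℝ (v y + ε • fderiv ℝ X y (v y))
        (∫ x, moll δ (x - (y + ε • X y)) • ψ x) := by
  set b : E3 → E3 := fun y => v y + ε • fderiv ℝ X y (v y) with hb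
  have hbi : IntegrableOn b Ω := integrableOn_add_smul_fderiv hX hL hv
  have hmc := (moll_contDiff δ).continuous
  obtain ⟨C, hC⟩ := (moll_hasCompactSupport hδ).exists_bound_of_continuous hmc
  have hC0 : 0 ≤ C := (norm_nonneg _).trans (hC 0)
  have hΦ : Continuous fun z : E3 × E3 => moll δ (z.1 - (z.2 + ε • X z.2)) :=
    hmc.comp (continuous_fst.sub (continuous_snd.add
      ((hX.continuous.comp continuous_snd).const_smul ε)))
  have hint : Integrable (fun z : E3 × E3 => moll δ (z.1 - (z.2 + ε • X z.2)) *
      inner ℝ (b z.2) (ψ z.1)) (volume.prod (volume.restrict Ω)) := by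
    have hψi : Integrable ψ := hψ.integrable_of_hasCompactSupport hψc
    refine ((hψi.norm.mul_prod hbi.norm).const_mul C).mono' ?_ (Eventually.of_forall fun z => ?_)
    · exact hΦ.aestronglyMeasurable.mul
        (hbi.aestronglyMeasurable.comp_snd.inner hψi.aestronglyMeasurable.comp_fst)
    · rw [norm_mul]
      refine mul_le_mul (hC _) ?_ (norm_nonneg _) hC0
      rw [mul_comm]; exact norm_inner_le_norm _ _
  have e1 : ∀ x, inner ℝ (pushMoll Ω X ε δ v x) (ψ x) =
      ∫ y in Ω, moll δ (x - (y + ε • X y)) * inner ℝ (b y) (ψ x) := fun x => by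
    rw [real_inner_comm, pushMoll, ← integral_inner (𝕜 := ℝ)]
    · refine integral_congr_ae (Eventually.of_forall fun y => ?_)
      simp only
      rw [real_inner_smul_right, real_inner_comm]
    · refine (hbi.norm.const_mul C).mono' ?_ (Eventually.of_forall fun y => ?_)
      · exact (hΦ.comp (continuous_const.prodMk continuous_id)).aestronglyMeasurable.smul
          hbi.aestronglyMeasurable
      · rw [norm_smul]; exact mul_le_mul_of_nonneg_right (hC _) (norm_nonneg _)
  have e2 : ∀ y, inner ℝ (b y) (∫ x, moll δ (x - (y + ε • X y)) • ψ x) =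
      ∫ x, moll δ (x - (y + ε • X y)) * inner ℝ (b y) (ψ x) := fun y => by
    rw [← integral_inner (𝕜 := ℝ)]
    · simp only [real_inner_smul_right]
    · exact ((hΦ.comp (continuous_id.prodMk continuous_const)).smul
        hψ).integrable_of_hasCompactSupport hψc.smul_left
  simp only [e1]
  rw [integral_integral_swap (f := fun x y => moll δ (x - (y + ε • X y)) * inner ℝ (b y) (ψ x))
    hint]
  exact integral_congr_ae (Eventually.of_forall fun y => (e2 y).symm)

/-- By Fubini the mollification falls on `ψ`, which is averaged over a ball of radius `δ n` around a
point tending to `y`. These averages converge to `ψ y`, and dominated convergence applies with a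
multiple of `‖v‖` as majorant. -/
theorem tendsto_integral_inner_pushMoll (hX : ContDiff ℝ ∞ X) (hL : ∀ y, ‖fderiv ℝ X y‖ ≤ L)
    {ε δ : ℕ → ℝ} (hε : ∀ n, 0 ≤ ε n) (hεL : ∀ n, ε n * L ≤ 1 / 2) (hδ : ∀ n, 0 < δ n)
    (hε0 : Tendsto ε atTop (𝓝 0)) (hδ0 : Tendsto δ atTop (𝓝 0))
    {v : E3 → E3} (hv : IntegrableOn v Ω) {ψ : E3 → E3} (hψ : Continuous ψ)
    (hψc : HasCompactSupport ψ) :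
    Tendsto (fun n => ∫ x, inner ℝ (pushMoll Ω X (ε n) (δ n) v x) (ψ x)) atTop
      (𝓝 (∫ y in Ω, inner ℝ (v y) (ψ y))) := by
  simp only [fun n => integral_inner_pushMoll (Ω := Ω) (ε := ε n) hX hL (hδ n) hv hψ hψc]
  obtain ⟨C, hC⟩ := hψc.exists_bound_of_continuous hψ
  have hC0 : 0 ≤ C := (norm_nonneg _).trans (hC 0)
  have hbm : ∀ n, AEStronglyMeasurable (fun y => v y + ε n • fderiv ℝ X y (v y))
    (volume.restrict Ω) := fun n => (integrableOn_add_smul_fderiv hX hL hv).aestronglyMeasurable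
  refine tendsto_integral_of_dominated_convergence (fun y => (2 * ‖v y‖) * (2 * C)) (fun n => ?_)
    ((hv.norm.const_mul 2).mul_const _) (fun n => Eventually.of_forall fun y => ?_)
    (Eventually.of_forall fun y => ?_)
  · refine (hbm n).inner ?_
    refine Continuous.aestronglyMeasurable ?_
    have : ∀ y, ∫ x, moll (δ n) (x - (y + ε n • X y)) • ψ x =
        ∫ x, moll (δ n) x • ψ (x + (y + ε n • X y)) := fun y => by
      rw [← integral_add_right_eq_self _ (y + ε n • X y)]
      simp
    simp only [this]
    have hm := (moll_contDiff (δ n)).continuous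
    refine continuous_of_dominated (bound := fun x => ‖moll (δ n) x‖ * C) (fun y => ?_)
      (fun y => Eventually.of_forall fun x => ?_) ?_ (Eventually.of_forall fun x => ?_)
    · exact (hm.smul (hψ.comp (continuous_id.add continuous_const))).aestronglyMeasurable
    · rw [norm_smul]; gcongr; exact hC _
    · exact ((hm.integrable_of_hasCompactSupport (moll_hasCompactSupport (hδ n))).norm.mul_const C)
    · have hXc : Continuous fun y => x + (y + ε n • X y) :=
        continuous_const.add (continuous_id.add (hX.continuous.const_smul (ε n)))
      exact (hψ.comp hXc).const_smul (moll (δ n) x)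
  · refine (norm_inner_le_norm _ _).trans ?_
    gcongr
    · refine (norm_add_le _ _).trans ?_
      rw [norm_smul, Real.norm_of_nonneg (hε n)]
      have h1 := mul_le_mul_of_nonneg_left ((fderiv ℝ X y).le_of_opNorm_le (hL y) (v y)) (hε n)
      rw [← mul_assoc] at h1
      have h2 := mul_le_mul_of_nonneg_right (hεL n) (norm_nonneg (v y))
      linarith [norm_nonneg (v y)]
    · have := norm_integral_moll_smul_sub_le hψ (hδ n) (c := y + ε n • X y) (a := 0) (η := C)
        (fun x _ => by rw [sub_zero]; exact hC x)
      rw [sub_zero] at this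
      linarith
  · refine Tendsto.inner ?_ ?_
    · have : Tendsto (fun n => v y + ε n • fderiv ℝ X y (v y)) atTop
          (𝓝 (v y + (0 : ℝ) • fderiv ℝ X y (v y))) := (hε0.smul_const _).const_add _
      simpa using this
    · rw [Metric.tendsto_atTop]
      intro η hη
      obtain ⟨τ, hτ, hτψ⟩ := Metric.continuousAt_iff.1 (hψ.continuousAt (x := y)) (η / 2)
        (by positivity)
      have hlim : Tendsto (fun n => δ n + ε n * ‖X y‖) atTop (𝓝 (0 + 0 * ‖X y‖)) :=
        hδ0.add (hε0.mul_const _)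
      rw [zero_mul, zero_add] at hlim
      obtain ⟨N, hN⟩ := eventually_atTop.1 (hlim.eventually (gt_mem_nhds hτ))
      refine ⟨N, fun n hn => ?_⟩
      rw [dist_eq_norm]
      refine (norm_integral_moll_smul_sub_le hψ (hδ n) (η := η / 2) fun x hx => ?_).trans_lt
        (by linarith)
      have := @hτψ x ?_
      · rw [dist_eq_norm] at this; exact this.le
      · rw [dist_eq_norm]
        have h1 : x - y = (x - (y + ε n • X y)) + ε n • X y := by abel
        rw [h1]
        refine (norm_add_le _ _).trans_lt ?_
        rw [norm_smul, Real.norm_of_nonneg (hε n)]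
        have := hN n hn
        linarith

end

/-! ### Simultaneous approximation by test fields. -/

theorem testFields.integral_fderiv_inner {Ω : Set E3} {φ : E3 → E3} (hφ : φ ∈ testFields Ω)
    {ψ : E3 → E3} (hψ : ContDiff ℝ ∞ ψ) (j : Fin 3) :
    ∫ x in Ω, inner ℝ (fderiv ℝ φ x (e j)) (ψ x) = -∫ x in Ω, inner ℝ (φ x) (fderiv ℝ ψ x (e j)) := by
  rw [testFields.integral_eq hφ fun x hx => by
    rw [fderiv_eq_zero_of_notMem_tsupport hx]; simp,
    testFields.integral_eq hφ fun x hx => by rw [image_eq_zero_of_notMem_tsupport hx]; simp]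
  have := integral_fderiv_bilin_eq_neg (innerSL ℝ) (f := ψ) (g := φ)
    (hψ.of_le (by exact_mod_cast le_top)) (hφ.1.of_le (by exact_mod_cast le_top)) hφ.2.1 (e j)
  have e1 : ∀ x, inner ℝ (fderiv ℝ φ x (e j)) (ψ x) = innerSL ℝ (ψ x) (fderiv ℝ φ x (e j)) :=
    fun x => (real_inner_comm _ _)
  have e2 : ∀ x, inner ℝ (φ x) (fderiv ℝ ψ x (e j)) = innerSL ℝ (fderiv ℝ ψ x (e j)) (φ x) :=
    fun x => (real_inner_comm _ _)
  simp only [e1, e2]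
  exact this

/-- The choice `δ = c ε / 2` serves two opposite needs: `δ < c ε` keeps the mollified field inside
`Ω`, and `ε ≤ (2 / c) δ` controls its gradient. -/
theorem exists_scales {c ε₀ L : ℝ} (hc : 0 < c) (hε₀ : 0 < ε₀) (hL0 : 0 ≤ L) :
    ∃ ε δ : ℕ → ℝ, (∀ n, 0 < ε n) ∧ (∀ n, ε n ≤ 1) ∧ (∀ n, ε n < ε₀) ∧ (∀ n, ε n * L ≤ 1 / 2) ∧
      (∀ n, 0 < δ n) ∧ (∀ n, δ n < c * ε n) ∧ (∀ n, ε n ≤ 2 / c * δ n) ∧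
      Tendsto ε atTop (𝓝 0) ∧ Tendsto δ atTop (𝓝 0) := by
  set ε₁ := min (ε₀ / 2) (min 1 (1 / (2 * (L + 1)))) with hε₁
  have hε₁0 : 0 < ε₁ := lt_min (by positivity) (lt_min one_pos (by positivity))
  have hε₁1 : ε₁ ≤ 1 := (min_le_right _ _).trans (min_le_left _ _)
  have hε₁ε₀ : ε₁ < ε₀ := (min_le_left _ _).trans_lt (by linarith)
  have hε₁L : ε₁ * L ≤ 1 / 2 := by
    have h1 : ε₁ ≤ 1 / (2 * (L + 1)) := (min_le_right _ _).trans (min_le_right _ _)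
    rw [le_div_iff₀ (by positivity)] at h1
    nlinarith
  let ε : ℕ → ℝ := fun n => ε₁ * (1 / ((n : ℝ) + 1))
  let δ : ℕ → ℝ := fun n => c / 2 * ε n
  have hq : ∀ n : ℕ, 0 < 1 / ((n : ℝ) + 1) ∧ 1 / ((n : ℝ) + 1) ≤ 1 := fun n => by
    refine ⟨by positivity, ?_⟩
    rw [div_le_one (by positivity)]
    have : (0 : ℝ) ≤ n := n.cast_nonneg
    linarith
  have hε : ∀ n, 0 < ε n := fun n => mul_pos hε₁0 (hq n).1
  have hεε₁ : ∀ n, ε n ≤ ε₁ := fun n => mul_le_of_le_one_right hε₁0.le (hq n).2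
  have hεL : ∀ n, ε n * L ≤ 1 / 2 := fun n =>
    (mul_le_mul_of_nonneg_right (hεε₁ n) hL0).trans hε₁L
  have hδ : ∀ n, 0 < δ n := fun n => mul_pos (by positivity) (hε n)
  have hε0 : Tendsto ε atTop (𝓝 0) := by
    have := (tendsto_one_div_add_atTop_nhds_zero_nat (𝕜 := ℝ)).const_mul ε₁
    rwa [mul_zero] at this
  have hδ0 : Tendsto δ atTop (𝓝 0) := by
    have := hε0.const_mul (c / 2)
    rwa [mul_zero] at this
  refine ⟨ε, δ, hε, fun n => (hεε₁ n).trans hε₁1, fun n => (hεε₁ n).trans_lt hε₁ε₀, hεL, hδ,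
    fun n => ?_, fun n => ?_, hε0, hδ0⟩
  · have := mul_pos hc (hε n)
    show c / 2 * ε n < c * ε n
    linarith
  · show ε n ≤ 2 / c * (c / 2 * ε n)
    rw [← mul_assoc]
    have : 2 / c * (c / 2) = 1 := by field_simp
    rw [this, one_mul]

theorem exists_fderiv_bounds {E F : Type*} [NormedAddCommGroup E] [NormedSpace ℝ E]
    [NormedAddCommGroup F] [NormedSpace ℝ F] {X : E → F} (hX : ContDiff ℝ ∞ X)
    (hXc : HasCompactSupport X) :
    ∃ L L₂ : ℝ, 0 ≤ L ∧ (∀ y, ‖fderiv ℝ X y‖ ≤ L) ∧ ∀ y, ‖fderiv ℝ (fderiv ℝ X) y‖ ≤ L₂ := by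
  have hX1 : ContDiff ℝ ∞ (fderiv ℝ X) := hX.fderiv_right (by simp)
  obtain ⟨L, hL⟩ := hX.lipschitzWith_of_hasCompactSupport hXc (by simp)
  obtain ⟨L₂, hL₂⟩ := hX1.lipschitzWith_of_hasCompactSupport (hXc.fderiv ℝ) (by simp)
  exact ⟨L, L₂, L.2, fun y => norm_fderiv_le_of_lipschitz ℝ hL,
    fun y => norm_fderiv_le_of_lipschitz ℝ hL₂⟩

/-- Approximation of the elements of `V` by test fields, simultaneously in `H¹` (with bounds) and
in all Lebesgue spaces (with bounds). -/
theorem exists_testFields_approx {Ω : Set E3} (hΩo : IsOpen Ω) (hΩb : Bornology.IsBounded Ω)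
    (hΩ : HasC2Boundary Ω) {p : L2 Ω × L2Grad Ω} (hp : p ∈ closure (testPairs Ω)) :
    ∃ φ : ℕ → E3 → E3, (∀ n, φ n ∈ testFields Ω) ∧
      (∀ ψ : E3 → E3, Continuous ψ → HasCompactSupport ψ →
        Tendsto (fun n => ∫ x in Ω, inner ℝ (φ n x) (ψ x)) atTop
          (𝓝 (∫ y in Ω, inner ℝ (p.1 y) (ψ y)))) ∧
      (∃ C : ℝ≥0∞, C ≠ ⊤ ∧ ∀ R : ℝ≥0∞, 1 ≤ R → R ≠ ⊤ → ∀ n,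
        eLpNorm (φ n) R (volume.restrict Ω) ≤ C * eLpNorm p.1 R (volume.restrict Ω)) ∧
      (∃ C : ℝ≥0∞, C ≠ ⊤ ∧ ∀ j n,
        eLpNorm (fun x => fderiv ℝ (φ n) x (e j)) 2 (volume.restrict Ω) ≤ C) := by
  have : IsFiniteMeasure (volume.restrict Ω) :=
    isFiniteMeasure_restrict.2 hΩb.measure_lt_top.ne
  obtain ⟨X, hX, hXc, c, ε₀, hc, hε₀, hball⟩ := exists_inward_field hΩo hΩb hΩ
  obtain ⟨L, L₂, hL0, hL, hL₂⟩ := exists_fderiv_bounds hX hXc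
  obtain ⟨M, hM, hMb⟩ := exists_moll_bound
  obtain ⟨ε, δ, hε, hε1, hεε₀, hεL, hδ, hδσ, hεδ, hε0, hδ0⟩ := exists_scales hc hε₀ hL0
  have hv : IntegrableOn p.1 Ω := (Lp.memLp p.1).integrable one_le_two
  let φ : ℕ → E3 → E3 := fun n => pushMoll Ω X (ε n) (δ n) p.1
  have hφ : ∀ n, φ n ∈ testFields Ω := fun n => by
    refine pushMoll_mem_testFields hΩb hX hL (hε n).le (hεL n) (hδ n) (hδσ n)
      (hball (ε n) (hε n) (hεε₀ n)) hv
      (fun q hq => spaceH.integral_fderiv_apply_eq_zero hΩo hΩb (spaceV.fst_mem_spaceH hp) hq)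
  have hconv : ∀ ψ : E3 → E3, Continuous ψ → HasCompactSupport ψ →
      Tendsto (fun n => ∫ x in Ω, inner ℝ (φ n x) (ψ x)) atTop
        (𝓝 (∫ y in Ω, inner ℝ (p.1 y) (ψ y))) := fun ψ hψ hψc => by
    have := tendsto_integral_inner_pushMoll (Ω := Ω) hX hL (fun n => (hε n).le) hεL hδ hε0 hδ0 hv
      hψ hψc
    refine this.congr fun n => (testFields.integral_eq (hφ n) fun x hx => ?_).symm
    rw [image_eq_zero_of_notMem_tsupport hx, inner_zero_left]
  have hle : ∀ (g : E3 → E3) (R : ℝ≥0∞), eLpNorm g R (volume.restrict Ω) ≤ eLpNorm g R volume :=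
    fun g R => eLpNorm_mono_measure _ Measure.restrict_le_self
  have hball_ne : volume (Metric.ball (0 : E3) 1) ≠ ⊤ := measure_ball_lt_top.ne
  refine ⟨φ, hφ, hconv, ⟨_, ENNReal.mul_ne_top ENNReal.ofReal_ne_top hball_ne,
    fun R hR1 hRt n => (hle _ _).trans (eLpNorm_pushMoll_le hX hL (hε n).le (hεL n) (hδ n) hM
      (fun z => (hMb _ (hδ n) z).1) hR1 hRt (Lp.aestronglyMeasurable p.1))⟩,
    ⟨ENNReal.ofReal (M * (2 + L₂ + 2 * (2 / c) * L) * 64) * volume (Metric.ball (0 : E3) 1) *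
        eLpNorm (fun y => ‖p.1 y‖ + ‖p.2 y‖) 2 (volume.restrict Ω), ?_, fun j n => ?_⟩⟩
  · have hβ : MemLp (fun y => ‖p.1 y‖ + ‖p.2 y‖) 2 (volume.restrict Ω) :=
      (Lp.memLp p.1).norm.add (Lp.memLp p.2).norm
    exact ENNReal.mul_ne_top (ENNReal.mul_ne_top ENNReal.ofReal_ne_top hball_ne) hβ.eLpNorm_ne_top
  · refine (hle _ _).trans (spaceV.eLpNorm_fderiv_pushMoll_le hΩo hΩb hX hL hL₂ (hε n).le
      (hε1 n) (hεL n) (hδ n) hM (fun z => (hMb _ (hδ n) z).1)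
      (fun z => (hMb _ (hδ n) z).2) (ρ := 2 / c) (by positivity) (hεδ n) hp j)

/-- **Simultaneous approximation.** A functional on `V ∩ L^P` vanishing on test fields
vanishes. -/
theorem annihilator_extends {Ω : Set E3} (hΩo : IsOpen Ω) (hΩb : Bornology.IsBounded Ω)
    (hΩ : HasC2Boundary Ω) {P Q : ℝ≥0∞} [Fact (1 ≤ P)] [Fact (1 ≤ Q)] [ENNReal.HolderConjugate P Q]
    (hP : P ≠ ⊤) (hQ : Q ≠ ⊤) {h : E3 → E3} {Γ : E3 → Mat3} {F : E3 → E3}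
    (hh : MemLp h 2 (volume.restrict Ω)) (hΓ : MemLp Γ 2 (volume.restrict Ω))
    (hF : MemLp F Q (volume.restrict Ω))
    (hvan : ∀ φ ∈ testFields Ω, (∫ x in Ω, inner ℝ (φ x) (h x)) +
      (∫ x in Ω, inner ℝ (grad φ x) (Γ x)) + (∫ x in Ω, inner ℝ (φ x) (F x)) = 0)
    {p : L2 Ω × L2Grad Ω} (hp : p ∈ closure (testPairs Ω))
    (hpP : MemLp p.1 P (volume.restrict Ω)) :
    (∫ x in Ω, inner ℝ (p.1 x) (h x)) +
      (∫ x in Ω, inner ℝ (p.2 x) (Γ x)) + (∫ x in Ω, inner ℝ (p.1 x) (F x)) = 0 := by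
  have : IsFiniteMeasure (volume.restrict Ω) :=
    isFiniteMeasure_restrict.2 hΩb.measure_lt_top.ne
  obtain ⟨φ, hφ, hconv, ⟨C, hC, hbound⟩, C', hC', hbound'⟩ :=
    exists_testFields_approx hΩo hΩb hΩ hp
  have mem : ∀ {F : Type} [NormedAddCommGroup F] {A : E3 → F} {R : ℝ≥0∞}, Continuous A →
      MemLp A R (volume.restrict Ω) := fun hA =>
    MemLp.of_continuous_of_isBounded hΩb hΩo.measurableSet hA _
  have t1 : Tendsto (fun n => ∫ x in Ω, inner ℝ (φ n x) (h x)) atTop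
      (𝓝 (∫ y in Ω, inner ℝ (p.1 y) (h y))) :=
    tendsto_integral_inner_of_tendsto_smooth (P := 2) (Q := 2) (by simp)
      (fun n => mem (testFields.continuous (hφ n))) (Lp.memLp p.1)
      (ENNReal.mul_ne_top hC (Lp.memLp p.1).eLpNorm_ne_top)
      (hbound 2 one_le_two (by simp)) (fun ψ hψ hψc => hconv ψ hψ.continuous hψc) hh
  have t3 : Tendsto (fun n => ∫ x in Ω, inner ℝ (φ n x) (F x)) atTop
      (𝓝 (∫ y in Ω, inner ℝ (p.1 y) (F y))) :=
    tendsto_integral_inner_of_tendsto_smooth (P := P) (Q := Q) hQ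
      (fun n => mem (testFields.continuous (hφ n))) hpP
      (ENNReal.mul_ne_top hC hpP.eLpNorm_ne_top)
      (hbound P Fact.out hP) (fun ψ hψ hψc => hconv ψ hψ.continuous hψc) hF
  have hpj : ∀ (G : E3 → Mat3), MemLp G 2 (volume.restrict Ω) → ∀ j : Fin 3,
      MemLp (fun x => G x j) 2 (volume.restrict Ω) := fun G hG j =>
    (PiLp.proj 2 (fun _ : Fin 3 => E3) j : Mat3 →L[ℝ] E3).comp_memLp' hG
  -- The partial derivatives are bounded in `L²`. Against smooth `ψ` the derivative moves to `ψ`,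
  -- both for the approximants and for the limit, which reduces the claim to convergence of the
  -- fields themselves.
  have t2j : ∀ j : Fin 3, Tendsto (fun n => ∫ x in Ω, inner ℝ (fderiv ℝ (φ n) x (e j)) (Γ x j))
      atTop (𝓝 (∫ y in Ω, inner ℝ (p.2 y j) (Γ y j))) := fun j => by
    refine tendsto_integral_inner_of_tendsto_smooth (P := 2) (Q := 2) (by simp)
      (a := fun n x => fderiv ℝ (φ n) x (e j)) (a₀ := fun x => p.2 x j)
      (fun n => mem ((testFields.continuous_fderiv (hφ n)).clm_apply continuous_const))
      (hpj _ (Lp.memLp p.2) j) hC' (hbound' j) (fun ψ hψ hψc => ?_) (hpj _ hΓ j)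
    simp only [testFields.integral_fderiv_inner (hφ _) hψ j]
    rw [spaceV.integral_inner_eq_neg hΩo hΩb hp hψ j]
    exact (hconv _ ((hψ.continuous_fderiv (by simp)).clm_apply continuous_const)
      (hψc.fderiv_apply ℝ (e j))).neg
  have hsum : ∀ G : E3 → Mat3, MemLp G 2 (volume.restrict Ω) → ∫ x in Ω, inner ℝ (G x) (Γ x) =
      ∑ j, ∫ x in Ω, inner ℝ (G x j) (Γ x j) := fun G hG => by
    simp only [PiLp.inner_apply]
    exact integral_finsetSum _ fun j _ => integrable_inner (P := 2) (Q := 2) (hpj _ hG j) (hpj _ hΓ j)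
  have t2 : Tendsto (fun n => ∫ x in Ω, inner ℝ (grad (φ n) x) (Γ x)) atTop
      (𝓝 (∫ y in Ω, inner ℝ (p.2 y) (Γ y))) := by
    rw [hsum _ (Lp.memLp p.2)]
    simp only [fun n => hsum (grad (φ n)) (mem (testFields.continuous_grad (hφ n)))]
    exact tendsto_finsetSum _ fun j _ => t2j j
  refine tendsto_nhds_unique ((t1.add t2).add t3) ?_
  simp only [hvan _ (hφ _)]
  exact tendsto_const_nhds

/-! ### Poincaré inequality and compactness -/

theorem norm_clm_apply_le_norm_mul (A : E3 →L[ℝ] E3) (z : E3) :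
    ‖A z‖ ≤ ‖z‖ * ‖(WithLp.toLp 2 (fun j => A (e j)) : Mat3)‖ := by
  rw [← sum_fderiv_single A z]
  refine (norm_sum_le _ _).trans ?_
  simp only [norm_smul]
  rw [EuclideanSpace.norm_eq, PiLp.norm_eq_of_L2, ]
  exact Real.sum_mul_le_sqrt_mul_sqrt _ _ _

theorem enorm_integral_rpow_two_le {α F : Type*} [MeasurableSpace α] [NormedAddCommGroup F]
    [NormedSpace ℝ F] (ν : Measure α) [IsProbabilityMeasure ν] {f : α → F}
    (hf : AEStronglyMeasurable f ν) :
    ‖∫ y, f y ∂ν‖ₑ ^ (2 : ℝ) ≤ ∫⁻ y, ‖f y‖ₑ ^ (2 : ℝ) ∂ν := by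
  have h1 := eLpNorm_le_eLpNorm_of_exponent_le (one_le_two : (1 : ℝ≥0∞) ≤ 2) hf
  rw [eLpNorm_one_eq_lintegral_enorm, eLpNorm_eq_lintegral_rpow_enorm_toReal (by simp) (by simp)]
    at h1
  have h2 := ENNReal.rpow_le_rpow ((enorm_integral_le_lintegral_enorm f).trans h1) zero_le_two
  rw [← ENNReal.rpow_mul] at h2
  simpa using h2

/-- The difference is the integral of the directional derivative along the segment; Jensen in `s`
and translation invariance in `x` finish. This estimate drives both the Poincaré inequality and
Rellich's theorem. -/
theorem lintegral_translate_sub_le {φ : E3 → E3} (hφ : ContDiff ℝ 1 φ) (z : E3) :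
    ∫⁻ x, ‖φ (x + z) - φ x‖ₑ ^ (2 : ℝ) ≤ ‖z‖ₑ ^ (2 : ℝ) * ∫⁻ x, ‖grad φ x‖ₑ ^ (2 : ℝ) := by
  have hd := hφ.differentiable one_ne_zero
  have hdc := hφ.continuous_fderiv one_ne_zero
  have hgc : Continuous (grad φ) := (PiLp.continuous_toLp 2 _).comp
    (continuous_pi fun j => hdc.clm_apply continuous_const)
  let ν : Measure ℝ := volume.restrict (Ioc 0 1)
  have : IsProbabilityMeasure ν := ⟨by simp [ν]⟩
  have hpt : ∀ x, ‖φ (x + z) - φ x‖ₑ ^ (2 : ℝ) ≤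
      ∫⁻ s, ‖z‖ₑ ^ (2 : ℝ) * ‖grad φ (x + s • z)‖ₑ ^ (2 : ℝ) ∂ν := fun x => by
    have hder : ∀ s : ℝ, HasDerivAt (fun s : ℝ => φ (x + s • z)) (fderiv ℝ φ (x + s • z) z) s :=
      fun s => by
        have h1 : HasDerivAt (fun s : ℝ => x + s • z) z s := by
          simpa using ((hasDerivAt_id s).smul_const z).const_add x
        exact (hd _).hasFDerivAt.comp_hasDerivAt s h1
    have hcont : Continuous fun s : ℝ => fderiv ℝ φ (x + s • z) z :=
      (hdc.comp (continuous_const.add (continuous_id.smul continuous_const))).clm_apply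
        continuous_const
    have hint := intervalIntegral.integral_eq_sub_of_hasDerivAt (a := 0) (b := 1)
      (fun s _ => hder s) (hcont.intervalIntegrable _ _)
    rw [one_smul, zero_smul, add_zero, intervalIntegral.integral_of_le zero_le_one] at hint
    rw [← hint]
    refine (enorm_integral_rpow_two_le ν hcont.aestronglyMeasurable).trans ?_
    refine lintegral_mono fun s => ?_
    rw [← ENNReal.mul_rpow_of_nonneg _ _ zero_le_two]
    refine ENNReal.rpow_le_rpow ?_ zero_le_two
    rw [← ofReal_norm, ← ofReal_norm, ← ofReal_norm, ← ENNReal.ofReal_mul (norm_nonneg _)]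
    exact ENNReal.ofReal_le_ofReal (norm_clm_apply_le_norm_mul _ _)
  refine (lintegral_mono hpt).trans ?_
  have hmeas : Continuous fun q : E3 × ℝ => ‖grad φ (q.1 + q.2 • z)‖ₑ ^ (2 : ℝ) :=
    ENNReal.continuous_rpow_const.comp (continuous_enorm.comp (hgc.comp
      (continuous_fst.add (continuous_snd.smul continuous_const))))
  rw [lintegral_lintegral_swap (f := fun x s => ‖z‖ₑ ^ (2 : ℝ) * ‖grad φ (x + s • z)‖ₑ ^ (2 : ℝ))
    ((measurable_const.mul hmeas.measurable).aemeasurable)]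
  have hinner : ∀ s : ℝ, ∫⁻ x, ‖z‖ₑ ^ (2 : ℝ) * ‖grad φ (x + s • z)‖ₑ ^ (2 : ℝ) =
      ‖z‖ₑ ^ (2 : ℝ) * ∫⁻ x, ‖grad φ x‖ₑ ^ (2 : ℝ) := fun s => by
    rw [lintegral_const_mul' _ _ (ENNReal.rpow_ne_top_of_nonneg zero_le_two enorm_ne_top)]
    rw [lintegral_add_right_eq_self (fun x => ‖grad φ x‖ₑ ^ (2 : ℝ))]
  simp only [hinner, lintegral_const, measure_univ, mul_one, le_refl]

/-- Convolution with the mollifier. -/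
def mollify (Ω : Set E3) (δ : ℝ) (w : E3 → E3) (x : E3) : E3 := ∫ y in Ω, moll δ (x - y) • w y

theorem mollify_continuous {Ω : Set E3} {δ : ℝ} (hδ : 0 < δ) {w : E3 → E3}
    (hw : IntegrableOn w Ω) : Continuous (mollify Ω δ w) :=
  (contDiff_integral_kernel (Φ := id) continuous_id Function.injective_id (moll_contDiff δ)
    (moll_hasCompactSupport hδ) hw).1.continuous

/-- Seen as a density, the mollifier is a probability measure on displacements of length at most
`δ`, and the error is the mean of `φ x - φ (x - w)`. Jensen and the translation estimate conclude;
integrating over `Ω` only is harmless since `φ` vanishes outside. -/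
theorem testFields.lintegral_sub_mollify_le {Ω : Set E3} {φ : E3 → E3} (hφ : φ ∈ testFields Ω)
    {δ : ℝ} (hδ : 0 < δ) :
    ∫⁻ x, ‖φ x - mollify Ω δ φ x‖ₑ ^ (2 : ℝ) ≤
      ENNReal.ofReal δ ^ (2 : ℝ) * ∫⁻ x, ‖grad φ x‖ₑ ^ (2 : ℝ) := by
  have hφc := testFields.continuous hφ
  have hφ1 : ContDiff ℝ 1 φ := hφ.1.of_le (by exact_mod_cast le_top)
  have hmc : Continuous (moll δ) := (moll_contDiff δ).continuous
  have hmi : Integrable (moll δ) := hmc.integrable_of_hasCompactSupport (moll_hasCompactSupport hδ)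
  let ν : Measure E3 := volume.withDensity fun w => ENNReal.ofReal (moll δ w)
  have hdm : Measurable fun w => ENNReal.ofReal (moll δ w) := hmc.measurable.ennreal_ofReal
  have : IsProbabilityMeasure ν := ⟨by
    rw [withDensity_apply _ MeasurableSet.univ, Measure.restrict_univ,
      ← ofReal_integral_eq_lintegral_ofReal hmi (Eventually.of_forall (moll_nonneg hδ)),
      integral_moll hδ, ENNReal.ofReal_one]⟩
  obtain ⟨C, hC⟩ := hφ.2.1.exists_bound_of_continuous hφc
  have hi : ∀ x, Integrable (fun w => φ (x - w)) ν := fun x =>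
    Integrable.of_bound (hφc.comp (continuous_const.sub continuous_id)).aestronglyMeasurable C
      (Eventually.of_forall fun w => hC _)
  have heq : ∀ x, φ x - mollify Ω δ φ x = ∫ w, (φ x - φ (x - w)) ∂ν := fun x => by
    rw [integral_sub (integrable_const _) (hi x), integral_const, probReal_univ, one_smul]
    congr 1
    rw [integral_withDensity_eq_integral_toReal_smul hdm (Eventually.of_forall fun _ =>
      ENNReal.ofReal_lt_top), mollify,
      testFields.integral_eq hφ fun y hy => by
        rw [image_eq_zero_of_notMem_tsupport hy, smul_zero]]
    rw [← integral_sub_left_eq_self _ volume x]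
    refine integral_congr_ae (Eventually.of_forall fun w => ?_)
    simp only [sub_sub_cancel, ENNReal.toReal_ofReal (moll_nonneg hδ _)]
  have hae : ∀ᵐ w ∂ν, ‖w‖ ≤ δ := by
    rw [ae_withDensity_iff hdm]
    refine Eventually.of_forall fun w hw => ?_
    by_contra hcon
    exact hw (by rw [moll_eq_zero hδ (not_le.1 hcon).le, ENNReal.ofReal_zero])
  calc ∫⁻ x, ‖φ x - mollify Ω δ φ x‖ₑ ^ (2 : ℝ)
      ≤ ∫⁻ x, (∫⁻ w, ‖φ x - φ (x - w)‖ₑ ^ (2 : ℝ) ∂ν) := by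
        refine lintegral_mono fun x => ?_
        rw [heq]
        exact enorm_integral_rpow_two_le ν
          (continuous_const.sub (hφc.comp (continuous_const.sub continuous_id))).aestronglyMeasurable
    _ = ∫⁻ w, (∫⁻ x, ‖φ x - φ (x - w)‖ₑ ^ (2 : ℝ)) ∂ν := by
        refine lintegral_lintegral_swap (f := fun x w => ‖φ x - φ (x - w)‖ₑ ^ (2 : ℝ)) ?_
        exact (ENNReal.continuous_rpow_const.comp (continuous_enorm.comp
          ((hφc.comp continuous_fst).sub
            (hφc.comp (continuous_fst.sub continuous_snd))))).measurable.aemeasurable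
    _ ≤ ∫⁻ _w, (ENNReal.ofReal δ ^ (2 : ℝ) * ∫⁻ x, ‖grad φ x‖ₑ ^ (2 : ℝ)) ∂ν := by
        refine lintegral_mono_ae (hae.mono fun w hw => ?_)
        rw [← lintegral_add_right_eq_self _ w]
        simp only [add_sub_cancel_right]
        refine (lintegral_translate_sub_le hφ1 w).trans ?_
        gcongr
        rw [← ofReal_norm]
        exact ENNReal.ofReal_le_ofReal hw
    _ = _ := by rw [lintegral_const, measure_univ, mul_one]

theorem eLpNorm_two_le_of_lintegral_le {α F G : Type*} [MeasurableSpace α] {μ : Measure α}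
    [NormedAddCommGroup F] [NormedAddCommGroup G] {f : α → F} {g : α → G} {C : ℝ≥0∞}
    (h : ∫⁻ x, ‖f x‖ₑ ^ (2 : ℝ) ∂μ ≤ C ^ (2 : ℝ) * ∫⁻ x, ‖g x‖ₑ ^ (2 : ℝ) ∂μ) :
    eLpNorm f 2 μ ≤ C * eLpNorm g 2 μ := by
  rw [eLpNorm_eq_lintegral_rpow_enorm_toReal (by simp) (by simp),
    eLpNorm_eq_lintegral_rpow_enorm_toReal (by simp) (by simp)]
  simp only [ENNReal.toReal_ofNat]
  refine (ENNReal.rpow_le_rpow h (by norm_num)).trans ?_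
  rw [ENNReal.mul_rpow_of_nonneg _ _ (by norm_num), ← ENNReal.rpow_mul]
  norm_num

theorem testFields.setLIntegral_grad_eq {Ω : Set E3} {φ : E3 → E3} (hφ : φ ∈ testFields Ω) :
    ∫⁻ x in Ω, ‖grad φ x‖ₑ ^ (2 : ℝ) = ∫⁻ x, ‖grad φ x‖ₑ ^ (2 : ℝ) := by
  refine setLIntegral_eq_of_support_subset fun x hx => ?_
  by_contra hcon
  refine hx ?_
  have h0 : x ∉ tsupport φ := fun h => hcon (hφ.2.2.1 h)
  have : grad φ x = 0 := by
    rw [grad, fderiv_eq_zero_of_notMem_tsupport h0]; rfl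
  simp [this]

theorem testFields.eLpNorm_sub_mollify_le {Ω : Set E3} {φ : E3 → E3} (hφ : φ ∈ testFields Ω)
    {δ : ℝ} (hδ : 0 < δ) :
    eLpNorm (fun x => φ x - mollify Ω δ φ x) 2 (volume.restrict Ω) ≤
      ENNReal.ofReal δ * eLpNorm (grad φ) 2 (volume.restrict Ω) := by
  refine eLpNorm_two_le_of_lintegral_le ?_
  rw [testFields.setLIntegral_grad_eq hφ]
  exact (setLIntegral_le_lintegral _ _).trans (testFields.lintegral_sub_mollify_le hφ hδ)

/-- A translation by `2 ρ` moves `Ω` off itself, so `φ (x + z) = 0` for `x ∈ Ω` and the translation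
estimate bounds `φ` itself. -/
theorem testFields.eLpNorm_le {Ω : Set E3} (hΩm : MeasurableSet Ω) {ρ : ℝ}
    (hρ : Ω ⊆ Metric.ball 0 ρ) (hρ0 : 0 < ρ) {φ : E3 → E3} (hφ : φ ∈ testFields Ω) :
    eLpNorm φ 2 (volume.restrict Ω) ≤
      ENNReal.ofReal (2 * ρ) * eLpNorm (grad φ) 2 (volume.restrict Ω) := by
  have hφ1 : ContDiff ℝ 1 φ := hφ.1.of_le (by exact_mod_cast le_top)
  refine eLpNorm_two_le_of_lintegral_le ?_
  rw [testFields.setLIntegral_grad_eq hφ]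
  set z : E3 := (2 * ρ) • e 0 with hz
  have hnz : ‖z‖ = 2 * ρ := by
    rw [hz, norm_smul, Real.norm_of_nonneg (by positivity)]; simp [e]
  have h1 := lintegral_translate_sub_le hφ1 z
  rw [← ofReal_norm, hnz] at h1
  refine le_trans ?_ h1
  refine le_trans ?_ (setLIntegral_le_lintegral Ω _)
  refine setLIntegral_mono' hΩm fun x hx => ?_
  have h2 : φ (x + z) = 0 := by
    refine image_eq_zero_of_notMem_tsupport fun h => ?_
    have h3 := hρ (hφ.2.2.1 h)
    have h4 := hρ hx
    rw [mem_ball_zero_iff] at h3 h4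
    have h5 := norm_sub_le (x + z) x
    rw [add_sub_cancel_left, hnz] at h5
    linarith
  rw [h2, zero_sub, enorm_neg]

theorem exists_poincare {Ω : Set E3} (hΩo : IsOpen Ω) (hΩb : Bornology.IsBounded Ω) :
    ∃ C : ℝ, 0 < C ∧ ∀ p ∈ closure (testPairs Ω), ‖p.1‖ ≤ C * ‖p.2‖ := by
  obtain ⟨ρ, hρ⟩ := hΩb.subset_ball (0 : E3)
  have hρ' : Ω ⊆ Metric.ball 0 (max ρ 1) :=
    hρ.trans (Metric.ball_subset_ball (le_max_left _ _))
  have hρ0 : 0 < max ρ 1 := lt_max_of_lt_right one_pos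
  refine ⟨2 * max ρ 1, by positivity, fun p hp => ?_⟩
  refine closure_testPairs_subset (S := {p | ‖p.1‖ ≤ 2 * max ρ 1 * ‖p.2‖})
    (isClosed_le (by fun_prop) (by fun_prop)) (fun p φ hφ h1 h2 => ?_) hp
  have h := testFields.eLpNorm_le hΩo.measurableSet hρ' hρ0 hφ
  rw [← eLpNorm_congr_ae h1, ← eLpNorm_congr_ae h2] at h
  have h3 := ENNReal.toReal_mono (ENNReal.mul_ne_top ENNReal.ofReal_ne_top
    (Lp.memLp p.2).eLpNorm_ne_top) h
  rwa [ENNReal.toReal_mul, ENNReal.toReal_ofReal (by positivity)] at h3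

theorem mollify_congr {Ω : Set E3} {δ : ℝ} {v w : E3 → E3} (h : v =ᵐ[volume.restrict Ω] w) :
    mollify Ω δ v = mollify Ω δ w := by
  ext1 x
  exact integral_congr_ae (h.mono fun y hy => by simp only [hy])

/-- A bounded sequence in a separable Hilbert space has a weakly convergent subsequence. -/
theorem exists_weakly_convergent_subseq {H : Type*} [NormedAddCommGroup H] [InnerProductSpace ℝ H]
    [CompleteSpace H] [TopologicalSpace.SeparableSpace H] {w : ℕ → H} {C : ℝ}
    (hw : ∀ n, ‖w n‖ ≤ C) :
    ∃ (w₀ : H) (σ : ℕ → ℕ), StrictMono σ ∧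
      ∀ f, Tendsto (fun n => inner ℝ (w (σ n)) f) atTop (𝓝 (inner ℝ w₀ f)) := by
  have hseq := WeakDual.isSeqCompact_closedBall ℝ H (0 : StrongDual ℝ H) C
  let x : ℕ → WeakDual ℝ H := fun n => StrongDual.toWeakDual (InnerProductSpace.toDual ℝ H (w n))
  obtain ⟨a, -, σ, hσ, hlim⟩ := hseq (x := x) (fun n => by
    have h : InnerProductSpace.toDual ℝ H (w n) ∈
        Metric.closedBall (0 : StrongDual ℝ H) C := by
      rw [mem_closedBall_zero_iff, LinearIsometryEquiv.norm_map]
      exact hw n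
    exact h)
  refine ⟨(InnerProductSpace.toDual ℝ H).symm (WeakDual.toStrongDual a), σ, hσ, fun f => ?_⟩
  have := ((WeakDual.eval_continuous f).tendsto a).comp hlim
  rw [InnerProductSpace.toDual_symm_apply]
  exact this

theorem isFiniteMeasure_restrict_of_isBounded {Ω : Set E3} (hΩb : Bornology.IsBounded Ω) :
    IsFiniteMeasure (volume.restrict Ω) :=
  isFiniteMeasure_restrict.2 hΩb.measure_lt_top.ne

theorem sum_inner_smul_e (z : E3) : ∑ j, (inner ℝ z (e j)) • e j = z := by
  have h : ∀ j, inner ℝ z (e j) = z j := fun j => by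
    rw [e, EuclideanSpace.inner_single_right]; simp
  simp only [h]
  conv_rhs => rw [← (EuclideanSpace.basisFun (Fin 3) ℝ).sum_repr z]
  simp [e]

theorem integral_norm_le_mul_norm {α E : Type*} [MeasurableSpace α] {μ : Measure α}
    [IsFiniteMeasure μ] [NormedAddCommGroup E] (w : Lp E 2 μ) :
    ∫ y, ‖w y‖ ∂μ ≤ ‖w‖ * (μ univ ^ (1 / 2 : ℝ)).toReal := by
  have h := eLpNorm_le_eLpNorm_mul_rpow_measure_univ (one_le_two : (1 : ℝ≥0∞) ≤ 2)
    (Lp.aestronglyMeasurable w)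
  have h3 : (1 / ENNReal.toReal 1 - 1 / ENNReal.toReal 2 : ℝ) = 1 / 2 := by norm_num
  rw [h3, eLpNorm_one_eq_lintegral_enorm] at h
  have h2 := ENNReal.toReal_mono (ENNReal.mul_ne_top (Lp.memLp w).eLpNorm_ne_top
    (ENNReal.rpow_ne_top_of_nonneg (by norm_num) (measure_ne_top μ _))) h
  rw [integral_norm_eq_lintegral_enorm (Lp.aestronglyMeasurable w)]
  rwa [ENNReal.toReal_mul] at h2

theorem memLp_mollify {Ω : Set E3} (hΩo : IsOpen Ω) (hΩb : Bornology.IsBounded Ω) {δ : ℝ}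
    (hδ : 0 < δ) (w : L2 Ω) : MemLp (mollify Ω δ w) 2 (volume.restrict Ω) := by
  have := isFiniteMeasure_restrict_of_isBounded hΩb
  exact MemLp.of_continuous_of_isBounded hΩb hΩo.measurableSet
    (mollify_continuous hδ ((Lp.memLp w).integrable one_le_two)) 2

/-- At a fixed scale mollification is compact. Each coordinate of the value at `x` is an inner
product with a fixed `L²` function, so weak convergence gives pointwise convergence; a uniform bound
then allows dominated convergence. -/
theorem tendsto_mollify {Ω : Set E3} (hΩo : IsOpen Ω) (hΩb : Bornology.IsBounded Ω) {δ : ℝ}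
    (hδ : 0 < δ) {w : ℕ → L2 Ω} {w₀ : L2 Ω} {C : ℝ} (hC : ∀ n, ‖w n‖ ≤ C)
    (hw : ∀ f : L2 Ω, Tendsto (fun n => inner ℝ (w n) f) atTop (𝓝 (inner ℝ w₀ f))) :
    Tendsto (fun n => (memLp_mollify hΩo hΩb hδ (w n)).toLp) atTop
      (𝓝 (memLp_mollify hΩo hΩb hδ w₀).toLp) := by
  have := isFiniteMeasure_restrict_of_isBounded hΩb
  have hmc : Continuous (moll δ) := (moll_contDiff δ).continuous
  obtain ⟨D, hD⟩ := (moll_hasCompactSupport hδ).exists_bound_of_continuous hmc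
  have hD0 : 0 ≤ D := (norm_nonneg _).trans (hD 0)
  have hint : ∀ v : L2 Ω, IntegrableOn v Ω := fun v => (Lp.memLp v).integrable one_le_two
  have hcx : ∀ x, Continuous fun y => moll δ (x - y) := fun x =>
    hmc.comp (continuous_const.sub continuous_id)
  have hinner : ∀ (x a : E3), ∃ f : L2 Ω, ∀ v : L2 Ω,
      inner ℝ (mollify Ω δ v x) a = inner ℝ v f := fun x a => by
    have hf : MemLp (fun y => moll δ (x - y) • a) 2 (volume.restrict Ω) :=
      MemLp.of_continuous_of_isBounded hΩb hΩo.measurableSet ((hcx x).smul continuous_const) 2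
    refine ⟨hf.toLp, fun v => ?_⟩
    have hi : Integrable (fun y => moll δ (x - y) • v y) (volume.restrict Ω) := by
      refine ((hint v).norm.const_mul D).mono' ((hcx x).aestronglyMeasurable.smul
        (hint v).aestronglyMeasurable) (Eventually.of_forall fun y => ?_)
      rw [norm_smul]; exact mul_le_mul_of_nonneg_right (hD _) (norm_nonneg _)
    rw [real_inner_comm, mollify, ← integral_inner hi, L2.inner_def]
    refine integral_congr_ae (hf.coeFn_toLp.mono fun y hy => ?_)
    simp only [hy]
    rw [real_inner_smul_right, real_inner_smul_right, real_inner_comm]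
  have hpt : ∀ x, Tendsto (fun n => mollify Ω δ (w n) x) atTop (𝓝 (mollify Ω δ w₀ x)) := fun x => by
    have ht := tendsto_finsetSum (f := fun j n => inner ℝ (mollify Ω δ (w n) x) (e j) • e j)
      (a := fun j => inner ℝ (mollify Ω δ w₀ x) (e j) • e j) Finset.univ fun j _ => by
        obtain ⟨f, hf⟩ := hinner x (e j)
        simp only [hf]
        exact (hw f).smul_const _
    simpa only [sum_inner_smul_e] using ht
  set B := D * (C * ((volume.restrict Ω) univ ^ (1 / 2 : ℝ)).toReal) with hB
  have hbd : ∀ v : L2 Ω, ‖v‖ ≤ C → ∀ x, ‖mollify Ω δ v x‖ ≤ B := fun v hv x => by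
    calc ‖mollify Ω δ v x‖ ≤ ∫ y in Ω, D * ‖v y‖ := by
          refine norm_integral_le_of_norm_le ((hint v).norm.const_mul D)
            (Eventually.of_forall fun y => ?_)
          rw [norm_smul]; exact mul_le_mul_of_nonneg_right (hD _) (norm_nonneg _)
      _ ≤ B := by
          rw [integral_const_mul]
          exact mul_le_mul_of_nonneg_left ((integral_norm_le_mul_norm v).trans
            (mul_le_mul_of_nonneg_right hv ENNReal.toReal_nonneg)) hD0
  have hbd0 : ∀ x, ‖mollify Ω δ w₀ x‖ ≤ B := fun x =>
    le_of_tendsto (hpt x).norm (Eventually.of_forall fun n => hbd _ (hC n) x)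
  rw [Lp.tendsto_Lp_iff_tendsto_eLpNorm'']
  have hlim : Tendsto (fun n => ∫⁻ x in Ω, ‖mollify Ω δ (w n) x - mollify Ω δ w₀ x‖ₑ ^ (2 : ℝ))
      atTop (𝓝 (∫⁻ x in Ω, 0)) := by
    refine tendsto_lintegral_of_dominated_convergence (fun _ => ENNReal.ofReal (2 * B) ^ (2 : ℝ))
      (fun n => ?_) (fun n => Eventually.of_forall fun x => ?_) ?_
      (Eventually.of_forall fun x => ?_)
    · exact (ENNReal.continuous_rpow_const.comp (continuous_enorm.comp
        ((mollify_continuous hδ (hint _)).sub (mollify_continuous hδ (hint _))))).measurable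
    · refine ENNReal.rpow_le_rpow ?_ zero_le_two
      rw [← ofReal_norm]
      refine ENNReal.ofReal_le_ofReal ((norm_sub_le _ _).trans ?_)
      linarith [hbd _ (hC n) x, hbd0 x]
    · rw [lintegral_const]
      exact ENNReal.mul_ne_top (ENNReal.rpow_ne_top_of_nonneg zero_le_two ENNReal.ofReal_ne_top)
        (measure_ne_top _ _)
    · have h1 := (tendsto_iff_norm_sub_tendsto_zero.1 (hpt x))
      have h2 := (ENNReal.continuous_rpow_const (y := 2)).continuousAt.tendsto.comp
        (ENNReal.tendsto_ofReal h1)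
      simpa [Function.comp_def] using h2
  rw [lintegral_zero] at hlim
  have h3 := (ENNReal.continuous_rpow_const (y := 1 / 2)).continuousAt.tendsto.comp hlim
  rw [ENNReal.zero_rpow_of_pos (by norm_num)] at h3
  refine h3.congr fun n => ?_
  rw [eLpNorm_eq_lintegral_rpow_enorm_toReal (by simp) (by simp)]
  simp

/-- **Rellich's theorem** for test fields. -/
theorem exists_cauchySeq_subseq {Ω : Set E3} (hΩo : IsOpen Ω) (hΩb : Bornology.IsBounded Ω)
    {p : ℕ → L2 Ω × L2Grad Ω} (hp : ∀ n, p n ∈ testPairs Ω) {C : ℝ} (h1 : ∀ n, ‖(p n).1‖ ≤ C)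
    (h2 : ∀ n, ‖(p n).2‖ ≤ C) :
    ∃ σ : ℕ → ℕ, StrictMono σ ∧ CauchySeq fun n => (p (σ n)).1 := by
  have := isFiniteMeasure_restrict_of_isBounded hΩb
  have : Fact ((2 : ℝ≥0∞) ≠ ⊤) := ⟨by simp⟩
  obtain ⟨w₀, σ, hσ, hw⟩ := exists_weakly_convergent_subseq h1
  refine ⟨σ, hσ, ?_⟩
  have hC0 : 0 ≤ C := (norm_nonneg _).trans (h1 0)
  rw [Metric.cauchySeq_iff]
  intro η hη
  -- The mollification error is at most `δ C ≤ η / 4` along the whole sequence; two such errors and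
  -- `η / 2` for the mollified sequence add up to `η`.
  set δ := η / (4 * (C + 1)) with hδdef
  have hδ : 0 < δ := by positivity
  have hδC : δ * C ≤ η / 4 := by
    calc δ * C ≤ δ * (C + 1) := by gcongr; linarith
      _ = η / 4 := by rw [hδdef]; field_simp
  have ht := tendsto_mollify hΩo hΩb hδ (fun n => h1 (σ n)) hw
  obtain ⟨N, hN⟩ := Metric.cauchySeq_iff.1 ht.cauchySeq (η / 2) (by positivity)
  have hclose : ∀ n, dist (p n).1 (memLp_mollify hΩo hΩb hδ (p n).1).toLp ≤ η / 4 := fun n => by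
    obtain ⟨φ, hφ, hφ1, hφ2⟩ := hp n
    rw [Lp.dist_def]
    have hE : eLpNorm ((p n).1 - ((memLp_mollify hΩo hΩb hδ (p n).1).toLp : L2 Ω) : E3 → E3) 2
        (volume.restrict Ω) ≤ ENNReal.ofReal δ * eLpNorm (p n).2 2 (volume.restrict Ω) := by
      rw [eLpNorm_congr_ae hφ2]
      refine le_trans (le_of_eq (eLpNorm_congr_ae ?_)) (testFields.eLpNorm_sub_mollify_le hφ hδ)
      filter_upwards [hφ1, (memLp_mollify hΩo hΩb hδ (p n).1).coeFn_toLp] with x hx1 hx2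
      rw [Pi.sub_apply, hx1, hx2, mollify_congr hφ1]
    have h3 := ENNReal.toReal_mono (ENNReal.mul_ne_top ENNReal.ofReal_ne_top
      (Lp.memLp (p n).2).eLpNorm_ne_top) hE
    rw [ENNReal.toReal_mul, ENNReal.toReal_ofReal hδ.le] at h3
    exact h3.trans ((mul_le_mul_of_nonneg_left (h2 n) hδ.le).trans hδC)
  refine ⟨N, fun m hm n hn => ?_⟩
  have a1 := hclose (σ m)
  have a2 := hclose (σ n)
  have a3 := hN m hm n hn
  rw [dist_comm] at a2
  have := dist_triangle4 (p (σ m)).1 (memLp_mollify hΩo hΩb hδ (p (σ m)).1).toLp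
    (memLp_mollify hΩo hΩb hδ (p (σ n)).1).toLp (p (σ n)).1
  linarith

/-! ### The Rayleigh quotient and the smallest Stokes eigenvalue. -/

/-- The Rayleigh quotient of a pair of inner products attains its infimum under a compactness
assumption, and the minimizers satisfy the Euler-Lagrange equation. -/
theorem exists_rayleigh_minimizer {H₁ H₂ : Type*} [NormedAddCommGroup H₁] [InnerProductSpace ℝ H₁]
    [CompleteSpace H₁] [NormedAddCommGroup H₂] [InnerProductSpace ℝ H₂] [CompleteSpace H₂]
    (S : Submodule ℝ (H₁ × H₂)) (hne : ∃ p ∈ S, p.1 ≠ 0)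
    (hrel : ∀ (p : ℕ → H₁ × H₂) (C : ℝ), (∀ n, p n ∈ S) → (∀ n, ‖(p n).1‖ ≤ C) →
      (∀ n, ‖(p n).2‖ ≤ C) → ∃ σ : ℕ → ℕ, StrictMono σ ∧ CauchySeq fun n => (p (σ n)).1) :
    ∃ lam : ℝ, (∀ p ∈ closure (S : Set (H₁ × H₂)), lam * ‖p.1‖ ^ 2 ≤ ‖p.2‖ ^ 2) ∧
      ∃ w ∈ closure (S : Set (H₁ × H₂)), ‖w.1‖ = 1 ∧ ‖w.2‖ ^ 2 = lam ∧
        ∀ v ∈ closure (S : Set (H₁ × H₂)), inner ℝ w.2 v.2 = lam * inner ℝ w.1 v.1 := by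
  set R : Set ℝ := {y | ∃ p ∈ S, ‖p.1‖ = 1 ∧ ‖p.2‖ ^ 2 = y} with hR
  have hnorm : ∀ p ∈ S, p.1 ≠ 0 → ‖p.1‖⁻¹ • p ∈ S ∧ ‖(‖p.1‖⁻¹ • p).1‖ = 1 := fun p hp h0 => by
    refine ⟨S.smul_mem _ hp, ?_⟩
    rw [Prod.smul_fst, norm_smul, norm_inv, norm_norm, inv_mul_cancel₀ (norm_ne_zero_iff.2 h0)]
  have hRne : R.Nonempty := by
    obtain ⟨p, hp, h0⟩ := hne
    exact ⟨_, _, (hnorm p hp h0).1, (hnorm p hp h0).2, rfl⟩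
  have hRb : BddBelow R := ⟨0, by rintro y ⟨p, _, _, rfl⟩; positivity⟩
  set lam := sInf R with hlam
  have hlam0 : 0 ≤ lam := le_csInf hRne (by rintro y ⟨p, _, _, rfl⟩; positivity)
  have hS : ∀ p ∈ S, lam * ‖p.1‖ ^ 2 ≤ ‖p.2‖ ^ 2 := fun p hp => by
    by_cases h0 : p.1 = 0
    · rw [h0, norm_zero]; simp
    have h1 : lam ≤ ‖(‖p.1‖⁻¹ • p).2‖ ^ 2 :=
      csInf_le hRb ⟨_, (hnorm p hp h0).1, (hnorm p hp h0).2, rfl⟩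
    have h2 : 0 < ‖p.1‖ := norm_pos_iff.2 h0
    rw [Prod.smul_snd, norm_smul, norm_inv, norm_norm, mul_pow, inv_pow, ← div_eq_inv_mul,
      le_div_iff₀ (by positivity)] at h1
    exact h1
  have hcl : ∀ p ∈ closure (S : Set (H₁ × H₂)), lam * ‖p.1‖ ^ 2 ≤ ‖p.2‖ ^ 2 := fun p hp =>
    closure_minimal (t := {p : H₁ × H₂ | lam * ‖p.1‖ ^ 2 ≤ ‖p.2‖ ^ 2})
      (fun p hp => mem_ofPred.2 (hS p hp))
      (isClosed_le (by fun_prop) (by fun_prop)) hp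
  refine ⟨lam, hcl, ?_⟩
  have hseq : ∀ n : ℕ, ∃ p ∈ S, ‖p.1‖ = 1 ∧ ‖p.2‖ ^ 2 < lam + 1 / ((n : ℝ) + 1) := fun n => by
    obtain ⟨y, ⟨p, hp, h1, rfl⟩, hy⟩ := exists_lt_of_csInf_lt hRne
      (show lam < lam + 1 / ((n : ℝ) + 1) by linarith [Nat.one_div_pos_of_nat (α := ℝ) (n := n)])
    exact ⟨p, hp, h1, hy⟩
  choose p hpS hp1 hp2 using hseq
  have hb1 : ∀ n, ‖(p n).1‖ ≤ lam + 2 := fun n => by rw [hp1]; linarith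
  have hb2 : ∀ n, ‖(p n).2‖ ≤ lam + 2 := fun n => by
    have h1 : 1 / ((n : ℝ) + 1) ≤ 1 := by
      rw [div_le_one (by positivity)]; linarith [n.cast_nonneg (α := ℝ)]
    exact abs_le_of_sq_le_sq' (by nlinarith [hp2 n]) (by linarith) |>.2
  obtain ⟨σ, hσ, hc1⟩ := hrel p _ hpS hb1 hb2
  set ε : ℕ → ℝ := fun n => 1 / ((σ n : ℝ) + 1) with hε
  have hεt : Tendsto ε atTop (𝓝 0) :=
    tendsto_one_div_add_atTop_nhds_zero_nat.comp hσ.tendsto_atTop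
  -- Parallelogram law in both spaces, with the Rayleigh bound applied to the sum: a minimizing
  -- sequence that is Cauchy in the first component is then Cauchy in the second.
  have hpar : ∀ m n, ‖(p (σ m)).2 - (p (σ n)).2‖ ^ 2 ≤
      2 * ε m + 2 * ε n + lam * ‖(p (σ m)).1 - (p (σ n)).1‖ ^ 2 := fun m n => by
    have a1 := parallelogram_law_with_norm ℝ (p (σ m)).1 (p (σ n)).1
    have a2 := parallelogram_law_with_norm ℝ (p (σ m)).2 (p (σ n)).2
    have a3 := hS _ (S.add_mem (hpS (σ m)) (hpS (σ n)))
    rw [Prod.fst_add, Prod.snd_add] at a3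
    rw [hp1, hp1] at a1
    have b1 := hp2 (σ m)
    have b2 := hp2 (σ n)
    have a4 : ‖(p (σ m)).1 + (p (σ n)).1‖ ^ 2 = 4 - ‖(p (σ m)).1 - (p (σ n)).1‖ ^ 2 := by
      linarith
    rw [a4] at a3
    simp only [hε]
    nlinarith
  have hc2 : CauchySeq fun n => (p (σ n)).2 := by
    rw [cauchySeq_iff_tendsto_dist_atTop_0] at hc1 ⊢
    have h1 : Tendsto (fun n : ℕ × ℕ => 2 * ε n.1 + 2 * ε n.2 +
        lam * ‖(p (σ n.1)).1 - (p (σ n.2)).1‖ ^ 2) atTop (𝓝 0) := by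
      have e1 : Tendsto (fun n : ℕ × ℕ => ε n.1) atTop (𝓝 0) := by
        rw [← prod_atTop_atTop_eq]; exact hεt.comp tendsto_fst
      have e2 : Tendsto (fun n : ℕ × ℕ => ε n.2) atTop (𝓝 0) := by
        rw [← prod_atTop_atTop_eq]; exact hεt.comp tendsto_snd
      simp only [dist_eq_norm] at hc1
      simpa using ((e1.const_mul 2).add (e2.const_mul 2)).add ((hc1.pow 2).const_mul lam)
    have h2 := (Real.continuous_sqrt.tendsto 0).comp h1
    rw [Real.sqrt_zero] at h2
    refine squeeze_zero (fun _ => dist_nonneg) (fun n => ?_) h2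
    rw [dist_eq_norm]
    exact Real.le_sqrt_of_sq_le (hpar _ _)
  obtain ⟨w₁, hw₁⟩ := cauchySeq_tendsto_of_complete hc1
  obtain ⟨w₂, hw₂⟩ := cauchySeq_tendsto_of_complete hc2
  have hw : (w₁, w₂) ∈ closure (S : Set (H₁ × H₂)) :=
    mem_closure_of_tendsto (hw₁.prodMk_nhds hw₂) (Eventually.of_forall fun n => hpS _)
  have hn1 : ‖w₁‖ = 1 := tendsto_nhds_unique hw₁.norm (by simp [hp1])
  have hn2 : ‖w₂‖ ^ 2 = lam := by
    refine le_antisymm ?_ (by simpa [hn1] using hcl _ hw)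
    have h1 : Tendsto (fun n => lam + ε n) atTop (𝓝 lam) := by simpa using hεt.const_add lam
    exact le_of_tendsto_of_tendsto' (hw₂.norm.pow 2) h1 fun n => (hp2 _).le
  refine ⟨(w₁, w₂), hw, hn1, hn2, fun v hv => ?_⟩
  -- Minimality at `w + t v`. The quadratic in `t` is nonnegative with zero constant term, so its
  -- discriminant forces the linear coefficient to vanish.
  have hq : ∀ t : ℝ, 0 ≤ (‖v.2‖ ^ 2 - lam * ‖v.1‖ ^ 2) * (t * t) +
      (2 * (inner ℝ w₂ v.2 - lam * inner ℝ w₁ v.1)) * t + 0 := fun t => by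
    have hmem : (w₁, w₂) + t • v ∈ closure (S : Set (H₁ × H₂)) := by
      rw [← Submodule.topologicalClosure_coe] at hw hv ⊢
      exact Submodule.add_mem _ hw (Submodule.smul_mem _ t hv)
    have h1 := hcl _ hmem
    simp only [Prod.fst_add, Prod.snd_add, Prod.smul_fst, Prod.smul_snd] at h1
    rw [norm_add_sq_real, norm_add_sq_real, hn1, hn2, real_inner_smul_right,
      real_inner_smul_right, norm_smul, norm_smul, mul_pow, mul_pow, Real.norm_eq_abs, sq_abs] at h1
    nlinarith
  have hd := discrim_le_zero hq
  rw [discrim] at hd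
  nlinarith

theorem testFields.zero_mem (Ω : Set E3) : (0 : E3 → E3) ∈ testFields Ω :=
  ⟨contDiff_const, HasCompactSupport.zero, by simp [tsupport], fun x => by
    simp [divergence]⟩

theorem testFields.differentiable {Ω : Set E3} {φ : E3 → E3} (hφ : φ ∈ testFields Ω) :
    Differentiable ℝ φ := hφ.1.differentiable (by simp)

theorem testFields.add_mem {Ω : Set E3} {φ ψ : E3 → E3} (hφ : φ ∈ testFields Ω)
    (hψ : ψ ∈ testFields Ω) : φ + ψ ∈ testFields Ω := by
  refine ⟨hφ.1.add hψ.1, hφ.2.1.add hψ.2.1, (tsupport_add _ _).trans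
    (union_subset hφ.2.2.1 hψ.2.2.1), fun x => ?_⟩
  have h1 := hφ.2.2.2 x
  have h2 := hψ.2.2.2 x
  simp only [divergence] at h1 h2 ⊢
  rw [fderiv_add (testFields.differentiable hφ x) (testFields.differentiable hψ x)]
  simp only [add_apply, PiLp.add_apply, Finset.sum_add_distrib, h1, h2, add_zero]

theorem testFields.smul_mem {Ω : Set E3} {φ : E3 → E3} (c : ℝ) (hφ : φ ∈ testFields Ω) :
    c • φ ∈ testFields Ω := by
  refine ⟨hφ.1.const_smul c, hφ.2.1.smul_left (f := fun _ => c),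
    (tsupport_smul_subset_right (fun _ => c) φ).trans hφ.2.2.1, fun x => ?_⟩
  have h1 := hφ.2.2.2 x
  simp only [divergence] at h1 ⊢
  rw [fderiv_const_smul (testFields.differentiable hφ x)]
  simp only [smul_apply, PiLp.smul_apply, smul_eq_mul, ← Finset.mul_sum, h1, mul_zero]

/-- The pairs `(φ, ∇φ)`, as a linear subspace. -/
def testPairsSubmodule (Ω : Set E3) : Submodule ℝ (L2 Ω × L2Grad Ω) where
  carrier := testPairs Ω
  zero_mem' := by
    refine ⟨0, testFields.zero_mem Ω, Lp.coeFn_zero _ _ _, ?_⟩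
    filter_upwards [Lp.coeFn_zero Mat3 2 (volume.restrict Ω)] with x hx
    rw [Prod.snd_zero, hx]
    ext j : 1
    simp [grad]
  add_mem' := by
    rintro p q ⟨φ, hφ, h1, h2⟩ ⟨ψ, hψ, h3, h4⟩
    refine ⟨φ + ψ, testFields.add_mem hφ hψ, (Lp.coeFn_add _ _).trans (h1.add h3), ?_⟩
    filter_upwards [Lp.coeFn_add p.2 q.2, h2, h4] with x hx hx2 hx4
    rw [Prod.snd_add, hx, Pi.add_apply, hx2, hx4]
    ext j : 1
    simp [grad, fderiv_add (testFields.differentiable hφ x) (testFields.differentiable hψ x)]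
  smul_mem' := by
    rintro c p ⟨φ, hφ, h1, h2⟩
    refine ⟨c • φ, testFields.smul_mem c hφ, (Lp.coeFn_smul _ _).trans (h1.const_smul c), ?_⟩
    filter_upwards [Lp.coeFn_smul c p.2, h2] with x hx hx2
    rw [Prod.smul_snd, hx, Pi.smul_apply, hx2]
    ext j : 1
    simp [grad, fderiv_const_smul (testFields.differentiable hφ x)]

theorem closure_testPairs.sub_mem {Ω : Set E3} {p q : L2 Ω × L2Grad Ω}
    (hp : p ∈ closure (testPairs Ω)) (hq : q ∈ closure (testPairs Ω)) :
    p - q ∈ closure (testPairs Ω) :=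
  (testPairsSubmodule Ω).topologicalClosure.sub_mem hp hq

theorem testPairs.exists_mem {Ω : Set E3} (hΩo : IsOpen Ω) (hΩb : Bornology.IsBounded Ω)
    {φ : E3 → E3} (hφ : φ ∈ testFields Ω) : ∃ p ∈ testPairs Ω,
      p.1 =ᵐ[volume.restrict Ω] φ ∧ p.2 =ᵐ[volume.restrict Ω] grad φ := by
  have h1 : MemLp φ 2 (volume.restrict Ω) :=
    MemLp.of_continuous_of_isBounded hΩb hΩo.measurableSet (testFields.continuous hφ) 2
  have h2 : MemLp (grad φ) 2 (volume.restrict Ω) :=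
    MemLp.of_continuous_of_isBounded hΩb hΩo.measurableSet (testFields.continuous_grad hφ) 2
  exact ⟨(h1.toLp, h2.toLp), ⟨φ, hφ, h1.coeFn_toLp, h2.coeFn_toLp⟩, h1.coeFn_toLp, h2.coeFn_toLp⟩

/-- The rotated gradient `(∂₁ b, -∂₀ b, 0)` of a bump is divergence-free by symmetry of second
derivatives. Were it zero, `b` would be constant in direction `e 0`, yet it is one at `x₀` and zero
at distance `ρ`. -/
theorem exists_testFields_ne_zero {Ω : Set E3} (hΩo : IsOpen Ω) (hne : Ω.Nonempty) :
    ∃ φ ∈ testFields Ω, φ ≠ 0 := by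
  obtain ⟨x₀, hx₀⟩ := hne
  obtain ⟨ρ, hρ, hball⟩ := Metric.isOpen_iff.1 hΩo x₀ hx₀
  let b : ContDiffBump x₀ := ⟨ρ / 4, ρ / 2, by positivity, by linarith⟩
  have hb : ContDiff ℝ ∞ b := b.contDiff
  have hbd : Differentiable ℝ b := hb.differentiable (by simp)
  have hd : ContDiff ℝ ∞ (fderiv ℝ b) := hb.fderiv_right (by simp)
  have hdd : Differentiable ℝ (fderiv ℝ b) := hd.differentiable (by simp)
  have hsub : tsupport b ⊆ Ω := by
    rw [b.tsupport_eq]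
    exact (Metric.closedBall_subset_ball (by change ρ / 2 < ρ; linarith)).trans hball
  have hsub2 : tsupport (fderiv ℝ b) ⊆ tsupport b := tsupport_fderiv_subset ℝ
  let φ : E3 → E3 := fun x => fderiv ℝ b x (e 1) • e 0 - fderiv ℝ b x (e 0) • e 1
  have hz : ∀ x, x ∉ tsupport (fderiv ℝ b) → φ x = 0 := fun x hx => by
    simp [φ, image_eq_zero_of_notMem_tsupport hx]
  have hts : tsupport φ ⊆ tsupport (fderiv ℝ b) :=
    closure_minimal (fun x hx => by_contra fun h => hx (hz x h)) isClosed_closure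
  refine ⟨φ, ⟨?_, ?_, hts.trans (hsub2.trans hsub), fun x => ?_⟩, fun h0 => ?_⟩
  · exact ((hd.clm_apply contDiff_const).smul contDiff_const).sub
      ((hd.clm_apply contDiff_const).smul contDiff_const)
  · exact (b.hasCompactSupport.fderiv (𝕜 := ℝ)).mono' (subset_closure.trans hts)
  · have hsym : fderiv ℝ (fderiv ℝ b) x (e 0) (e 1) = fderiv ℝ (fderiv ℝ b) x (e 1) (e 0) :=
      second_derivative_symmetric (fun y => (hbd y).hasFDerivAt) (hdd x).hasFDerivAt _ _
    have hfd : ∀ v, HasFDerivAt (fun x => fderiv ℝ b x v)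
        ((ContinuousLinearMap.apply ℝ ℝ v).comp (fderiv ℝ (fderiv ℝ b) x)) x := fun v =>
      (ContinuousLinearMap.apply ℝ ℝ v).hasFDerivAt.comp x (hdd x).hasFDerivAt
    have hD := (((hfd (e 1)).smul_const (e 0)).sub ((hfd (e 0)).smul_const (e 1))).fderiv
    rw [divergence]
    change ∑ j, fderiv ℝ ((fun x => fderiv ℝ b x (e 1) • e 0) -
      fun x => fderiv ℝ b x (e 0) • e 1) x (e j) j = 0
    rw [hD]
    simp [e] at hsym ⊢
    linarith
  · have h1 : ∀ x, fderiv ℝ b x (e 0) = 0 := fun x => by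
      have := congrArg (fun z : E3 => z 1) (congrFun h0 x)
      simpa [φ, e] using this
    have h2 : ∀ t : ℝ, HasDerivAt (fun t : ℝ => b (x₀ + t • e 0)) 0 t := fun t => by
      have h3 : HasDerivAt (fun t : ℝ => x₀ + t • e 0) (e 0) t := by
        simpa using ((hasDerivAt_id t).smul_const (e 0)).const_add x₀
      have := (hbd (x₀ + t • e 0)).hasFDerivAt.comp_hasDerivAt t h3
      rwa [h1] at this
    have h4 := is_const_of_deriv_eq_zero (fun t => (h2 t).differentiableAt)
      (fun t => (h2 t).deriv) 0 ρ
    simp only [zero_smul, add_zero] at h4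
    rw [b.one_of_mem_closedBall (Metric.mem_closedBall_self (by change 0 ≤ ρ / 4; linarith)),
      b.zero_of_le_dist] at h4
    · exact one_ne_zero h4
    · simp only [dist_self_add_left, norm_smul, e, PiLp.norm_single, Real.norm_eq_abs,
        abs_of_pos hρ, norm_one]
      change ρ / 2 ≤ _
      linarith

theorem testFields.eq_zero_of_ae {Ω : Set E3} (hΩo : IsOpen Ω) {φ : E3 → E3}
    (hφ : φ ∈ testFields Ω) (h : φ =ᵐ[volume.restrict Ω] 0) : φ = 0 := by
  have h1 : EqOn φ 0 Ω := Measure.eqOn_open_of_ae_eq h hΩo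
    (testFields.continuous hφ).continuousOn continuousOn_const
  funext x
  by_cases hx : x ∈ Ω
  · exact h1 hx
  · exact image_eq_zero_of_notMem_tsupport fun h => hx (hφ.2.2.1 h)

/-- Membership in `V` thereby reduces to membership in the closure of the pairs `(φ, ∇φ)`, which is
used from here on. -/
theorem hasWeakGrad_of_mem_closure {Ω : Set E3} (hΩo : IsOpen Ω) (hΩb : Bornology.IsBounded Ω)
    {p : L2 Ω × L2Grad Ω} (hp : p ∈ closure (testPairs Ω)) : HasWeakGrad Ω p.1 p.2 := by
  have := isFiniteMeasure_restrict_of_isBounded hΩb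
  intro ψ hψ hψc _ j
  have hψd : Differentiable ℝ ψ := hψ.differentiable (by simp)
  have hmem : ∀ {c : E3 → ℝ}, Continuous c → MemLp c 2 (volume.restrict Ω) := fun hc =>
    MemLp.of_continuous_of_isBounded hΩb hΩo.measurableSet hc 2
  have hG : MemLp (fun x => p.2 x j) 2 (volume.restrict Ω) :=
    (PiLp.proj (𝕜 := ℝ) 2 (fun _ : Fin 3 => E3) j).comp_memLp' (Lp.memLp p.2)
  have i1 : Integrable (fun x => fderiv ℝ ψ x (e j) • p.1 x) (volume.restrict Ω) :=
    memLp_one_iff_integrable.1 ((Lp.memLp p.1).smul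
      (hmem ((hψ.continuous_fderiv (by simp)).clm_apply continuous_const)))
  have i2 : Integrable (fun x => ψ x • p.2 x j) (volume.restrict Ω) :=
    memLp_one_iff_integrable.1 (hG.smul (hmem hψ.continuous))
  refine ext_inner_left ℝ fun a => ?_
  rw [inner_neg_right, ← integral_inner i1, ← integral_inner i2]
  have h := spaceV.integral_inner_eq_neg hΩo hΩb hp (ψ := fun x => ψ x • a)
    (hψ.smul contDiff_const) j
  have hfd : ∀ y, fderiv ℝ (fun x => ψ x • a) y (e j) = fderiv ℝ ψ y (e j) • a := fun y => by
    rw [((hψd y).hasFDerivAt.smul_const a).fderiv]; simp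
  simp only [hfd, real_inner_smul_right] at h ⊢
  simp only [real_inner_comm _ a]
  linarith

theorem mem_spaceV_iff {Ω : Set E3} (hΩo : IsOpen Ω) (hΩb : Bornology.IsBounded Ω)
    {p : L2 Ω × L2Grad Ω} : p ∈ spaceV Ω ↔ p ∈ closure (testPairs Ω) :=
  ⟨fun h => h.2, fun h => ⟨hasWeakGrad_of_mem_closure hΩo hΩb h, h⟩⟩

theorem spaceH.smul_mem {Ω : Set E3} (c : ℝ) {w : L2 Ω} (hw : w ∈ spaceH Ω) :
    c • w ∈ spaceH Ω := by
  refine map_mem_closure (continuous_const_smul c) hw ?_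
  rintro v ⟨φ, hφ, hv⟩
  exact ⟨c • φ, testFields.smul_mem c hφ, (Lp.coeFn_smul _ _).trans (hv.const_smul c)⟩

theorem inner_L2_eq_integral {α E : Type*} [MeasurableSpace α] {μ : Measure α}
    [NormedAddCommGroup E] [InnerProductSpace ℝ E] (v w : Lp E 2 μ) {φ : α → E}
    (h : w =ᵐ[μ] φ) : inner ℝ v w = ∫ x, inner ℝ (v x) (φ x) ∂μ := by
  rw [L2.inner_def]
  exact integral_congr_ae (h.mono fun x hx => by simp only [hx])

/-- The smallest eigenvalue of the Stokes operator. -/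
theorem exists_isLeast_stokesEigenvalues {Ω : Set E3} (hΩo : IsOpen Ω) (hne : Ω.Nonempty)
    (hΩb : Bornology.IsBounded Ω) : ∃ lam : ℝ, 0 < lam ∧ IsLeast (stokesEigenvalues Ω) lam ∧
      ∀ p ∈ closure (testPairs Ω), lam * ‖p.1‖ ^ 2 ≤ ‖p.2‖ ^ 2 := by
  obtain ⟨φ, hφ, hφ0⟩ := exists_testFields_ne_zero hΩo hne
  obtain ⟨q, hq, hq1, -⟩ := testPairs.exists_mem hΩo hΩb hφ
  obtain ⟨lam, hlam, w, hw, hw1, hw2, hEL⟩ := exists_rayleigh_minimizer (testPairsSubmodule Ω)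
    ⟨q, hq, fun h => hφ0 (testFields.eq_zero_of_ae hΩo hφ (by
      rw [h] at hq1; exact hq1.symm.trans (Lp.coeFn_zero _ _ _)))⟩
    (fun p C hp h1 h2 => exists_cauchySeq_subseq hΩo hΩb hp h1 h2)
  change w ∈ closure (testPairs Ω) at hw
  obtain ⟨D, hD, hpoin⟩ := exists_poincare hΩo hΩb
  refine ⟨lam, ?_, ⟨⟨w.1, ?_, spaceH.smul_mem _ (spaceV.fst_mem_spaceH hw), w.2,
    (mem_spaceV_iff hΩo hΩb).2 hw, fun φ hφ => ?_⟩, ?_⟩, hlam⟩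
  · rw [← hw2]
    -- As `‖w.1‖ = 1`, Poincaré's inequality excludes `w.2 = 0`.
    have := hpoin w hw
    rw [hw1] at this
    have : 0 < ‖w.2‖ := by
      by_contra! h
      nlinarith
    positivity
  · rw [← norm_ne_zero_iff, hw1]; exact one_ne_zero
  · obtain ⟨p, hp, hp1, hp2⟩ := testPairs.exists_mem hΩo hΩb hφ
    have := hEL p (subset_closure hp)
    rw [← real_inner_smul_left, inner_L2_eq_integral _ _ hp1, inner_L2_eq_integral _ _ hp2] at this
    exact this
  · rintro μ ⟨v, hv0, -, G, hG, hvG⟩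
    have hcl := (mem_spaceV_iff hΩo hΩb).1 hG
    -- The eigenvalue equation extends to the closure, so the eigenfunction may be tested with
    -- itself: `‖G‖² = μ ‖v‖²`, whence `lam ≤ μ`.
    have h1 : ∀ p ∈ closure (testPairs Ω), inner ℝ G p.2 = μ * inner ℝ v p.1 := fun p hp => by
      refine closure_testPairs_subset (S := {p | inner ℝ G p.2 = μ * inner ℝ v p.1})
        (isClosed_eq (by fun_prop) (by fun_prop)) (fun p φ hφ hp1 hp2 => ?_) hp
      rw [mem_ofPred_eq, ← real_inner_smul_left, inner_L2_eq_integral _ _ hp1,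
        inner_L2_eq_integral _ _ hp2]
      exact hvG φ hφ
    have h2 := h1 _ hcl
    have h3 := hlam _ hcl
    simp only [real_inner_self_eq_norm_sq] at h2
    rw [h2] at h3
    exact le_of_mul_le_mul_right h3 (by have := norm_pos_iff.2 hv0; positivity)

/-! ### Translations in time and the energy identity. -/

theorem memLp_translate {X : Type*} [NormedAddCommGroup X] {a : ℝ → X} {q : ℝ≥0∞}
    (ha : MemLp a q volume) (σ : ℝ) : MemLp (fun t => a (t + σ)) q volume :=
  ha.comp_measurePreserving (measurePreserving_add_right volume σ)

theorem continuous_toLp_translate {X : Type*} [NormedAddCommGroup X] {a : ℝ → X} {q : ℝ≥0∞} [Fact (1 ≤ q)] (hq : q ≠ ⊤)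
    (ha : MemLp a q volume) : Continuous fun σ => (memLp_translate ha σ).toLp := by
  let tr : ℝ → C(ℝ, ℝ) := fun σ => ⟨fun t => t + σ, by fun_prop⟩
  have htr : Continuous tr := ContinuousMap.continuous_of_continuous_uncurry _ (by
    simp only [tr, Function.uncurry_def]
    exact continuous_snd.add continuous_fst)
  have h := (continuous_const (y := ha.toLp)).compMeasurePreservingLp htr
    (fun σ => measurePreserving_add_right volume σ) hq
  refine h.congr fun σ => ?_
  exact Lp.toLp_compMeasurePreserving ha (measurePreserving_add_right volume σ)

section Translation

variable {X Y : Type*} [NormedAddCommGroup X] [NormedSpace ℝ X] [NormedAddCommGroup Y]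
  [NormedSpace ℝ Y]

theorem integrable_pairing {α : Type*} [MeasurableSpace α] {μ : Measure α} (B : X →L[ℝ] Y →L[ℝ] ℝ)
    {p q : ℝ≥0∞} [ENNReal.HolderConjugate q p] {a : α → X} {b : α → Y}
    (ha : MemLp a q μ) (hb : MemLp b p μ) : Integrable (fun t => B (a t) (b t)) μ :=
  memLp_one_iff_integrable.1 (B.memLp_of_bilin (p := q) (q := p) 1 ha hb)

theorem continuous_integral_translate_pairing (B : X →L[ℝ] Y →L[ℝ] ℝ) {p q : ℝ≥0∞}
    [Fact (1 ≤ p)] [Fact (1 ≤ q)] [ENNReal.HolderConjugate q p] (hp : p ≠ ⊤) (hq : q ≠ ⊤)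
    {a : ℝ → X} {b : ℝ → Y} (ha : MemLp a q volume) (hb : MemLp b p volume) (I : Set ℝ) :
    Continuous fun z : ℝ × ℝ => ∫ t in I, B (a (t + z.1)) (b (t + z.2) + b t) := by
  have h1 := (LpToLpRestrictCLM ℝ X ℝ volume q I).continuous.comp
    ((continuous_toLp_translate hq ha).comp (continuous_fst (X := ℝ) (Y := ℝ)))
  have h2 := (LpToLpRestrictCLM ℝ Y ℝ volume p I).continuous.comp
    (((continuous_toLp_translate hp hb).comp (continuous_snd (X := ℝ) (Y := ℝ))).add
      (continuous_const (y := hb.toLp)))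
  have h3 := ((B.lpPairing (volume.restrict I) q p).continuous.comp h1).clm_apply h2
  refine h3.congr fun z => ?_
  simp only [Function.comp_apply, Pi.add_apply]
  rw [ContinuousLinearMap.lpPairing_eq_integral]
  refine integral_congr_ae ?_
  filter_upwards [LpToLpRestrictCLM_coeFn ℝ I (memLp_translate ha z.1).toLp,
    LpToLpRestrictCLM_coeFn ℝ I ((memLp_translate hb z.2).toLp + hb.toLp),
    ae_restrict_of_ae (memLp_translate ha z.1).coeFn_toLp,
    ae_restrict_of_ae (Lp.coeFn_add (memLp_translate hb z.2).toLp hb.toLp),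
    ae_restrict_of_ae (memLp_translate hb z.2).coeFn_toLp,
    ae_restrict_of_ae hb.coeFn_toLp] with t e1 e2 e3 e4 e5 e6
  rw [e1, e2, e3, e4, Pi.add_apply, e5, e6]

theorem integrable_prod_translate_pairing (B : X →L[ℝ] Y →L[ℝ] ℝ) {p q : ℝ≥0∞}
    [Fact (1 ≤ p)] [Fact (1 ≤ q)] [ENNReal.HolderConjugate q p] (hp : p ≠ ⊤) (hq : q ≠ ⊤)
    {a : ℝ → X} {b : ℝ → Y} (ha : MemLp a q volume) (hb : MemLp b p volume)
    (has : StronglyMeasurable a) (hbs : StronglyMeasurable b) (I : Set ℝ) (h : ℝ) :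
    Integrable (fun z : ℝ × ℝ => B (a (z.1 + z.2)) (b (z.1 + h) + b z.1))
      ((volume.restrict I).prod (volume.restrict (Ioc 0 h))) := by
  have m1 : StronglyMeasurable fun z : ℝ × ℝ => a (z.1 + z.2) :=
    has.comp_measurable (measurable_fst.add measurable_snd)
  have m2 : StronglyMeasurable fun z : ℝ × ℝ => b (z.1 + h) :=
    hbs.comp_measurable (measurable_fst.add_const h)
  have m3 : StronglyMeasurable fun z : ℝ × ℝ => b z.1 := hbs.comp_measurable measurable_fst
  have hdom : Integrable (fun z : ℝ × ℝ => ‖a (z.1 + z.2)‖ * (‖b (z.1 + h)‖ + ‖b z.1‖))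
      ((volume.restrict I).prod (volume.restrict (Ioc 0 h))) := by
    refine (integrable_prod_iff' (m1.norm.mul (m2.norm.add m3.norm)).aestronglyMeasurable).2 ?_
    have hc := continuous_integral_translate_pairing (ContinuousLinearMap.mul ℝ ℝ) hp hq ha.norm
      hb.norm I
    refine ⟨Eventually.of_forall fun σ => ?_, ?_⟩
    · exact integrable_pairing (ContinuousLinearMap.mul ℝ ℝ)
        ((memLp_translate ha.norm σ).restrict I)
        (((memLp_translate hb.norm h).add hb.norm).restrict I)
    · have h1 : Continuous fun σ => ∫ t in I, ‖a (t + σ)‖ * (‖b (t + h)‖ + ‖b t‖) := by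
        exact hc.comp (continuous_id.prodMk (continuous_const (y := h)))
      refine (h1.integrableOn_Ioc (a := 0) (b := h)).congr (Eventually.of_forall fun σ => ?_)
      refine integral_congr_ae (Eventually.of_forall fun t => ?_)
      exact (Real.norm_of_nonneg (by positivity)).symm
  refine (hdom.const_mul ‖B‖).mono' (B.continuous₂.comp_stronglyMeasurable
    (m1.prodMk (m2.add m3))).aestronglyMeasurable (Eventually.of_forall fun z => ?_)
  calc ‖B (a (z.1 + z.2)) (b (z.1 + h) + b z.1)‖
      ≤ ‖B‖ * ‖a (z.1 + z.2)‖ * ‖b (z.1 + h) + b z.1‖ := B.le_opNorm₂ _ _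
    _ ≤ _ := by
      rw [mul_assoc]
      gcongr
      exact norm_add_le _ _

/-- After Fubini the expression is the mean over `σ ∈ (0, h]` of a jointly continuous function of
`(σ, h)`, so it tends to the value at `(0, 0)`. The factor two comes from the sum `b (t + h) + b t`.
-/
theorem tendsto_average_translate_pairing (B : X →L[ℝ] Y →L[ℝ] ℝ) {p q : ℝ≥0∞}
    [Fact (1 ≤ p)] [Fact (1 ≤ q)] [ENNReal.HolderConjugate q p] (hp : p ≠ ⊤) (hq : q ≠ ⊤)
    {a : ℝ → X} {b : ℝ → Y} (ha : MemLp a q volume) (hb : MemLp b p volume)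
    (has : StronglyMeasurable a) (hbs : StronglyMeasurable b) (I : Set ℝ) :
    Tendsto (fun h : ℝ => h⁻¹ * ∫ t in I, ∫ σ in Ioc 0 h, B (a (t + σ)) (b (t + h) + b t))
      (𝓝[>] 0) (𝓝 (2 * ∫ t in I, B (a t) (b t))) := by
  set J : ℝ × ℝ → ℝ := fun z => ∫ t in I, B (a (t + z.1)) (b (t + z.2) + b t) with hJ
  have hc : Continuous J := continuous_integral_translate_pairing B hp hq ha hb I
  have hJ0 : J (0, 0) = 2 * ∫ t in I, B (a t) (b t) := by
    simp only [hJ, add_zero, map_add, ← two_mul]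
    rw [integral_const_mul]
  rw [← hJ0, Metric.tendsto_nhdsWithin_nhds]
  intro ε hε
  obtain ⟨δ, hδ, hδ'⟩ := Metric.continuous_iff.1 hc (0, 0) (ε / 2) (by positivity)
  refine ⟨δ, hδ, fun {h} (hh : 0 < h) hhδ => ?_⟩
  rw [dist_zero_right, Real.norm_eq_abs, abs_of_pos hh] at hhδ
  have hswap : ∫ t in I, ∫ σ in Ioc 0 h, B (a (t + σ)) (b (t + h) + b t) =
      ∫ σ in Ioc 0 h, J (σ, h) :=
    integral_integral_swap (f := fun t σ => B (a (t + σ)) (b (t + h) + b t))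
      (integrable_prod_translate_pairing B hp hq ha hb has hbs I h)
  have hsub : (∫ σ in Ioc 0 h, J (σ, h)) - h * J (0, 0) =
      ∫ σ in Ioc 0 h, (J (σ, h) - J (0, 0)) := by
    have hi : IntegrableOn (fun σ => J (σ, h)) (Ioc 0 h) := by
      have h1 : Continuous fun σ => J (σ, h) :=
        hc.comp (continuous_id.prodMk (continuous_const (y := h)))
      exact h1.integrableOn_Ioc
    rw [integral_sub hi (integrable_const _)]
    simp [hh.le]
  have hbound : ‖∫ σ in Ioc 0 h, (J (σ, h) - J (0, 0))‖ ≤ ε / 2 * volume.real (Ioc 0 h) := by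
    refine norm_setIntegral_le_of_norm_le_const (by simp) fun σ hσ => ?_
    rw [Real.norm_eq_abs, ← Real.dist_eq]
    refine (hδ' (σ, h) ?_).le
    rw [Prod.dist_eq, max_lt_iff]
    simp only [dist_zero_right, Real.norm_eq_abs, abs_of_pos hσ.1, abs_of_pos hh]
    exact ⟨hσ.2.trans_lt hhδ, hhδ⟩
  rw [hswap, Real.dist_eq]
  have e1 : h⁻¹ * (∫ σ in Ioc 0 h, J (σ, h)) - J (0, 0) =
      h⁻¹ * ((∫ σ in Ioc 0 h, J (σ, h)) - h * J (0, 0)) := by field_simp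
  rw [e1, hsub, abs_mul, abs_of_pos (inv_pos.2 hh), ← Real.norm_eq_abs]
  rw [measureReal_def, Real.volume_Ioc, sub_zero, ENNReal.toReal_ofReal hh.le] at hbound
  calc _ ≤ h⁻¹ * (ε / 2 * h) := by gcongr
    _ = ε / 2 := by field_simp
    _ < ε := by linarith

end Translation

theorem hasDerivWithinAt_integral_of_continuousOn {N : ℝ → ℝ} {s T c : ℝ}
    (hN : ContinuousOn N (Icc s T)) (hc : c ∈ Ico s T) :
    HasDerivWithinAt (fun u => ∫ x in c..u, N x) (N c) (Ici c) c := by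
  have hcT : Icc c T ⊆ Icc s T := Icc_subset_Icc_left hc.1
  have hcont : ContinuousWithinAt N (Ici c) c := by
    have h1 : ContinuousWithinAt N (Icc c T) c := (hN.mono hcT) c ⟨le_rfl, hc.2.le⟩
    exact h1.mono_of_mem_nhdsWithin (Icc_mem_nhdsGE hc.2)
  have hmeas : StronglyMeasurableAtFilter N (𝓝[>] c) volume :=
    ⟨Ioc c T, Ioc_mem_nhdsGT hc.2, ((hN.mono hcT).mono Ioc_subset_Icc_self).aestronglyMeasurable
      measurableSet_Ioc⟩
  exact intervalIntegral.integral_hasDerivWithinAt_right (by simp) hmeas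
    (hcont.mono Ioi_subset_Ici_self)

/-- The integral of the increments telescopes to a mean over `[t, t + h]` minus a mean over `[s, s +
h]`; no differentiability of `N` is needed. -/
theorem tendsto_average_increment {N : ℝ → ℝ} {s t T : ℝ} (hst : s ≤ t) (htT : t < T)
    (hN : ContinuousOn N (Icc s T)) :
    Tendsto (fun h : ℝ => h⁻¹ * ∫ x in Ioc s t, (N (x + h) - N x)) (𝓝[>] 0) (𝓝 (N t - N s)) := by
  have hint : ∀ c ∈ Icc s T, ∀ d ∈ Icc s T, IntervalIntegrable N volume c d := fun c hc d hd =>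
    (hN.mono ((convex_Icc s T).ordConnected.uIcc_subset hc hd)).intervalIntegrable
  have hsT : s < T := hst.trans_lt htT
  have hderiv : ∀ c ∈ Ico s T, Tendsto (fun h : ℝ => h⁻¹ * ∫ x in c..(c + h), N x) (𝓝[>] 0)
      (𝓝 (N c)) := fun c hc => by
    have hd := hasDerivWithinAt_integral_of_continuousOn hN hc
    have h2 := (hasDerivWithinAt_iff_tendsto_slope' (by simp)).1 hd.Ioi_of_Ici
    have h3 : Tendsto (fun h : ℝ => c + h) (𝓝[>] 0) (𝓝[>] c) := by
      refine tendsto_nhdsWithin_iff.2 ⟨?_, ?_⟩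
      · have : Tendsto (fun h : ℝ => c + h) (𝓝 0) (𝓝 (c + 0)) := tendsto_id.const_add c
        rw [add_zero] at this
        exact this.mono_left nhdsWithin_le_nhds
      · filter_upwards [self_mem_nhdsWithin] with h (hh : 0 < h)
        simp [hh]
    refine (h2.comp h3).congr fun h => ?_
    simp [slope_def_field, div_eq_inv_mul]
  have h1 := (hderiv t ⟨hst, htT⟩).sub (hderiv s ⟨le_rfl, hsT⟩)
  refine h1.congr' ?_
  filter_upwards [self_mem_nhdsWithin, Ioo_mem_nhdsGT (sub_pos.2 htT)] with h (hh : 0 < h) hhT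
  have hT : t + h ∈ Icc s T := ⟨by linarith, by linarith [hhT.2]⟩
  have hsh : s + h ∈ Icc s T := ⟨by linarith, by linarith [hT.2]⟩
  have hs' : s ∈ Icc s T := ⟨le_rfl, hsT.le⟩
  have ht' : t ∈ Icc s T := ⟨hst, htT.le⟩
  have i1 : IntervalIntegrable (fun x => N (x + h)) volume s t := by
    simpa using (hint _ hsh _ hT).comp_add_right h
  rw [← mul_sub, ← intervalIntegral.integral_of_le hst,
    intervalIntegral.integral_sub i1 (hint s hs' t ht'),
    intervalIntegral.integral_comp_add_right]
  congr 1
  have e1 := intervalIntegral.integral_add_adjacent_intervals (hint s hs' t ht')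
    (hint t ht' _ hT)
  have e2 := intervalIntegral.integral_add_adjacent_intervals (hint s hs' _ hsh)
    (hint _ hsh _ hT)
  linarith

/-- The energy identity: if the increments of `w` are represented by the forces `Γ` and `a`, then
so is the increment of `‖w‖ ^ 2`. -/
theorem energy_identity {H Y X₁ X₂ : Type*} [NormedAddCommGroup H] [InnerProductSpace ℝ H]
    [NormedAddCommGroup Y] [InnerProductSpace ℝ Y] [NormedAddCommGroup X₁] [NormedSpace ℝ X₁]
    [NormedAddCommGroup X₂] [NormedSpace ℝ X₂] (B : X₁ →L[ℝ] X₂ →L[ℝ] ℝ)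
    {p q : ℝ≥0∞} [Fact (1 ≤ p)] [Fact (1 ≤ q)] [ENNReal.HolderConjugate q p] (hp : p ≠ ⊤)
    (hq : q ≠ ⊤) {w : ℝ → H} {Γ : ℝ → Y} {a : ℝ → X₁} {b : ℝ → X₂} {T : ℝ}
    (hw : ContinuousOn w (Ioo 0 T)) (hΓ : MemLp Γ 2 volume) (hΓs : StronglyMeasurable Γ)
    (ha : MemLp a q volume) (has : StronglyMeasurable a) (hb : MemLp b p volume)
    (hbs : StronglyMeasurable b)
    (hweak : ∀ᵐ x, x ∈ Ioo 0 T → ∀ s t, 0 < s → s ≤ t → t < T → inner ℝ (w t - w s) (w x) +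
      ∫ τ in Ioc s t, (inner ℝ (Γ τ) (Γ x) + B (a τ) (b x)) = 0)
    {s t : ℝ} (hs : 0 < s) (hst : s ≤ t) (ht : t < T) :
    ‖w t‖ ^ 2 - ‖w s‖ ^ 2 = -(2 * ∫ τ in Ioc s t, (‖Γ τ‖ ^ 2 + B (a τ) (b τ))) := by
  have hin : ∀ y z : Y, (innerSL ℝ : Y →L[ℝ] Y →L[ℝ] ℝ) y z = inner ℝ y z := fun _ _ => rfl
  obtain ⟨T', htT', hT'⟩ := exists_between ht
  have hN : ContinuousOn (fun x => ‖w x‖ ^ 2) (Icc s T') :=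
    ((hw.mono fun x hx => ⟨hs.trans_le hx.1, hx.2.trans_lt hT'⟩).norm).pow 2
  have h1 := tendsto_average_increment hst htT' hN
  have h2 := tendsto_average_translate_pairing (innerSL ℝ : Y →L[ℝ] Y →L[ℝ] ℝ) (p := 2) (q := 2)
    (by simp) (by simp) hΓ hΓ hΓs hΓs (Ioc s t)
  have h3 := tendsto_average_translate_pairing B hp hq ha hb has hbs (Ioc s t)
  have hi1 : IntegrableOn (fun τ => ‖Γ τ‖ ^ 2) (Ioc s t) :=
    (hΓ.integrable_norm_pow two_ne_zero).integrableOn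
  have hi2 : IntegrableOn (fun τ => B (a τ) (b τ)) (Ioc s t) :=
    (integrable_pairing B ha hb).integrableOn
  have h4 := (h2.add h3).neg
  simp only [hin, real_inner_self_eq_norm_sq] at h4
  rw [← mul_add, ← integral_add hi1 hi2] at h4
  refine tendsto_nhds_unique (h1.congr' ?_) h4
  filter_upwards [self_mem_nhdsWithin, Ioo_mem_nhdsGT (sub_pos.2 ht)] with h (hh : 0 < h) hhT
  have j1 := (integrable_prod_translate_pairing (innerSL ℝ : Y →L[ℝ] Y →L[ℝ] ℝ) (p := 2) (q := 2)
    (by simp) (by simp) hΓ hΓ hΓs hΓs (Ioc s t) h)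
  have j2 := (integrable_prod_translate_pairing B hp hq ha hb has hbs (Ioc s t) h)
  simp only [hin] at j1
  have k1 := j1.integral_prod_left
  have k2 := j2.integral_prod_left
  simp only at k1 k2
  rw [← mul_add, ← mul_neg, ← integral_add k1 k2, ← integral_neg]
  congr 1
  -- The increment formula can be tested with `w x` only for almost every `x`; for fixed `h` the
  -- shifted exceptional set is null as well.
  have hweak' : ∀ᵐ x, x + h ∈ Ioo 0 T → ∀ s t, 0 < s → s ≤ t → t < T →
      inner ℝ (w t - w s) (w (x + h)) +
      ∫ τ in Ioc s t, (inner ℝ (Γ τ) (Γ (x + h)) + B (a τ) (b (x + h))) = 0 :=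
    (measurePreserving_add_right volume h).quasiMeasurePreserving.ae hweak
  refine setIntegral_congr_ae measurableSet_Ioc ?_
  filter_upwards [hweak, hweak', ae_imp_of_ae_restrict j1.prod_right_ae,
    ae_imp_of_ae_restrict j2.prod_right_ae] with x e1 e2 e3 e4 hx
  have hx0 : 0 < x := hs.trans hx.1
  have hxT : x + h < T := by linarith [hx.2, hhT.2]
  -- The increment over `[x, x + h]` is tested at both endpoints. The sum has `⟨w(x+h) - w(x),
  -- w(x+h) + w(x)⟩ = ‖w(x+h)‖² - ‖w(x)‖²` on the left.
  have f1 := e1 ⟨hx0, by linarith⟩ x (x + h) hx0 (by linarith) hxT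
  have f2 := e2 ⟨by linarith, hxT⟩ x (x + h) hx0 (by linarith) hxT
  have hIΓ : ∀ y, Integrable (fun τ => inner ℝ (Γ τ) y) (volume.restrict (Ioc x (x + h))) :=
    fun y => ((hΓ.restrict _).integrable one_le_two).inner_const y
  have hIa : ∀ y, Integrable (fun τ => B (a τ) y) (volume.restrict (Ioc x (x + h))) := fun y =>
    (B.flip y).integrable_comp ((ha.restrict _).integrable Fact.out)
  have hsh : ∀ k : ℝ → ℝ, ∫ σ in Ioc 0 h, k (x + σ) = ∫ τ in Ioc x (x + h), k τ := fun k => by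
    rw [← intervalIntegral.integral_of_le hh.le, ← intervalIntegral.integral_of_le (by linarith),
      intervalIntegral.integral_comp_add_left, add_zero]
  rw [hsh fun τ => inner ℝ (Γ τ) (Γ (x + h) + Γ x), hsh fun τ => B (a τ) (b (x + h) + b x)]
  simp only [inner_add_right, map_add]
  rw [integral_add (hIΓ _) (hIΓ _), integral_add (hIa _) (hIa _)]
  rw [integral_add (hIΓ _) (hIa _)] at f1 f2
  rw [inner_sub_left] at f1 f2
  rw [real_inner_self_eq_norm_sq] at f1 f2
  rw [real_inner_comm] at f2
  linarith

/-! ### Superposition operators on time-dependent functions. -/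

section Superposition

variable {α E F : Type*} [MeasurableSpace α] {μ : Measure α} [NormedAddCommGroup E]
  [NormedAddCommGroup F]

theorem lintegral_enorm_rpow_eq_enorm_toLp {s : ℝ} (hs : 1 ≤ s) {f : α → F}
    (hf : MemLp f (ENNReal.ofReal s) μ) : ∫⁻ x, ‖f x‖ₑ ^ s ∂μ = ‖hf.toLp‖ₑ ^ s := by
  have hs0 : 0 < s := by linarith
  rw [Lp.enorm_toLp, eLpNorm_eq_lintegral_rpow_enorm_toReal (by simp [hs0]) (by simp),
    ENNReal.toReal_ofReal hs0.le, ← ENNReal.rpow_mul, one_div, inv_mul_cancel₀ hs0.ne',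
    ENNReal.rpow_one]

theorem tendsto_toLp_of_dominated {s : ℝ≥0∞} [Fact (1 ≤ s)] (hs : s ≠ ⊤) {f : ℕ → α → F}
    {f₀ : α → F} {g : α → ℝ} (hf : ∀ n, MemLp (f n) s μ) (hf₀ : MemLp f₀ s μ) (hg : MemLp g s μ)
    (hbd : ∀ n x, ‖f n x‖ ≤ g x)
    (hlim : ∀ᵐ x ∂μ, Tendsto (fun n => f n x) atTop (𝓝 (f₀ x))) :
    Tendsto (fun n => (hf n).toLp) atTop (𝓝 hf₀.toLp) := by
  have hs0 : s ≠ 0 := (zero_lt_one.trans_le Fact.out).ne'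
  have hs' : 0 < s.toReal := ENNReal.toReal_pos hs0 hs
  rw [Lp.tendsto_Lp_iff_tendsto_eLpNorm'']
  have hgs : ∫⁻ x, ‖g x‖ₑ ^ s.toReal ∂μ ≠ ⊤ :=
    (lintegral_rpow_enorm_lt_top_of_eLpNorm_lt_top hs0 hs hg.2).ne
  have hlim' : Tendsto (fun n => ∫⁻ x, ‖f n x - f₀ x‖ₑ ^ s.toReal ∂μ) atTop
      (𝓝 (∫⁻ _, 0 ∂μ)) := by
    refine tendsto_lintegral_of_dominated_convergence' (fun x => (2 * ‖g x‖ₑ) ^ s.toReal)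
      (fun n => ((hf n).1.sub hf₀.1).enorm.pow_const _) (fun n => ?_) ?_ ?_
    · filter_upwards [hlim] with x hx
      have h1 : ‖f₀ x‖ ≤ g x := le_of_tendsto hx.norm (Eventually.of_forall fun n => hbd n x)
      refine ENNReal.rpow_le_rpow ?_ hs'.le
      have h2 : ‖f n x - f₀ x‖ ≤ 2 * ‖g x‖ := by
        have := le_abs_self (g x)
        rw [Real.norm_eq_abs]
        linarith [norm_sub_le (f n x) (f₀ x), hbd n x]
      have h3 := ENNReal.ofReal_le_ofReal h2
      rwa [ENNReal.ofReal_mul zero_le_two, ofReal_norm, ofReal_norm, ENNReal.ofReal_ofNat] at h3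
    · simp only [ENNReal.mul_rpow_of_nonneg _ _ hs'.le]
      rw [lintegral_const_mul' _ _ (ENNReal.rpow_ne_top_of_nonneg hs'.le (by simp))]
      exact ENNReal.mul_ne_top (ENNReal.rpow_ne_top_of_nonneg hs'.le (by simp)) hgs
    · filter_upwards [hlim] with x hx
      have h1 := tendsto_iff_norm_sub_tendsto_zero.1 hx
      have h2 := (ENNReal.continuous_rpow_const (y := s.toReal)).continuousAt.tendsto.comp
        (ENNReal.tendsto_ofReal h1)
      simpa [Function.comp_def, hs'] using h2
  rw [lintegral_zero] at hlim'
  have h3 := (ENNReal.continuous_rpow_const (y := 1 / s.toReal)).continuousAt.tendsto.comp hlim'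
  rw [ENNReal.zero_rpow_of_pos (by positivity)] at h3
  refine h3.congr fun n => ?_
  rw [eLpNorm_eq_lintegral_rpow_enorm_toReal hs0 hs]
  simp

theorem memLp_comp_of_bound [IsFiniteMeasure μ] {Θ : E → F} (hΘ : Continuous Θ) {D : ℝ}
    (hD : ∀ z, ‖Θ z‖ ≤ D) (s : ℝ≥0∞) (v : Lp E 2 μ) : MemLp (fun x => Θ (v x)) s μ :=
  MemLp.of_bound (hΘ.comp_aestronglyMeasurable (Lp.aestronglyMeasurable v)) D
    (Eventually.of_forall fun _ => hD _)

/-- Every `L²`-convergent sequence has an almost everywhere convergent subsequence, along which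
bounded `Θ` allows dominated convergence. -/
theorem continuous_toLp_comp [IsFiniteMeasure μ] {s : ℝ≥0∞} [Fact (1 ≤ s)] (hs : s ≠ ⊤)
    {Θ : E → F} (hΘ : Continuous Θ) {D : ℝ} (hD : ∀ z, ‖Θ z‖ ≤ D) :
    Continuous fun v : Lp E 2 μ => (memLp_comp_of_bound hΘ hD s v).toLp := by
  refine continuous_iff_continuousAt.2 fun v => tendsto_of_subseq_tendsto fun ns hns => ?_
  obtain ⟨ms, -, hms⟩ := (tendstoInMeasure_of_tendsto_Lp hns).exists_seq_tendsto_ae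
  refine ⟨ms, tendsto_toLp_of_dominated hs _ _ (memLp_const D) (fun n x => hD _) ?_⟩
  filter_upwards [hms] with x hx
  exact (hΘ.tendsto _).comp hx

variable [NormedSpace ℝ F]

/-- The radial truncation of a vector to the ball of radius `k`. -/
def truncate (k : ℝ) (z : F) : F := (k / max k ‖z‖) • z

theorem continuous_truncate {k : ℝ} (hk : 0 < k) : Continuous (truncate k : F → F) :=
  (continuous_const.div (continuous_const.max continuous_norm) fun _ =>
    (lt_max_of_lt_left hk).ne').smul continuous_id

theorem norm_truncate {k : ℝ} (hk : 0 < k) (z : F) : ‖truncate k z‖ = min k ‖z‖ := by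
  have h := lt_max_of_lt_left (c := ‖z‖) hk
  rw [truncate, norm_smul, Real.norm_of_nonneg (by positivity)]
  rcases le_total k ‖z‖ with h1 | h1
  · have : 0 < ‖z‖ := hk.trans_le h1
    rw [max_eq_right h1, min_eq_left h1]; field_simp
  · rw [max_eq_left h1, min_eq_right h1]; field_simp

theorem tendsto_truncate (z : F) :
    Tendsto (fun n : ℕ => truncate ((n : ℝ) + 1) z) atTop (𝓝 z) := by
  obtain ⟨N, hN⟩ := exists_nat_ge ‖z‖
  refine tendsto_const_nhds.congr' ?_
  filter_upwards [eventually_ge_atTop N] with n hn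
  have h1 : ‖z‖ ≤ (n : ℝ) + 1 := by
    have : (N : ℝ) ≤ n := by exact_mod_cast hn
    linarith
  have h2 : (0 : ℝ) < n + 1 := by positivity
  rw [truncate, max_eq_left h1, div_self h2.ne', one_smul]

theorem norm_truncate_comp_le {β : Type*} {Ψ : β → F} (n : ℕ) (z : β) :
    ‖truncate ((n : ℝ) + 1) (Ψ z)‖ ≤ (n : ℝ) + 1 := by
  rw [norm_truncate (by positivity)]
  exact min_le_left _ _

/-- An unbounded `Ψ` does not act continuously from `L²` to `L^s`, but its truncations do. They
preserve measurability in time and converge in `L^s` at almost every time. -/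
theorem exists_stronglyMeasurable_comp [IsFiniteMeasure μ] {ν : Measure ℝ} {u : ℝ → Lp E 2 μ}
    (hu : AEStronglyMeasurable u ν) {Ψ : E → F} (hΨ : Continuous Ψ) {s : ℝ≥0∞} [Fact (1 ≤ s)]
    (hs : s ≠ ⊤) (hmem : ∀ᵐ t ∂ν, MemLp (fun x => Ψ (u t x)) s μ) :
    ∃ A : ℝ → Lp F s μ, StronglyMeasurable A ∧ ∀ᵐ t ∂ν, A t =ᵐ[μ] fun x => Ψ (u t x) := by
  classical
  have hc : ∀ n : ℕ, Continuous fun z => truncate ((n : ℝ) + 1) (Ψ z) := fun n =>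
    (continuous_truncate (by positivity)).comp hΨ
  let A₀ : ℝ → Lp F s μ := fun t =>
    if h : MemLp (fun x => Ψ (u t x)) s μ then h.toLp else 0
  have hA₀ : AEStronglyMeasurable A₀ ν := by
    refine aestronglyMeasurable_of_tendsto_ae atTop (f := fun n t =>
      (memLp_comp_of_bound (hc n) (norm_truncate_comp_le n) s (u t)).toLp) (fun n => ?_) ?_
    · exact (continuous_toLp_comp hs (hc n) (norm_truncate_comp_le n)).comp_aestronglyMeasurable hu
    · filter_upwards [hmem] with t ht
      simp only [A₀, dif_pos ht]
      refine tendsto_toLp_of_dominated hs _ _ ht.norm (fun n x => ?_)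
        (Eventually.of_forall fun x => tendsto_truncate _)
      rw [norm_truncate (by positivity)]
      exact min_le_right _ _
  refine ⟨hA₀.mk A₀, hA₀.stronglyMeasurable_mk, ?_⟩
  filter_upwards [hmem, hA₀.ae_eq_mk] with t ht h1
  rw [← h1]
  simp only [A₀, dif_pos ht]
  exact ht.coeFn_toLp

theorem aemeasurable_lintegral_enorm_rpow [IsFiniteMeasure μ] {ν : Measure ℝ} {u : ℝ → Lp F 2 μ}
    (hu : AEStronglyMeasurable u ν) {s : ℝ} (hs : 1 ≤ s) :
    AEMeasurable (fun t => ∫⁻ x, ‖u t x‖ₑ ^ s ∂μ) ν := by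
  have hs0 : 0 < s := by linarith
  have : Fact (1 ≤ ENNReal.ofReal s) := ⟨by simpa using hs⟩
  have hc : ∀ n : ℕ, Continuous fun z : F => truncate ((n : ℝ) + 1) z := fun n =>
    continuous_truncate (by positivity)
  refine aemeasurable_of_tendsto_metrizable_ae atTop (f := fun (n : ℕ) t =>
    ∫⁻ x, ‖truncate ((n : ℝ) + 1) (u t x)‖ₑ ^ s ∂μ) (fun n => ?_)
    (Eventually.of_forall fun t => ?_)
  · have h1 := (continuous_toLp_comp (μ := μ) (s := ENNReal.ofReal s) (by simp) (hc n)
      (norm_truncate_comp_le (Ψ := id) n)).comp_aestronglyMeasurable hu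
    refine (h1.enorm.pow_const s).congr (Eventually.of_forall fun t => ?_)
    exact (lintegral_enorm_rpow_eq_enorm_toLp hs _).symm
  · refine lintegral_tendsto_of_tendsto_of_monotone (fun n => ?_)
      (Eventually.of_forall fun x => ?_) (Eventually.of_forall fun x => ?_)
    · exact ((hc n).comp_aestronglyMeasurable (Lp.aestronglyMeasurable (u t))).enorm.pow_const s
    · intro m n hmn
      refine ENNReal.rpow_le_rpow ?_ hs0.le
      rw [← ofReal_norm, ← ofReal_norm, norm_truncate (by positivity), norm_truncate (by positivity)]
      have : (m : ℝ) ≤ n := by exact_mod_cast hmn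
      exact ENNReal.ofReal_le_ofReal (min_le_min_right _ (by linarith))
    · exact ((ENNReal.continuous_rpow_const (y := s)).comp continuous_enorm).continuousAt.tendsto.comp
        (tendsto_truncate _)

/-- Superposition operators with power growth act between vector-valued Lebesgue spaces. -/
theorem exists_memLp_comp [NormedSpace ℝ E] [IsFiniteMeasure μ] {ν : Measure ℝ} [IsFiniteMeasure ν]
    {u : ℝ → Lp E 2 μ} (hu : AEStronglyMeasurable u ν) {Ψ : E → F} (hΨ : Continuous Ψ) {s m : ℝ}
    (hs : 1 ≤ s) [Fact (1 ≤ ENNReal.ofReal s)] (hm : 1 ≤ m) {c : ℝ≥0∞} (hc : c ≠ ⊤)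
    (hgrowth : ∀ z, ‖Ψ z‖ₑ ^ s ≤ c * (1 + ‖z‖ₑ ^ m))
    (hfin : ∫⁻ t, ∫⁻ x, ‖u t x‖ₑ ^ m ∂μ ∂ν ≠ ⊤) :
    ∃ A : ℝ → Lp F (ENNReal.ofReal s) μ, StronglyMeasurable A ∧ MemLp A (ENNReal.ofReal s) ν ∧
      ∀ᵐ t ∂ν, A t =ᵐ[μ] fun x => Ψ (u t x) := by
  have hs0 : 0 < s := by linarith
  have hmeas := aemeasurable_lintegral_enorm_rpow hu hm
  have hbd : ∀ t, ∫⁻ x, ‖Ψ (u t x)‖ₑ ^ s ∂μ ≤ c * (μ univ + ∫⁻ x, ‖u t x‖ₑ ^ m ∂μ) := fun t => by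
    calc _ ≤ ∫⁻ x, c * (1 + ‖u t x‖ₑ ^ m) ∂μ := lintegral_mono fun x => hgrowth _
      _ = _ := by
        rw [lintegral_const_mul' _ _ hc, lintegral_add_left measurable_const, lintegral_one]
  have hmem : ∀ᵐ t ∂ν, MemLp (fun x => Ψ (u t x)) (ENNReal.ofReal s) μ := by
    filter_upwards [ae_lt_top' hmeas hfin] with t ht
    refine ⟨hΨ.comp_aestronglyMeasurable (Lp.aestronglyMeasurable _), ?_⟩
    rw [eLpNorm_lt_top_iff_lintegral_rpow_enorm_lt_top (by simp [hs0]) (by simp),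
      ENNReal.toReal_ofReal hs0.le]
    exact (hbd t).trans_lt (ENNReal.mul_lt_top hc.lt_top
      (ENNReal.add_lt_top.2 ⟨measure_lt_top _ _, ht⟩))
  obtain ⟨A, hA, hA'⟩ := exists_stronglyMeasurable_comp hu hΨ (by simp) hmem
  refine ⟨A, hA, ⟨hA.aestronglyMeasurable, ?_⟩, hA'⟩
  rw [eLpNorm_lt_top_iff_lintegral_rpow_enorm_lt_top (by simp [hs0]) (by simp),
    ENNReal.toReal_ofReal hs0.le]
  calc ∫⁻ t, ‖A t‖ₑ ^ s ∂ν ≤ ∫⁻ t, c * (μ univ + ∫⁻ x, ‖u t x‖ₑ ^ m ∂μ) ∂ν := by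
        refine lintegral_mono_ae ?_
        filter_upwards [hA', hmem] with t h1 h2
        have h3 : A t = h2.toLp := Lp.ext (h1.trans h2.coeFn_toLp.symm)
        rw [h3, ← lintegral_enorm_rpow_eq_enorm_toLp hs h2]
        exact hbd t
    _ < ⊤ := by
        rw [lintegral_const_mul' _ _ hc, lintegral_add_left measurable_const, lintegral_const]
        exact ENNReal.mul_lt_top hc.lt_top (ENNReal.add_lt_top.2
          ⟨ENNReal.mul_lt_top (measure_lt_top _ _) (measure_lt_top _ _), hfin.lt_top⟩)

end Superposition

/-! ### From distributional time derivatives to increments. -/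

/-- A smooth approximation of the Heaviside function with jump at `s`. -/
def smoothStep (n : ℕ) (s x : ℝ) : ℝ := Real.smoothTransition (((n : ℝ) + 1) * (x - s))

theorem smoothStep_contDiff (n : ℕ) (s : ℝ) : ContDiff ℝ ∞ (smoothStep n s) :=
  Real.smoothTransition.contDiff.comp (contDiff_const.mul (contDiff_id.sub contDiff_const))

theorem smoothStep_differentiable (n : ℕ) (s : ℝ) : Differentiable ℝ (smoothStep n s) :=
  (smoothStep_contDiff n s).differentiable (by simp)

theorem smoothStep_monotone (n : ℕ) (s : ℝ) : Monotone (smoothStep n s) := fun x y hxy =>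
  Real.smoothTransition.monotone (mul_le_mul_of_nonneg_left (by linarith) (by positivity))

theorem smoothStep_eq_zero {n : ℕ} {s x : ℝ} (h : x ≤ s) : smoothStep n s x = 0 :=
  Real.smoothTransition.zero_of_nonpos (mul_nonpos_of_nonneg_of_nonpos (by positivity)
    (by linarith))

theorem smoothStep_eq_one {n : ℕ} {s x : ℝ} (h : s + 1 / ((n : ℝ) + 1) ≤ x) :
    smoothStep n s x = 1 := by
  refine Real.smoothTransition.one_of_one_le ?_
  have h1 : (0 : ℝ) < n + 1 := by positivity
  have h2 : 1 / ((n : ℝ) + 1) ≤ x - s := by linarith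
  rwa [div_le_iff₀' h1] at h2

theorem tendsto_smoothStep {s x : ℝ} (h : s < x) :
    Tendsto (fun n => smoothStep n s x) atTop (𝓝 1) := by
  refine tendsto_const_nhds.congr' ?_
  have h1 := (tendsto_one_div_add_atTop_nhds_zero_nat (𝕜 := ℝ)).eventually_lt_const (sub_pos.2 h)
  filter_upwards [h1] with n hn
  exact (smoothStep_eq_one (by linarith)).symm

theorem deriv_smoothStep_eq_zero {n : ℕ} {s x : ℝ} (h : x ∉ Icc s (s + 1 / ((n : ℝ) + 1))) :
    deriv (smoothStep n s) x = 0 := by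
  rw [mem_Icc, not_and_or, not_le, not_le] at h
  rcases h with h | h
  · have : smoothStep n s =ᶠ[𝓝 x] fun _ => 0 := by
      filter_upwards [Iio_mem_nhds h] with y hy
      exact smoothStep_eq_zero (le_of_lt hy)
    rw [this.deriv_eq, deriv_const]
  · have : smoothStep n s =ᶠ[𝓝 x] fun _ => 1 := by
      filter_upwards [Ioi_mem_nhds h] with y hy
      exact smoothStep_eq_one (le_of_lt hy)
    rw [this.deriv_eq, deriv_const]

theorem continuous_deriv_smoothStep (n : ℕ) (s : ℝ) : Continuous (deriv (smoothStep n s)) :=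
  (smoothStep_contDiff n s).continuous_deriv (by simp)

theorem integrableOn_deriv_smoothStep_mul {a : ℝ → ℝ} (ha : ContinuousOn a (Ioi 0)) {s : ℝ}
    (hs : 0 < s) (n : ℕ) : IntegrableOn (fun x => deriv (smoothStep n s) x * a x) (Ioi 0) := by
  have hsub : Icc s (s + 1 / ((n : ℝ) + 1)) ⊆ Ioi 0 := fun x hx => hs.trans_le hx.1
  have h1 : IntegrableOn (fun x => deriv (smoothStep n s) x * a x)
      (Icc s (s + 1 / ((n : ℝ) + 1))) :=
    (((continuous_deriv_smoothStep n s).continuousOn).mul (ha.mono hsub)).integrableOn_Icc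
  refine h1.of_forall_sdiff_eq_zero measurableSet_Ioi fun x hx => ?_
  rw [deriv_smoothStep_eq_zero hx.2, zero_mul]

/-- The derivative of the step is nonnegative, has integral one, and is supported in `[s, s +
1/(n+1)]`, so it concentrates at `s`. -/
theorem tendsto_integral_deriv_smoothStep_mul {a : ℝ → ℝ} (ha : ContinuousOn a (Ioi 0)) {s : ℝ}
    (hs : 0 < s) :
    Tendsto (fun n => ∫ x in Ioi (0 : ℝ), deriv (smoothStep n s) x * a x) atTop (𝓝 (a s)) := by
  rw [Metric.tendsto_atTop]
  intro ε hε
  obtain ⟨δ, hδ, hδ'⟩ := Metric.continuousAt_iff.1 (ha.continuousAt (Ioi_mem_nhds hs)) (ε / 2)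
    (by positivity)
  obtain ⟨N, hN⟩ := (eventually_atTop.1
    ((tendsto_one_div_add_atTop_nhds_zero_nat (𝕜 := ℝ)).eventually_lt_const hδ))
  refine ⟨N, fun n hn => ?_⟩
  set k := 1 / ((n : ℝ) + 1) with hk
  have hk0 : 0 < k := by positivity
  have hkδ : k < δ := hN n hn
  have hsub : Icc s (s + k) ⊆ Ioi 0 := fun x hx => hs.trans_le hx.1
  have hc := (continuous_deriv_smoothStep n s)
  have hca : IntervalIntegrable (fun x => deriv (smoothStep n s) x * a x) volume s (s + k) := by
    refine ContinuousOn.intervalIntegrable ?_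
    rw [uIcc_of_le (by linarith)]
    exact hc.continuousOn.mul (ha.mono hsub)
  have e1 : ∫ x in Ioi (0 : ℝ), deriv (smoothStep n s) x * a x =
      ∫ x in s..(s + k), deriv (smoothStep n s) x * a x := by
    rw [intervalIntegral.integral_of_le (by linarith), ← integral_Icc_eq_integral_Ioc]
    refine setIntegral_eq_of_subset_of_forall_sdiff_eq_zero measurableSet_Ioi hsub fun x hx => ?_
    rw [deriv_smoothStep_eq_zero hx.2, zero_mul]
  have e2 : ∫ x in s..(s + k), deriv (smoothStep n s) x = 1 := by
    rw [intervalIntegral.integral_deriv_eq_sub (fun x _ => smoothStep_differentiable n s x)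
      (hc.intervalIntegrable _ _), smoothStep_eq_one le_rfl, smoothStep_eq_zero le_rfl, sub_zero]
  have e3 : (∫ x in s..(s + k), deriv (smoothStep n s) x * a x) - a s =
      ∫ x in s..(s + k), deriv (smoothStep n s) x * (a x - a s) := by
    simp only [mul_sub]
    rw [intervalIntegral.integral_sub hca ((hc.intervalIntegrable _ _).mul_const _),
      intervalIntegral.integral_mul_const, e2, one_mul]
  rw [e1, Real.dist_eq, e3, ← Real.norm_eq_abs]
  have e4 : ‖∫ x in s..(s + k), deriv (smoothStep n s) x * (a x - a s)‖ ≤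
      ∫ x in s..(s + k), deriv (smoothStep n s) x * (ε / 2) := by
    refine intervalIntegral.norm_integral_le_of_norm_le (by linarith)
      (Eventually.of_forall fun x hx => ?_) ((hc.intervalIntegrable _ _).mul_const _)
    have hD : 0 ≤ deriv (smoothStep n s) x := (smoothStep_monotone n s).deriv_nonneg
    rw [norm_mul, Real.norm_of_nonneg hD]
    refine mul_le_mul_of_nonneg_left ?_ hD
    rw [Real.norm_eq_abs, ← Real.dist_eq]
    refine (hδ' ?_).le
    rw [Real.dist_eq, abs_of_pos (by linarith [hx.1])]
    linarith [hx.2]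
  rw [intervalIntegral.integral_mul_const, e2, one_mul] at e4
  linarith

/-- A continuous function with a locally integrable distributional derivative is a primitive. -/
theorem sub_eq_integral_of_weak_deriv {a c : ℝ → ℝ} (ha : ContinuousOn a (Ioi 0))
    (hc : ∀ T : ℝ, 0 < T → IntegrableOn c (Ioo 0 T))
    (h : ∀ θ : ℝ → ℝ, ContDiff ℝ ∞ θ → HasCompactSupport θ → tsupport θ ⊆ Ioi 0 →
      -∫ t in Ioi (0 : ℝ), deriv θ t * a t = ∫ t in Ioi (0 : ℝ), θ t * c t)
    {s t : ℝ} (hs : 0 < s) (hst : s ≤ t) : a t - a s = ∫ τ in Ioc s t, c τ := by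
  have ht : 0 < t := hs.trans_le hst
  -- `θ n` approximates the indicator of `(s, t]`; its derivative is an approximate point mass at
  -- `s` minus one at `t`.
  let θ : ℕ → ℝ → ℝ := fun n x => smoothStep n s x - smoothStep n t x
  have hsupp : ∀ n, tsupport (θ n) ⊆ Icc s (t + 1) := fun n => by
    refine closure_minimal (fun x hx => ?_) isClosed_Icc
    by_contra hx'
    rw [mem_Icc, not_and_or, not_le, not_le] at hx'
    refine hx ?_
    simp only [θ]
    rcases hx' with h1 | h1
    · rw [smoothStep_eq_zero h1.le, smoothStep_eq_zero (h1.le.trans hst), sub_zero]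
    · have h2 : 1 / ((n : ℝ) + 1) ≤ 1 := by
        rw [div_le_one (by positivity)]; linarith [n.cast_nonneg (α := ℝ)]
      rw [smoothStep_eq_one (by linarith), smoothStep_eq_one (by linarith), sub_self]
  have hθ : ∀ n, -∫ x in Ioi (0 : ℝ), deriv (θ n) x * a x = ∫ x in Ioi (0 : ℝ), θ n x * c x :=
    fun n => h (θ n) ((smoothStep_contDiff n s).sub (smoothStep_contDiff n t))
      (HasCompactSupport.of_support_subset_isCompact isCompact_Icc
        (subset_closure.trans (hsupp n))) fun x hx => hs.trans_le (hsupp n hx).1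
  have hL : Tendsto (fun n => -∫ x in Ioi (0 : ℝ), deriv (θ n) x * a x) atTop
      (𝓝 (a t - a s)) := by
    have h1 := ((tendsto_integral_deriv_smoothStep_mul ha hs).sub
      (tendsto_integral_deriv_smoothStep_mul ha ht)).neg
    rw [neg_sub] at h1
    refine h1.congr fun n => ?_
    rw [← integral_sub (integrableOn_deriv_smoothStep_mul ha hs n)
      (integrableOn_deriv_smoothStep_mul ha ht n)]
    congr 2
    funext x
    have : deriv (θ n) x = deriv (smoothStep n s) x - deriv (smoothStep n t) x :=
      deriv_sub (smoothStep_differentiable n s x) (smoothStep_differentiable n t x)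
    rw [this, sub_mul]
  -- All supports lie in `[s, t + 1]`, so cutting `c` off to `(0, t + 2)` changes nothing and
  -- supplies an integrable majorant.
  have hI : IntegrableOn c (Ioo 0 (t + 2)) := hc _ (by linarith)
  have hR : Tendsto (fun n => ∫ x in Ioi (0 : ℝ), θ n x * c x) atTop
      (𝓝 (∫ x in Ioi (0 : ℝ), (Ioc s t).indicator c x)) := by
    have heq : ∀ n, ∀ x, θ n x * c x = θ n x * (Ioo 0 (t + 2)).indicator c x := fun n x => by
      by_cases hx : x ∈ Ioo 0 (t + 2)
      · rw [indicator_of_mem hx]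
      · have : θ n x = 0 := image_eq_zero_of_notMem_tsupport fun h1 =>
          hx ⟨hs.trans_le (hsupp n h1).1, by linarith [(hsupp n h1).2]⟩
        rw [this, zero_mul, zero_mul]
    simp only [heq]
    have hI2 : Integrable ((Ioo 0 (t + 2)).indicator c) := hI.integrable_indicator measurableSet_Ioo
    refine tendsto_integral_of_dominated_convergence
      (fun x => ‖(Ioo 0 (t + 2)).indicator c x‖) (fun n => ?_) hI2.norm.integrableOn
      (fun n => Eventually.of_forall fun x => ?_) (Eventually.of_forall fun x => ?_)
    · exact (((smoothStep_contDiff n s).sub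
        (smoothStep_contDiff n t)).continuous.aestronglyMeasurable).mul hI2.1.restrict
    · rw [norm_mul]
      refine mul_le_of_le_one_left (norm_nonneg _) ?_
      rw [Real.norm_eq_abs, abs_le]
      have b1 : 0 ≤ smoothStep n s x := Real.smoothTransition.nonneg _
      have b2 : smoothStep n s x ≤ 1 := Real.smoothTransition.le_one _
      have b3 : 0 ≤ smoothStep n t x := Real.smoothTransition.nonneg _
      have b4 : smoothStep n t x ≤ 1 := Real.smoothTransition.le_one _
      constructor <;> simp only [θ] <;> linarith
    · rcases le_or_gt x s with h1 | h1
      · have e1 : (Ioc s t).indicator c x = 0 := indicator_of_notMem (fun h => h1.not_gt h.1) _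
        simp only [θ]
        rw [e1]
        simp only [smoothStep_eq_zero h1, smoothStep_eq_zero (h1.trans hst), sub_zero, zero_mul]
        exact tendsto_const_nhds
      · rcases le_or_gt x t with h2 | h2
        · have e1 : (Ioc s t).indicator c x = 1 * (Ioo 0 (t + 2)).indicator c x := by
            rw [indicator_of_mem (show x ∈ Ioc s t from ⟨h1, h2⟩),
              indicator_of_mem (show x ∈ Ioo 0 (t + 2) from ⟨by linarith, by linarith⟩), one_mul]
          rw [e1]
          simp only [θ, smoothStep_eq_zero h2, sub_zero]
          exact (tendsto_smoothStep h1).mul_const _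
        · have e1 : (Ioc s t).indicator c x = (1 - 1) * (Ioo 0 (t + 2)).indicator c x := by
            rw [indicator_of_notMem fun h => h2.not_ge h.2]; simp
          rw [e1]
          exact ((tendsto_smoothStep h1).sub (tendsto_smoothStep h2)).mul_const _
  have hfin := tendsto_nhds_unique (hL.congr hθ) hR
  rw [hfin, setIntegral_indicator measurableSet_Ioc,
    inter_eq_right.2 (show Ioc s t ⊆ Ioi 0 from fun x hx => hs.trans hx.1)]

/-! ### Duality pairings and the increments of weak solutions. -/

section Pairing

variable {α E : Type*} [MeasurableSpace α] {μ : Measure α} [NormedAddCommGroup E]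
  [InnerProductSpace ℝ E] {P Q : ℝ≥0∞} [Fact (1 ≤ P)] [Fact (1 ≤ Q)] [ENNReal.HolderConjugate P Q]

variable (μ E P Q) in
/-- The duality pairing `∫ ⟨v, a⟩` of Lebesgue spaces with conjugate exponents. -/
def innerPairing : Lp E P μ →L[ℝ] Lp E Q μ →L[ℝ] ℝ :=
  (innerSL ℝ : E →L[ℝ] E →L[ℝ] ℝ).lpPairing μ P Q

theorem innerPairing_eq {v : Lp E P μ} {a : Lp E Q μ} {v' a' : α → E} (hv : v =ᵐ[μ] v')
    (ha : a =ᵐ[μ] a') : innerPairing E μ P Q v a = ∫ x, inner ℝ (v' x) (a' x) ∂μ := by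
  rw [innerPairing, ContinuousLinearMap.lpPairing_eq_integral]
  refine integral_congr_ae ?_
  filter_upwards [hv, ha] with x h1 h2
  rw [h1, h2]
  rfl

theorem integrable_integral_inner {ν : Measure ℝ} {a : ℝ → Lp E Q μ} (ha : Integrable a ν)
    {v : α → E} (hv : MemLp v P μ) : Integrable (fun τ => ∫ x, inner ℝ (v x) (a τ x) ∂μ) ν := by
  refine ((innerPairing E μ P Q hv.toLp).integrable_comp ha).congr
    (Eventually.of_forall fun τ => ?_)
  exact innerPairing_eq hv.coeFn_toLp (EventuallyEq.refl _ _)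

theorem integral_inner_integral [CompleteSpace E] {ν : Measure ℝ} {a : ℝ → Lp E Q μ} (ha : Integrable a ν)
    {v : α → E} (hv : MemLp v P μ) :
    ∫ x, inner ℝ (v x) ((∫ τ, a τ ∂ν : Lp E Q μ) x) ∂μ =
      ∫ τ, (∫ x, inner ℝ (v x) (a τ x) ∂μ) ∂ν := by
  have h := (innerPairing E μ P Q hv.toLp).integral_comp_comm ha
  rw [innerPairing_eq hv.coeFn_toLp (EventuallyEq.refl _ _)] at h
  rw [← h]
  exact integral_congr_ae (Eventually.of_forall fun τ =>
    (innerPairing_eq hv.coeFn_toLp (EventuallyEq.refl _ _)))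

end Pairing

theorem smul_mem_spaceTimeTestFields {Ω : Set E3} {φ : E3 → E3} (hφ : φ ∈ testFields Ω)
    {θ : ℝ → ℝ} (hθ : ContDiff ℝ ∞ θ) (hθc : HasCompactSupport θ) (hθs : tsupport θ ⊆ Ioi 0) :
    (fun z : ℝ × E3 => θ z.1 • φ z.2) ∈ spaceTimeTestFields Ω := by
  have hsub : tsupport (fun z : ℝ × E3 => θ z.1 • φ z.2) ⊆ tsupport θ ×ˢ tsupport φ := by
    refine closure_minimal (fun z hz => ?_) (isClosed_closure.prod isClosed_closure)
    rw [Function.mem_support, smul_ne_zero_iff] at hz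
    exact ⟨subset_closure hz.1, subset_closure hz.2⟩
  refine ⟨(hθ.comp contDiff_fst).smul (hφ.1.comp contDiff_snd), ?_, hsub.trans
    (prod_mono hθs hφ.2.2.1), fun t x => ?_⟩
  · exact HasCompactSupport.of_support_subset_isCompact (hθc.isCompact.prod hφ.2.1.isCompact)
      (subset_closure.trans hsub)
  · exact (testFields.smul_mem (θ t) hφ).2.2.2 x

theorem testFields.memLp {Ω : Set E3} (hΩo : IsOpen Ω) (hΩb : Bornology.IsBounded Ω)
    {φ : E3 → E3} (hφ : φ ∈ testFields Ω) (P : ℝ≥0∞) : MemLp φ P (volume.restrict Ω) :=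
  MemLp.of_continuous_of_isBounded hΩb hΩo.measurableSet (testFields.continuous hφ) P

theorem testFields.memLp_grad {Ω : Set E3} (hΩo : IsOpen Ω) (hΩb : Bornology.IsBounded Ω)
    {φ : E3 → E3} (hφ : φ ∈ testFields Ω) (P : ℝ≥0∞) : MemLp (grad φ) P (volume.restrict Ω) :=
  MemLp.of_continuous_of_isBounded hΩb hΩo.measurableSet (testFields.continuous_grad hφ) P

/-- Test functions `θ(t) φ(x)` turn the equation into a scalar distributional derivative in time,
one for each `φ`. -/
theorem weak_equation_separated {Ω : Set E3} {f g : E3 → E3} {u : ℝ → L2 Ω}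
    {G : ℝ → L2Grad Ω} (hG : ∀ φ ∈ spaceTimeTestFields Ω,
      -∫ t in Ioi (0 : ℝ), ∫ x in Ω, inner ℝ (u t x) (deriv (fun s => φ (s, x)) t) =
        ∫ t in Ioi (0 : ℝ),
          (-(∫ x in Ω, inner ℝ (G t x) (grad (fun y => φ (t, y)) x))
            - (∫ x in Ω, inner ℝ (f (u t x)) (φ (t, x)))
            + ∫ x in Ω, inner ℝ (g x) (φ (t, x))))
    {φ : E3 → E3} (hφ : φ ∈ testFields Ω) {θ : ℝ → ℝ} (hθ : ContDiff ℝ ∞ θ)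
    (hθc : HasCompactSupport θ) (hθs : tsupport θ ⊆ Ioi 0) :
    -∫ t in Ioi (0 : ℝ), deriv θ t * ∫ x in Ω, inner ℝ (u t x) (φ x) =
      ∫ t in Ioi (0 : ℝ), θ t * (-(∫ x in Ω, inner ℝ (G t x) (grad φ x))
        - (∫ x in Ω, inner ℝ (f (u t x)) (φ x)) + ∫ x in Ω, inner ℝ (g x) (φ x)) := by
  have h := hG _ (smul_mem_spaceTimeTestFields hφ hθ hθc hθs)
  have hθd : Differentiable ℝ θ := hθ.differentiable (by simp)
  have hd : ∀ t x, deriv (fun s => θ s • φ x) t = deriv θ t • φ x := fun t x =>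
    ((hθd t).hasDerivAt.smul_const (φ x)).deriv
  have hg : ∀ t x, grad (fun y => θ t • φ y) x = θ t • grad φ x := fun t x => by
    ext j : 1
    have : fderiv ℝ (fun y => θ t • φ y) x = θ t • fderiv ℝ φ x :=
      fderiv_const_smul (testFields.differentiable hφ x) (θ t)
    simp [grad, this]
  simp only [hd, hg, real_inner_smul_right, integral_const_mul] at h
  rw [h]
  congr 1
  funext t
  ring

/-- The forces acting on a weak solution, as measurable functions of time with values in Lebesgue
spaces, and the increments of the solution. -/
theorem IsWeakSolution.exists_forces {Ω : Set E3} (hΩo : IsOpen Ω) (hΩb : Bornology.IsBounded Ω)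
    {r q : ℝ} (hr : 1 ≤ r) (hq : 1 ≤ q) {f g : E3 → E3} (hf : Continuous f) {c : ℝ≥0∞}
    (hc : c ≠ ⊤) (hgrowth : ∀ z, ‖f z‖ₑ ^ q ≤ c * (1 + ‖z‖ₑ ^ (r + 1))) {u : ℝ → L2 Ω}
    (hu : IsWeakSolution Ω r f g u)
    [Fact (1 ≤ ENNReal.ofReal (r + 1))] [Fact (1 ≤ ENNReal.ofReal q)]
    [ENNReal.HolderConjugate (ENNReal.ofReal (r + 1)) (ENNReal.ofReal q)] :
    ∃ G : ℝ → L2Grad Ω, ∀ T : ℝ, 0 < T → ∃ (A : ℝ → Lp E3 (ENNReal.ofReal q) (volume.restrict Ω))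
      (U : ℝ → Lp E3 (ENNReal.ofReal (r + 1)) (volume.restrict Ω)),
      MemLp G 2 (volume.restrict (Ioo 0 T)) ∧
      MemLp A (ENNReal.ofReal q) (volume.restrict (Ioo 0 T)) ∧
      MemLp U (ENNReal.ofReal (r + 1)) (volume.restrict (Ioo 0 T)) ∧
      (∀ᵐ t ∂(volume.restrict (Ioo 0 T)), (u t, G t) ∈ closure (testPairs Ω) ∧
        A t =ᵐ[volume.restrict Ω] (fun x => f (u t x)) ∧ U t =ᵐ[volume.restrict Ω] u t) ∧
      ∀ φ ∈ testFields Ω, ∀ s t, 0 < s → s ≤ t → t < T →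
        (∫ x in Ω, inner ℝ (φ x) (u t x)) - (∫ x in Ω, inner ℝ (φ x) (u s x)) =
          ∫ τ in Ioc s t, (-(∫ x in Ω, inner ℝ (grad φ x) (G τ x))
            - (∫ x in Ω, inner ℝ (φ x) (A τ x)) + ∫ x in Ω, inner ℝ (g x) (φ x)) := by
  have := isFiniteMeasure_restrict_of_isBounded hΩb
  obtain ⟨G, hGV, hG2, hweak⟩ := hu.weak_equation
  have hcont : ContinuousOn u (Ioi 0) := hu.continuousOn.mono Ioi_subset_Ici_self
  have hforce : ∀ T : ℝ, 0 < T →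
      ∃ A : ℝ → Lp E3 (ENNReal.ofReal q) (volume.restrict Ω),
      ∃ U : ℝ → Lp E3 (ENNReal.ofReal (r + 1)) (volume.restrict Ω),
      MemLp A (ENNReal.ofReal q) (volume.restrict (Ioo 0 T)) ∧
      MemLp U (ENNReal.ofReal (r + 1)) (volume.restrict (Ioo 0 T)) ∧
      (∀ᵐ t ∂(volume.restrict (Ioo 0 T)), A t =ᵐ[volume.restrict Ω] (fun x => f (u t x))) ∧
      (∀ᵐ t ∂(volume.restrict (Ioo 0 T)), U t =ᵐ[volume.restrict Ω] u t) := fun T hT => by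
    have hm : AEStronglyMeasurable u (volume.restrict (Ioo 0 T)) :=
      (hcont.mono Ioo_subset_Ioi_self).aestronglyMeasurable measurableSet_Ioo
    have hfin : ∫⁻ t in Ioo 0 T, ∫⁻ x in Ω, ‖u t x‖ₑ ^ (r + 1) ≠ ⊤ := by
      have h1 := hu.eLpNorm_lt_top T hT
      have h2 : ∀ t, eLpNorm (u t) (ENNReal.ofReal (r + 1)) (volume.restrict Ω) ^ (r + 1) =
          ∫⁻ x in Ω, ‖u t x‖ₑ ^ (r + 1) := fun t => by
        have hr0 : 0 < r + 1 := by linarith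
        rw [eLpNorm_eq_lintegral_rpow_enorm_toReal (by simp [hr0]) (by simp),
          ENNReal.toReal_ofReal hr0.le, ← ENNReal.rpow_mul, one_div, inv_mul_cancel₀ hr0.ne',
          ENNReal.rpow_one]
      simp only [h2] at h1
      exact h1.ne
    -- The growth condition on `f` places `f(u)` in `L^q` in time and space; the same lemma with the
    -- identity in place of `f` handles `u` in `L^{r+1}`.
    obtain ⟨A, -, hA1, hA2⟩ := exists_memLp_comp hm hf hq (by linarith) hc hgrowth hfin
    obtain ⟨U, -, hU1, hU2⟩ := exists_memLp_comp hm continuous_id (s := r + 1) (by linarith)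
      (by linarith) ENNReal.one_ne_top (fun z => by
        rw [one_mul]; exact le_add_self) hfin
    exact ⟨A, U, hA1, hU1, hA2, hU2⟩
  refine ⟨G, fun T hT => ?_⟩
  obtain ⟨A, U, hA, hU, hAu, hUu⟩ := hforce T hT
  refine ⟨A, U, hG2 T hT, hA, hU, ?_, fun φ hφ s t hs hst htT => ?_⟩
  · filter_upwards [ae_restrict_of_ae_restrict_of_subset Ioo_subset_Ioi_self hGV, hAu, hUu]
      with t h1 h2 h3
    exact ⟨h1.2, h2, h3⟩
  have hφ2 := testFields.memLp hΩo hΩb hφ 2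
  have hφp := testFields.memLp hΩo hΩb hφ (ENNReal.ofReal (r + 1))
  have hgφ := testFields.memLp_grad hΩo hΩb hφ 2
  have hac : ContinuousOn (fun t => ∫ x in Ω, inner ℝ (u t x) (φ x)) (Ioi 0) := by
    refine ((innerSL ℝ hφ2.toLp).continuous.comp_continuousOn hcont).congr fun t _ => ?_
    simp only [Function.comp_apply, innerSL_apply_apply]
    rw [real_inner_comm, inner_L2_eq_integral _ _ hφ2.coeFn_toLp]
  have h := sub_eq_integral_of_weak_deriv hac (c := fun t =>
    (-(∫ x in Ω, inner ℝ (G t x) (grad φ x)) - (∫ x in Ω, inner ℝ (f (u t x)) (φ x)) +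
      ∫ x in Ω, inner ℝ (g x) (φ x))) (fun T' hT' => ?_)
    (fun θ hθ hθc hθs => weak_equation_separated hweak hφ hθ hθc hθs) hs hst
  · simp only [real_inner_comm (φ _), real_inner_comm (grad φ _)] at h ⊢
    rw [h]
    refine setIntegral_congr_ae measurableSet_Ioc ?_
    filter_upwards [ae_imp_of_ae_restrict hAu] with τ h1 hτ
    have h2 := h1 ⟨hs.trans hτ.1, hτ.2.trans_lt htT⟩
    congr 2
    refine integral_congr_ae (h2.mono fun x hx => ?_)
    simp only [hx]
  -- Local integrability in time is needed on every `(0, T')`, so the force is represented anew on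
  -- that interval.
  · obtain ⟨A', -, hA', -, hAu', -⟩ := hforce T' hT'
    have i1 : Integrable (fun τ => ∫ x in Ω, inner ℝ (grad φ x) (G τ x))
        (volume.restrict (Ioo 0 T')) :=
      integrable_integral_inner ((hG2 T' hT').integrable one_le_two) hgφ
    have i2 := integrable_integral_inner (hA'.integrable Fact.out) hφp
    have i3 : Integrable (fun τ => ∫ x in Ω, inner ℝ (φ x) (f (u τ x)))
        (volume.restrict (Ioo 0 T')) := by
      refine i2.congr (hAu'.mono fun τ hτ => ?_)
      exact integral_congr_ae (hτ.mono fun x hx => by simp only [hx])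
    simp only [real_inner_comm (grad φ _), real_inner_comm (φ _)]
    exact (i1.neg.sub i3).add (integrable_const _)

/-! ### Gronwall's inequality and the nonlinearity. -/

/-- The sign of `c` is arbitrary, as it must be for decay when `K < λ₁`. The inequality is therefore
required on all subintervals, so that it can be turned into `N' ≤ c N` for right difference
quotients. -/
theorem le_exp_mul_of_integral_inequality {N : ℝ → ℝ} {s t c : ℝ} (hst : s ≤ t)
    (hN : ContinuousOn N (Icc s t))
    (h : ∀ x y, s ≤ x → x ≤ y → y ≤ t → N y - N x ≤ c * ∫ τ in x..y, N τ) :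
    N t ≤ N s * Real.exp (c * (t - s)) := by
  have h1 := le_gronwallBound_of_liminf_deriv_right_le (f := N) (f' := fun x => c * N x)
    (δ := N s) (K := c) (ε := 0) hN (fun x hx r hr => ?_) le_rfl (fun x _ => by simp) t
    ⟨hst, le_rfl⟩
  · rwa [gronwallBound_ε0] at h1
  · have h2 := (hasDerivWithinAt_integral_of_continuousOn hN hx).const_mul c
    have h3 := (hasDerivWithinAt_iff_tendsto_slope' (by simp)).1 h2.Ioi_of_Ici
    have h4 := h3.eventually_lt_const hr
    refine Eventually.frequently ?_
    filter_upwards [h4, Ioc_mem_nhdsGT hx.2] with z hz hzt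
    refine lt_of_le_of_lt ?_ hz
    have h5 := h x z hx.1 hzt.1.le hzt.2
    rw [slope_def_field, intervalIntegral.integral_same, mul_zero, sub_zero, div_eq_inv_mul]
    exact mul_le_mul_of_nonneg_left h5 (inv_nonneg.2 (by linarith [hzt.1]))

namespace NonlinearityCond

variable {f : E3 → E3} {K C κ r : ℝ}

theorem differentiable (hf : NonlinearityCond f K C κ r) : Differentiable ℝ f :=
  hf.contDiff.differentiable (by simp)

/-- Mean value theorem for `s ↦ ⟨f (y + s v), v⟩` along the segment from `y` to `x`; the `κ` term is
nonnegative and is dropped. -/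
theorem neg_mul_le_inner_sub (hf : NonlinearityCond f K C κ r) (hκ : 0 < κ) (x y : E3) :
    -K * ‖x - y‖ ^ 2 ≤ inner ℝ (f x - f y) (x - y) := by
  set v := x - y with hv
  have hd : ∀ s : ℝ, HasDerivAt (fun s : ℝ => inner ℝ (f (y + s • v)) v)
      (inner ℝ (fderiv ℝ f (y + s • v) v) v) s := fun s => by
    have h1 : HasDerivAt (fun s : ℝ => y + s • v) v s := by
      simpa using ((hasDerivAt_id s).smul_const v).const_add y
    have h2 := (hf.differentiable (y + s • v)).hasFDerivAt.comp_hasDerivAt s h1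
    simpa using h2.inner ℝ (hasDerivAt_const s v)
  obtain ⟨s, -, hs⟩ := exists_hasDerivAt_eq_slope (fun s : ℝ => inner ℝ (f (y + s • v)) v) _
    one_pos (fun s _ => (hd s).continuousAt.continuousWithinAt) fun s _ => hd s
  have h3 := hf.monotone (y + s • v) v
  rw [hs] at h3
  simp only [one_smul, zero_smul, add_zero, sub_zero, div_one, ← inner_sub_left] at h3
  rw [hv, add_sub_cancel, ← hv] at h3
  refine le_trans ?_ h3
  have : 0 ≤ κ * ‖y + s • v‖ ^ (r - 1) := by positivity
  nlinarith [sq_nonneg ‖v‖]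

theorem norm_le (hf : NonlinearityCond f K C κ r) (hC : 0 < C) (hr : 1 ≤ r) (z : E3) :
    ‖f z‖ ≤ (‖f 0‖ + 2 * C) * max 1 ‖z‖ ^ r := by
  set M := max 1 ‖z‖ with hM
  have hM1 : 1 ≤ M := le_max_left _ _
  have hMz : ‖z‖ ≤ M := le_max_right _ _
  have hM0 : 0 < M := by linarith
  have h1 : ∀ y ∈ Metric.closedBall (0 : E3) ‖z‖, ‖fderiv ℝ f y‖ ≤ C * (1 + M ^ (r - 1)) :=
    fun y hy => by
      rw [mem_closedBall_zero_iff] at hy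
      refine (hf.growth y).trans ?_
      gcongr
      exact hy.trans hMz
  have h2 := (convex_closedBall (0 : E3) ‖z‖).norm_image_sub_le_of_norm_fderiv_le
    (fun y _ => hf.differentiable y) h1 (Metric.mem_closedBall_self (norm_nonneg z))
    (show z ∈ Metric.closedBall (0 : E3) ‖z‖ by simp)
  rw [sub_zero] at h2
  have h3 : 1 ≤ M ^ (r - 1) := Real.one_le_rpow hM1 (by linarith)
  have h4 : M ^ (r - 1) * M = M ^ r := by
    rw [← Real.rpow_add_one hM0.ne', sub_add_cancel]
  have h5 : 1 ≤ M ^ r := Real.one_le_rpow hM1 (by linarith)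
  calc ‖f z‖ ≤ ‖f 0‖ + ‖f z - f 0‖ := by
        simpa using norm_add_le (f 0) (f z - f 0)
    _ ≤ ‖f 0‖ * M ^ r + C * (2 * M ^ (r - 1)) * M := by
        refine add_le_add (le_mul_of_one_le_right (norm_nonneg _) h5) (h2.trans ?_)
        gcongr
        linarith
    _ = _ := by rw [← h4]; ring

/-- `(r + 1) / r` is the exponent conjugate to `r + 1`: growth of order `r` makes `f` map `L^{r+1}`
to the dual space, so that `(f(u), u)` is defined. -/
theorem enorm_rpow_le (hf : NonlinearityCond f K C κ r) (hC : 0 < C) (hr : 1 ≤ r) (z : E3) :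
    ‖f z‖ₑ ^ ((r + 1) / r) ≤
      ENNReal.ofReal (‖f 0‖ + 2 * C) ^ ((r + 1) / r) * (1 + ‖z‖ₑ ^ (r + 1)) := by
  have hr0 : 0 < r := by linarith
  have hM0 : 0 < max 1 ‖z‖ := lt_max_of_lt_left one_pos
  have h1 := ENNReal.ofReal_le_ofReal (hf.norm_le hC hr z)
  rw [ofReal_norm, ENNReal.ofReal_mul (by positivity), ← ENNReal.ofReal_rpow_of_pos hM0] at h1
  have h2 := ENNReal.rpow_le_rpow h1 (show 0 ≤ (r + 1) / r by positivity)
  rw [ENNReal.mul_rpow_of_nonneg _ _ (by positivity), ← ENNReal.rpow_mul,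
    mul_div_cancel₀ _ hr0.ne'] at h2
  refine h2.trans (mul_le_mul_right ?_ _)
  rcases le_total ‖z‖ 1 with h | h
  · rw [max_eq_left h]; simp
  · rw [max_eq_right h, ofReal_norm]; exact le_add_self

end NonlinearityCond

/-! ### The energy inequality for differences and the decay estimate. -/

/-- A function on an interval extends to a strongly measurable function in the same Lebesgue
space. -/
theorem exists_memLp_extension {X : Type*} [NormedAddCommGroup X] {a : ℝ → X} {P : ℝ≥0∞}
    {I : Set ℝ} (hI : MeasurableSet I) (ha : MemLp a P (volume.restrict I)) :
    ∃ a' : ℝ → X, StronglyMeasurable a' ∧ MemLp a' P volume ∧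
      ∀ᵐ t ∂(volume.restrict I), a' t = a t := by
  refine ⟨I.indicator (ha.1.mk a), ha.1.stronglyMeasurable_mk.indicator hI, ?_, ?_⟩
  · rw [memLp_indicator_iff_restrict hI]
    exact (memLp_congr_ae ha.1.ae_eq_mk).1 ha
  · filter_upwards [ha.1.ae_eq_mk, ae_restrict_mem hI] with t h1 h2
    rw [indicator_of_mem h2, ← h1]

theorem integral_inner_sub_right {α E : Type*} [MeasurableSpace α] {μ : Measure α}
    [NormedAddCommGroup E] [InnerProductSpace ℝ E] {P Q : ℝ≥0∞} [ENNReal.HolderConjugate P Q]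
    {v : α → E} (hv : MemLp v P μ) (a b : Lp E Q μ) :
    ∫ x, inner ℝ (v x) ((a - b : Lp E Q μ) x) ∂μ =
      (∫ x, inner ℝ (v x) (a x) ∂μ) - ∫ x, inner ℝ (v x) (b x) ∂μ := by
  rw [← integral_sub (integrable_inner hv (Lp.memLp a)) (integrable_inner hv (Lp.memLp b))]
  refine integral_congr_ae ((Lp.coeFn_sub a b).mono fun x hx => ?_)
  simp only [hx, Pi.sub_apply, inner_sub_right]

/-- Increments tested with a test field, in terms of the time integrals of the forces. -/
theorem increment_eq_of_weak_increment {Ω : Set E3} (hΩo : IsOpen Ω) (hΩb : Bornology.IsBounded Ω)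
    {P Q : ℝ≥0∞} [Fact (1 ≤ P)] [Fact (1 ≤ Q)] [ENNReal.HolderConjugate P Q] {T : ℝ}
    {G : ℝ → L2Grad Ω} {A : ℝ → Lp E3 Q (volume.restrict Ω)} {us ut : L2 Ω}
    (hG : MemLp G 2 (volume.restrict (Ioo 0 T))) (hA : MemLp A Q (volume.restrict (Ioo 0 T)))
    {φ : E3 → E3} (hφ : φ ∈ testFields Ω) {s t γ : ℝ} (hs : 0 < s) (ht : t < T)
    (h : (∫ x in Ω, inner ℝ (φ x) (ut x)) - (∫ x in Ω, inner ℝ (φ x) (us x)) =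
      ∫ τ in Ioc s t, (-(∫ x in Ω, inner ℝ (grad φ x) (G τ x))
        - (∫ x in Ω, inner ℝ (φ x) (A τ x)) + γ)) :
    (∫ x in Ω, inner ℝ (φ x) ((ut - us : L2 Ω) x)) +
      (∫ x in Ω, inner ℝ (grad φ x) ((∫ τ in Ioc s t, G τ : L2Grad Ω) x)) +
      (∫ x in Ω, inner ℝ (φ x) ((∫ τ in Ioc s t, A τ : Lp E3 Q (volume.restrict Ω)) x)) =
      ∫ _ in Ioc s t, γ := by
  have hsub : Ioc s t ⊆ Ioo 0 T := fun x hx => ⟨hs.trans hx.1, hx.2.trans_lt ht⟩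
  have hG1 : IntegrableOn G (Ioc s t) :=
    (hG.mono_measure (Measure.restrict_mono_set _ hsub)).integrable one_le_two
  have hA1 : IntegrableOn A (Ioc s t) :=
    (hA.mono_measure (Measure.restrict_mono_set _ hsub)).integrable Fact.out
  have hφP := testFields.memLp hΩo hΩb hφ P
  have hgφ := testFields.memLp_grad hΩo hΩb hφ 2
  have i1 := integrable_integral_inner hG1 hgφ
  have i2 := integrable_integral_inner hA1 hφP
  have i3 := i1.fun_neg.sub' i2
  rw [integral_inner_sub_right (testFields.memLp hΩo hΩb hφ 2), h,
    integral_inner_integral hG1 hgφ, integral_inner_integral hA1 hφP,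
    integral_add i3 (integrable_const _), integral_sub i1.fun_neg i2, integral_neg]
  ring

/-- The increment and the time-integrated forces form one functional that vanishes on test fields,
hence on `V ∩ L^P`. Integrating in time before testing means that the approximation is needed for a
single element `v` only; Fubini then releases the time integral. -/
theorem inner_add_integral_eq_zero_of_annihilator {Ω : Set E3} (hΩo : IsOpen Ω)
    (hΩb : Bornology.IsBounded Ω) (hΩ : HasC2Boundary Ω) {P Q : ℝ≥0∞} [Fact (1 ≤ P)]
    [Fact (1 ≤ Q)] [ENNReal.HolderConjugate P Q] [ENNReal.HolderConjugate Q P] (hP : P ≠ ⊤)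
    (hQ : Q ≠ ⊤) {ν : Measure ℝ} {h : L2 Ω} {Γ : ℝ → L2Grad Ω}
    {a : ℝ → Lp E3 Q (volume.restrict Ω)} (hΓ : Integrable Γ ν) (ha : Integrable a ν)
    (hvan : ∀ φ ∈ testFields Ω, (∫ y in Ω, inner ℝ (φ y) (h y)) +
      (∫ y in Ω, inner ℝ (grad φ y) ((∫ τ, Γ τ ∂ν : L2Grad Ω) y)) +
      (∫ y in Ω, inner ℝ (φ y) ((∫ τ, a τ ∂ν : Lp E3 Q (volume.restrict Ω)) y)) = 0)
    {v : L2 Ω} {G : L2Grad Ω} (hp : (v, G) ∈ closure (testPairs Ω))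
    {b : Lp E3 P (volume.restrict Ω)} (hb : b =ᵐ[volume.restrict Ω] v) :
    inner ℝ h v +
      ∫ τ, (inner ℝ (Γ τ) G + innerPairing E3 (volume.restrict Ω) Q P (a τ) b) ∂ν = 0 := by
  have hvP : MemLp v P (volume.restrict Ω) := (memLp_congr_ae hb).1 (Lp.memLp b)
  have hann := annihilator_extends hΩo hΩb hΩ hP hQ (Lp.memLp h) (Lp.memLp (∫ τ, Γ τ ∂ν))
    (Lp.memLp (∫ τ, a τ ∂ν)) hvan hp hvP
  simp only at hann
  rw [integral_inner_integral ha hvP, integral_inner_integral hΓ (Lp.memLp G)] at hann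
  have g1 : inner ℝ h v = ∫ y in Ω, inner ℝ (v y) (h y) := by
    rw [real_inner_comm, L2.inner_def]
  have g2 : ∀ τ, inner ℝ (Γ τ) G = ∫ y in Ω, inner ℝ (G y) (Γ τ y) := fun τ => by
    rw [real_inner_comm, L2.inner_def]
  have g3 : ∀ τ, innerPairing E3 (volume.restrict Ω) Q P (a τ) b =
      ∫ y in Ω, inner ℝ (v y) (a τ y) := fun τ =>
    (innerPairing_eq (EventuallyEq.refl _ _) hb).trans
      (integral_congr_ae (Eventually.of_forall fun y => real_inner_comm _ _))
  simp only [g2, g3]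
  rw [integral_add (integrable_integral_inner hΓ (Lp.memLp G)) (integrable_integral_inner ha hvP),
    g1, ← add_assoc]
  exact hann

/-- The energy inequality for the difference of two weak solutions. -/
theorem energy_inequality {Ω : Set E3} (hΩo : IsOpen Ω) (hΩb : Bornology.IsBounded Ω)
    (hΩ : HasC2Boundary Ω) {K C κ r lam : ℝ} (hC : 0 < C) (hκ : 0 < κ) (hr : 1 ≤ r)
    {f g : E3 → E3} (hf : NonlinearityCond f K C κ r)
    (hlam : ∀ p ∈ closure (testPairs Ω), lam * ‖p.1‖ ^ 2 ≤ ‖p.2‖ ^ 2) {u₁ u₂ : ℝ → L2 Ω}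
    (h₁ : IsWeakSolution Ω r f g u₁) (h₂ : IsWeakSolution Ω r f g u₂) {s t : ℝ} (hs : 0 < s)
    (hst : s ≤ t) :
    ‖u₁ t - u₂ t‖ ^ 2 - ‖u₁ s - u₂ s‖ ^ 2 ≤
      2 * (K - lam) * ∫ τ in Ioc s t, ‖u₁ τ - u₂ τ‖ ^ 2 := by
  have hr0 : 0 < r := by linarith
  set q := (r + 1) / r with hq
  have hq1 : 1 ≤ q := by rw [hq, le_div_iff₀ hr0]; linarith
  have hpq : (r + 1).HolderConjugate q := by
    rw [Real.holderConjugate_iff]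
    refine ⟨by linarith, ?_⟩
    rw [hq]; field_simp; ring
  have i1 : Fact (1 ≤ ENNReal.ofReal (r + 1)) := ⟨by simpa using hr0.le⟩
  have i2 : Fact (1 ≤ ENNReal.ofReal q) := ⟨by simpa using hq1⟩
  have i3 : ENNReal.HolderConjugate (ENNReal.ofReal (r + 1)) (ENNReal.ofReal q) :=
    hpq.ennrealOfReal
  have i4 : ENNReal.HolderConjugate (ENNReal.ofReal q) (ENNReal.ofReal (r + 1)) :=
    hpq.symm.ennrealOfReal
  have i5 := isFiniteMeasure_restrict_of_isBounded hΩb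
  have hD : ENNReal.ofReal (‖f 0‖ + 2 * C) ^ q ≠ ⊤ :=
    ENNReal.rpow_ne_top_of_nonneg (by linarith) ENNReal.ofReal_ne_top
  have hforces : ∀ {u : ℝ → L2 Ω}, IsWeakSolution Ω r f g u → _ := fun hu =>
    IsWeakSolution.exists_forces hΩo hΩb hr hq1 hf.differentiable.continuous hD
      (hf.enorm_rpow_le hC hr) hu
  set T := t + 1 with hT
  have hT0 : 0 < T := by linarith
  have htT : t < T := by linarith
  obtain ⟨G₁, hG₁⟩ := hforces h₁
  obtain ⟨A₁, U₁, hG₁2, hA₁, hU₁, hae₁, hinc₁⟩ := hG₁ T hT0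
  obtain ⟨G₂, hG₂⟩ := hforces h₂
  obtain ⟨A₂, U₂, hG₂2, hA₂, hU₂, hae₂, hinc₂⟩ := hG₂ T hT0
  -- The energy identity translates in time, so the differences of gradients, forces and fields are
  -- extended from `(0, T)` to the whole line.
  obtain ⟨Γ, hΓs, hΓ, hΓeq⟩ := exists_memLp_extension measurableSet_Ioo (hG₁2.sub hG₂2)
  obtain ⟨a, has, ha, haeq⟩ := exists_memLp_extension measurableSet_Ioo (hA₁.sub hA₂)
  obtain ⟨b, hbs, hb, hbeq⟩ := exists_memLp_extension measurableSet_Ioo (hU₁.sub hU₂)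
  set w : ℝ → L2 Ω := fun x => u₁ x - u₂ x with hw
  have hwc : ContinuousOn w (Ici 0) := h₁.continuousOn.sub h₂.continuousOn
  have hgood : ∀ᵐ x ∂(volume.restrict (Ioo 0 T)), (w x, Γ x) ∈ closure (testPairs Ω) ∧
      a x =ᵐ[volume.restrict Ω] (fun y => f (u₁ x y) - f (u₂ x y)) ∧
      b x =ᵐ[volume.restrict Ω] w x := by
    filter_upwards [hae₁, hae₂, hΓeq, haeq, hbeq] with x e1 e2 e3 e4 e5
    rw [e3, e4, e5]
    exact ⟨closure_testPairs.sub_mem e1.1 e2.1, (Lp.coeFn_sub _ _).trans (e1.2.1.sub e2.2.1),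
      (Lp.coeFn_sub _ _).trans ((e1.2.2.sub e2.2.2).trans (Lp.coeFn_sub _ _).symm)⟩
  have henergy := energy_identity (innerPairing E3 (volume.restrict Ω) (ENNReal.ofReal q)
    (ENNReal.ofReal (r + 1))) (T := T) ENNReal.ofReal_ne_top ENNReal.ofReal_ne_top
    (hwc.mono (Ioo_subset_Ioi_self.trans Ioi_subset_Ici_self)) hΓ hΓs ha has hb hbs ?_ hs hst htT
  -- The dissipation is bounded below by the Rayleigh quotient, the nonlinear term by the one-sided
  -- bound on `f`.
  · have hbound : ∀ᵐ x ∂(volume.restrict (Ioc s t)), (lam - K) * ‖w x‖ ^ 2 ≤ ‖Γ x‖ ^ 2 +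
        innerPairing E3 (volume.restrict Ω) (ENNReal.ofReal q) (ENNReal.ofReal (r + 1))
          (a x) (b x) := by
      filter_upwards [ae_restrict_of_ae_restrict_of_subset
        (fun x hx => (⟨hs.trans hx.1, hx.2.trans_lt htT⟩ : x ∈ Ioo 0 T)) hgood]
        with x ⟨e1, e2, e3⟩
      have f1 := hlam _ e1
      have f2 : -K * ‖w x‖ ^ 2 ≤ innerPairing E3 (volume.restrict Ω) (ENNReal.ofReal q)
          (ENNReal.ofReal (r + 1)) (a x) (b x) := by
        rw [innerPairing_eq (EventuallyEq.refl _ _) (EventuallyEq.refl _ _),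
          ← real_inner_self_eq_norm_sq, L2.inner_def, ← integral_const_mul]
        refine integral_mono_ae ((L2.integrable_inner _ _).const_mul _)
          (integrable_inner (Lp.memLp (a x)) (Lp.memLp (b x))) ?_
        filter_upwards [e2, e3, Lp.coeFn_sub (u₁ x) (u₂ x)] with y k1 k2 k3
        have k4 : w x y = u₁ x y - u₂ x y := k3
        rw [k1, k2, k4, real_inner_self_eq_norm_sq]
        exact hf.neg_mul_le_inner_sub hκ _ _
      simp only at f1
      linarith
    have hwi : IntegrableOn (fun x => ‖w x‖ ^ 2) (Ioc s t) :=
      (((hwc.mono fun x hx => hs.le.trans hx.1).norm.pow 2).integrableOn_Icc (a := s)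
        (b := t)).mono_set Ioc_subset_Icc_self
    have hmono : ∫ τ in Ioc s t, (lam - K) * ‖w τ‖ ^ 2 ≤ ∫ τ in Ioc s t, (‖Γ τ‖ ^ 2 +
        innerPairing E3 (volume.restrict Ω) (ENNReal.ofReal q) (ENNReal.ofReal (r + 1))
          (a τ) (b τ)) := integral_mono_ae (hwi.const_mul (lam - K))
      (((hΓ.integrable_norm_pow two_ne_zero).integrableOn).add
        ((integrable_pairing _ ha hb).integrableOn)) hbound
    rw [integral_const_mul] at hmono
    rw [henergy]
    linarith
  · filter_upwards [ae_imp_of_ae_restrict hgood] with x hx hxT s t hs hst htT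
    obtain ⟨e1, e2, e3⟩ := hx hxT
    have hsub : Ioc s t ⊆ Ioo 0 T := fun x hx => ⟨hs.trans hx.1, hx.2.trans_lt htT⟩
    have hΓi : IntegrableOn Γ (Ioc s t) := (hΓ.restrict _).integrable one_le_two
    have hai : IntegrableOn a (Ioc s t) := (ha.restrict _).integrable Fact.out
    have hint : ∀ {X : Type} [NormedAddCommGroup X] [NormedSpace ℝ X] {P : ℝ≥0∞} (_ : 1 ≤ P)
        {c c₁ c₂ : ℝ → X} (_ : MemLp c₁ P (volume.restrict (Ioo 0 T)))
        (_ : MemLp c₂ P (volume.restrict (Ioo 0 T)))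
        (_ : ∀ᵐ y ∂(volume.restrict (Ioo 0 T)), c y = (c₁ - c₂) y),
        ∫ τ in Ioc s t, c τ = (∫ τ in Ioc s t, c₁ τ) - ∫ τ in Ioc s t, c₂ τ :=
      fun hP c c₁ c₂ k1 k2 k3 => by
        rw [← integral_sub ((k1.mono_measure (Measure.restrict_mono_set _ hsub)).integrable hP)
          ((k2.mono_measure (Measure.restrict_mono_set _ hsub)).integrable hP)]
        exact integral_congr_ae (ae_restrict_of_ae_restrict_of_subset hsub k3)
    -- The two increment formulas are subtracted; the contribution of `g` is the same in both and
    -- cancels.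
    have hvan : ∀ φ ∈ testFields Ω, (∫ y in Ω, inner ℝ (φ y) ((w t - w s : L2 Ω) y)) +
        (∫ y in Ω, inner ℝ (grad φ y) ((∫ τ in Ioc s t, Γ τ : L2Grad Ω) y)) +
        (∫ y in Ω, inner ℝ (φ y) ((∫ τ in Ioc s t, a τ :
          Lp E3 (ENNReal.ofReal q) (volume.restrict Ω)) y)) = 0 := fun φ hφ => by
      have k1 := increment_eq_of_weak_increment (P := ENNReal.ofReal (r + 1)) hΩo hΩb hG₁2 hA₁ hφ
        hs htT (hinc₁ φ hφ s t hs hst htT)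
      have k2 := increment_eq_of_weak_increment (P := ENNReal.ofReal (r + 1)) hΩo hΩb hG₂2 hA₂ hφ
        hs htT (hinc₂ φ hφ s t hs hst htT)
      have hw' : w t - w s = (u₁ t - u₁ s) - (u₂ t - u₂ s) := by simp only [hw]; abel
      have d1 := integral_inner_sub_right (testFields.memLp hΩo hΩb hφ 2) (u₁ t - u₁ s)
        (u₂ t - u₂ s)
      have d2 := integral_inner_sub_right (testFields.memLp_grad hΩo hΩb hφ 2)
        (∫ τ in Ioc s t, G₁ τ) (∫ τ in Ioc s t, G₂ τ)
      have d3 := integral_inner_sub_right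
        (testFields.memLp hΩo hΩb hφ (ENNReal.ofReal (r + 1)))
        (∫ τ in Ioc s t, A₁ τ) (∫ τ in Ioc s t, A₂ τ)
      rw [hw', hint one_le_two hG₁2 hG₂2 hΓeq, hint Fact.out hA₁ hA₂ haeq, d1, d2, d3]
      linarith
    exact inner_add_integral_eq_zero_of_annihilator hΩo hΩb hΩ ENNReal.ofReal_ne_top
      ENNReal.ofReal_ne_top hΓi hai hvan e1 e3

theorem norm_sub_le_exp_mul {Ω : Set E3} (hΩo : IsOpen Ω) (hΩb : Bornology.IsBounded Ω)
    (hΩ : HasC2Boundary Ω) {K C κ r lam : ℝ} (hC : 0 < C) (hκ : 0 < κ) (hr : 1 ≤ r)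
    {f g : E3 → E3} (hf : NonlinearityCond f K C κ r)
    (hlam : ∀ p ∈ closure (testPairs Ω), lam * ‖p.1‖ ^ 2 ≤ ‖p.2‖ ^ 2) {u₁ u₂ : ℝ → L2 Ω}
    (h₁ : IsWeakSolution Ω r f g u₁) (h₂ : IsWeakSolution Ω r f g u₂) {t : ℝ} (ht : 0 ≤ t) :
    ‖u₁ t - u₂ t‖ ≤ Real.exp ((K - lam) * t) * ‖u₁ 0 - u₂ 0‖ := by
  set N : ℝ → ℝ := fun x => ‖u₁ x - u₂ x‖ ^ 2 with hN
  have hNc : ContinuousOn N (Ici 0) := (h₁.continuousOn.sub h₂.continuousOn).norm.pow 2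
  have hmain : N t ≤ N 0 * Real.exp (2 * (K - lam) * t) := by
    rcases ht.eq_or_lt with rfl | ht0
    · simp
    -- Test functions are supported in positive times, so the energy inequality starts at `s > 0`;
    -- the limit `s → 0` uses continuity up to time zero.
    have hpos : ∀ s ∈ Ioc 0 t, N t ≤ N s * Real.exp (2 * (K - lam) * (t - s)) := fun s hs =>
      le_exp_mul_of_integral_inequality hs.2
        (hNc.mono fun x hx => hs.1.le.trans hx.1) fun x y hx hxy hy => by
          rw [intervalIntegral.integral_of_le hxy]
          exact energy_inequality hΩo hΩb hΩ hC hκ hr hf hlam h₁ h₂ (hs.1.trans_le hx) hxy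
    have hlim : Tendsto (fun s => N s * Real.exp (2 * (K - lam) * (t - s))) (𝓝[>] 0)
        (𝓝 (N 0 * Real.exp (2 * (K - lam) * (t - 0)))) := by
      refine Tendsto.mul ((hNc 0 (by simp)).mono Ioi_subset_Ici_self) ?_
      exact Tendsto.mono_left (Continuous.tendsto (by fun_prop) 0) nhdsWithin_le_nhds
    rw [sub_zero] at hlim
    refine ge_of_tendsto hlim ?_
    filter_upwards [Ioc_mem_nhdsGT ht0] with s hs using hpos s hs
  refine (pow_le_pow_iff_left₀ (norm_nonneg _) (by positivity) two_ne_zero).1 ?_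
  rw [mul_pow, ← Real.exp_nat_mul]
  calc _ ≤ _ := hmain
    _ = _ := by
      rw [mul_comm]
      simp only [hN]
      congr 2
      push_cast
      ring

end BrinkmanForchheimer

end

theorem mainTheorem10
    (Ω : Set BrinkmanForchheimer.E3) (hΩ_open : IsOpen Ω) (hΩ_ne : Ω.Nonempty)
    (hΩ_bdd : Bornology.IsBounded Ω) (hΩ_bdry : BrinkmanForchheimer.HasC2Boundary Ω)
    (K C κ r : ℝ) (hK : 0 < K) (hC : 0 < C) (hκ : 0 < κ) (hr : 1 ≤ r)
    (f : BrinkmanForchheimer.E3 → BrinkmanForchheimer.E3)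
    (hf : BrinkmanForchheimer.NonlinearityCond f K C κ r)
    (g : BrinkmanForchheimer.E3 → BrinkmanForchheimer.E3)
    (hg : MeasureTheory.LocallyIntegrableOn g Ω) :
    (∀ (u₀ : BrinkmanForchheimer.L2 Ω) (u₁ u₂ : ℝ → BrinkmanForchheimer.L2 Ω),
      BrinkmanForchheimer.IsWeakSolution Ω r f g u₁ →
      BrinkmanForchheimer.IsWeakSolution Ω r f g u₂ →
      u₁ 0 = u₀ → u₂ 0 = u₀ → ∀ t : ℝ, 0 ≤ t → u₁ t = u₂ t) ∧
    ∃ lam₁ : ℝ, 0 < lam₁ ∧ IsLeast (BrinkmanForchheimer.stokesEigenvalues Ω) lam₁ ∧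
      ∀ u₁ u₂ : ℝ → BrinkmanForchheimer.L2 Ω,
        BrinkmanForchheimer.IsWeakSolution Ω r f g u₁ →
        BrinkmanForchheimer.IsWeakSolution Ω r f g u₂ →
        ∀ t : ℝ, 0 ≤ t →
          ‖u₁ t - u₂ t‖ ≤ Real.exp ((K - lam₁) * t) * ‖u₁ 0 - u₂ 0‖ := by
  obtain ⟨lam, hlam, hleast, hpoin⟩ :=
    BrinkmanForchheimer.exists_isLeast_stokesEigenvalues hΩ_open hΩ_ne hΩ_bdd
  refine ⟨fun u₀ u₁ u₂ h₁ h₂ h0₁ h0₂ t ht => ?_, lam, hlam, hleast, fun u₁ u₂ h₁ h₂ t ht => ?_⟩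
  · have h := BrinkmanForchheimer.norm_sub_le_exp_mul hΩ_open hΩ_bdd hΩ_bdry hC hκ hr hf hpoin
      h₁ h₂ ht
    rw [h0₁, h0₂, sub_self, norm_zero, mul_zero] at h
    exact sub_eq_zero.1 (norm_le_zero_iff.1 h)
  · exact BrinkmanForchheimer.norm_sub_le_exp_mul hΩ_open hΩ_bdd hΩ_bdry hC hκ hr hf hpoin
      h₁ h₂ ht
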